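/- Let $D=[0,\infty)$ or $D=\mathbb{R}$, and let the risk-neutral short rate $(r_t)_{t\ge 0}$ be a one-dimensional regular, conservative affine process with state space $D$: a stochastically continuous time-homogeneous Markov process with càdlàg paths in $D$ and laws $(\mathbb{P}^x)_{x\in D}$ such that $\mathbb{E}^x[e^{u r_t}]=\exp(\phi(t,u)+x\psi(t,u))$ for all $x\in D$, $t\ge 0$ and $u\in\mathcal{U}$, where $\mathcal{U}=\{\operatorname{Re}u\le 0\}$ if $D=[0,\infty)$ and $\mathcal{U}=\{\operatorname{Re}u=0\}$ if $D=\mathbb{R}$, and such that the right derivatives $F(u)=\partial_t\phi(t,u)|_{t=0+}$ and $R(u)=\partial_t\psi(t,u)|_{t=0+}$ exist for all $u\in\mathcal{U}$ and are continuous at $u=0$. The functions $F$ and $R$ are regarded as functions on $(-\infty,0]$; if $D=\mathbb{R}$ they are extended there, with values in $(-\infty,\infty]$, by their Lévy–Khintchine formula. If $D=\mathbb{R}$, in which case necessarily $R(x)=\beta x$ for some $\beta\in\mathbb{R}$, assume in addition that $F(x)<\infty$ for all $x\in(1/\beta,0]$ if $\beta<0$, and for all $x\in(-\infty,0]$ otherwise.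 Assume that the equation $R(c)=1$ has a (necessarily unique) negative solution $c$, i.e. that the quasi-mean-reversion $\lambda=-1/c$ is positive, that $F\neq 0$, and that at least one of $F$ and $R$ is not linear. For a current short rate $r\in D$ and time-to-maturity $x>0$ let $P(x,r)=\mathbb{E}^r\big[\exp\big(-\int_0^x r_s\,ds\big)\big]$ be the zero-coupon bond price and $Y(x,r)=-\frac{1}{x}\log P(x,r)$ the yield. Call the yield curve $Y(\cdot,r)$ normal if it is strictly increasing on $(0,\infty)$, inverse if it is strictly decreasing on $(0,\infty)$, and humped if it has exactly one local maximum and no local minimum in $(0,\infty)$. Then for every $r\in D$: 1. The yield curve $Y(\cdot,r)$ is normal, inverse or humped. 2. Define, with values in $[-\infty,\infty]$, $$b_{\text{y-norm}}=\frac1c\int_c^0\frac{F(u)-F(c)}{R(u)-1}\,du,\qquad b_{\text{inv}}=\begin{cases}-F'(0)/R'(0)&\text{if }R'(0)<0,\\+\infty&\text{if }R'(0)\ge 0,\end{cases}$$ where $F'(0)$ and $R'(0)$ are left derivatives (possibly $+\infty$), and $b_{\text{y-norm}}=-\infty$ if $F(c)=\infty$ or the integral diverges. The yield curve $Y(\cdot,r)$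 is normal if $r\le b_{\text{y-norm}}$, humped if $b_{\text{y-norm}}<r<b_{\text{inv}}$, and inverse if $r\ge b_{\text{inv}}$. -/

import Mathlib

open Set Filter Topology MeasureTheory ProbabilityTheory
open scoped NNReal ENNReal

noncomputable section

namespace AffineYield

/-- The two possible state spaces of a one-dimensional affine process: `[0, ∞)` and `ℝ`. -/
inductive StateSpace where
  | halfLine : StateSpace
  | line : StateSpace

namespace StateSpace

/-- The state space `D` as a set of real numbers. -/
def carrier : StateSpace → Set ℝ
  | halfLine => Set.Ici 0
  | line => Set.univ

/-- The set `𝒰` of complex `u` for which `y ↦ exp (u y)` is bounded on `D`. -/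
def frequencies : StateSpace → Set ℂ
  | halfLine => {u | u.re ≤ 0}
  | line => {u | u.re = 0}

end StateSpace

/-- The information generated by the process `r` up to time `s`. -/
abbrev past {Ω E : Type*} [MeasurableSpace E] (r : ℝ≥0 → Ω → E) (s : ℝ≥0) : MeasurableSpace Ω :=
  ⨆ u : Set.Iic s, MeasurableSpace.comap (r u) inferInstance

/-- A regular conservative affine process with state space `D`: a time-homogeneous Markov process
(the process `r` under the laws `P x`, where `x` is the starting point) with càdlàg paths whose
transition laws are stochastically continuous and have Fourier-Laplace transforms that are
exponentially affine in the starting point; regularity says that the exponents `φ, ψ` have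
right derivatives `F, R` at time zero, continuous at `u = 0`.  It is conservative because every
`P x` is a probability measure under which `r` never leaves `D`. -/
structure AffineProcess (D : StateSpace) (Ω : Type*) [MeasurableSpace Ω] where
  /-- the short rate process -/
  r : ℝ≥0 → Ω → D.carrier
  /-- the laws, indexed by the starting point -/
  P : Kernel D.carrier Ω
  /-- the constant part of the exponent -/
  φ : ℝ → ℂ → ℂ
  /-- the linear part of the exponent -/
  ψ : ℝ → ℂ → ℂ
  /-- the right derivative of `φ` at time zero -/
  F : ℂ → ℂ
  /-- the right derivative of `ψ` at time zero -/
  R : ℂ → ℂ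
  conservative : IsMarkovKernel P
  measurable_r : ∀ t, Measurable (r t)
  start : ∀ x, ∀ᵐ ω ∂(P x), r 0 ω = x
  markov : ∀ (x : D.carrier) (s t : ℝ≥0) (f : D.carrier → ℂ), Measurable f →
    (∃ C : ℝ, ∀ y, ‖f y‖ ≤ C) →
    (P x)[fun ω => f (r (s + t) ω) | past r s] =ᵐ[P x] fun ω => ∫ ω', f (r t ω') ∂(P (r s ω))
  cadlag : ∀ x, ∀ᵐ ω ∂(P x), ∀ t : ℝ≥0,
    ContinuousWithinAt (fun s => (r s ω : ℝ)) (Set.Ici t) t ∧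
      ∃ l : ℝ, Tendsto (fun s => (r s ω : ℝ)) (𝓝[<] t) (𝓝 l)
  stochasticallyContinuous : ∀ (x : D.carrier) (t : ℝ≥0) (f : BoundedContinuousFunction D.carrier ℝ),
    Tendsto (fun s => ∫ ω, f (r s ω) ∂(P x)) (𝓝 t) (𝓝 (∫ ω, f (r t ω) ∂(P x)))
  affine : ∀ (x : D.carrier) (t : ℝ≥0), ∀ u ∈ D.frequencies,
    ∫ ω, Complex.exp (u * ((r t ω : ℝ) : ℂ)) ∂(P x)
      = Complex.exp (φ t u + ((x : ℝ) : ℂ) * ψ t u)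
  hasDeriv_φ : ∀ u ∈ D.frequencies, HasDerivWithinAt (fun t : ℝ => φ t u) (F u) (Set.Ici 0) 0
  hasDeriv_ψ : ∀ u ∈ D.frequencies, HasDerivWithinAt (fun t : ℝ => ψ t u) (R u) (Set.Ici 0) 0
  continuous_F : ContinuousWithinAt F D.frequencies 0
  continuous_R : ContinuousWithinAt R D.frequencies 0

/-- The integral of an extended-real function, as an extended real number: the integral of the
positive part minus the integral of the negative part. -/
def eintegral (μ : Measure ℝ) (g : ℝ → EReal) : EReal :=
  ((∫⁻ x, (g x).toENNReal ∂μ : ℝ≥0∞) : EReal) - ((∫⁻ x, (-g x).toENNReal ∂μ : ℝ≥0∞) : EReal)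

/-- A Lévy triplet: Gaussian part, drift and jump measure. -/
structure LevyTriplet where
  /-- the Gaussian part -/
  a : ℝ
  /-- the drift -/
  b : ℝ
  /-- the jump measure -/
  m : Measure ℝ
  a_nonneg : 0 ≤ a
  m_zero : m {0} = 0
  m_integrable : ∫⁻ ξ, ENNReal.ofReal (min 1 (ξ ^ 2)) ∂m < ∞

/-- The truncation function `ξ ↦ ξ 𝟙_{|ξ| ≤ 1}`. -/
def truncation (ξ : ℝ) : ℝ := if |ξ| ≤ 1 then ξ else 0

namespace LevyTriplet

/-- The Lévy-Khintchine exponent at a complex frequency (used for imaginary `u` only, where the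
integral converges absolutely). -/
def exponent (T : LevyTriplet) (u : ℂ) : ℂ :=
  (T.a : ℂ) / 2 * u ^ 2 + (T.b : ℂ) * u
    + ∫ ξ, (Complex.exp (u * (ξ : ℂ)) - 1 - u * (truncation ξ : ℂ)) ∂T.m

/-- The Lévy-Khintchine exponent at a real point, with values in `(-∞, ∞]`. -/
def realExponent (T : LevyTriplet) (x : ℝ) : EReal :=
  ((T.a / 2 * x ^ 2 + T.b * x : ℝ) : EReal)
    + eintegral T.m (fun ξ => ((Real.exp (x * ξ) - 1 - x * truncation ξ : ℝ) : EReal))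

end LevyTriplet

open Classical in
/-- The extension to the real line of a function given on the imaginary axis in
Lévy-Khintchine form (the triplet is uniquely determined by the function). -/
def levyExtension (f : ℂ → ℂ) (x : ℝ) : EReal :=
  if h : ∃ T : LevyTriplet, ∀ u : ℂ, u.re = 0 → f u = T.exponent u then
    (Classical.choose h).realExponent x
  else ⊤

/-- The function `f` on `𝒰` as an extended-real function on `(-∞, 0]`: if `D = [0, ∞)` then
`(-∞, 0] ⊆ 𝒰`, and `f` is real there; if `D = ℝ` then `f` is extended by its Lévy-Khintchine
formula. -/
def realVersion : StateSpace → (ℂ → ℂ) → ℝ → EReal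
  | StateSpace.halfLine, f, x => (((f (x : ℂ)).re : ℝ) : EReal)
  | StateSpace.line, f, x => levyExtension f x

/-- The left derivative at zero, as an extended real number (for convex functions the
difference quotient is monotone, so that the limit exists). -/
def leftDerivZero (f : ℝ → EReal) : EReal :=
  limsup (fun u : ℝ => (f u - f 0) / (u : EReal)) (𝓝[<] 0)

/-- `f` is a linear function on `(-∞, 0]`. -/
def IsLinearFun (f : ℝ → EReal) : Prop :=
  ∃ k : ℝ, ∀ u : ℝ, u ≤ 0 → f u = ((k * u : ℝ) : EReal)

namespace AffineProcess

variable {D : StateSpace} {Ω : Type*} [MeasurableSpace Ω]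

/-- `F` on `(-∞, 0]`. -/
def realF (X : AffineProcess D Ω) : ℝ → EReal := realVersion D X.F

/-- `R` on `(-∞, 0]`. -/
def realR (X : AffineProcess D Ω) : ℝ → EReal := realVersion D X.R

/-- The integrability condition on `F` for the state space `ℝ` (regularity and conservativity
are part of `AffineProcess`). -/
def FiniteCondition (X : AffineProcess D Ω) : Prop :=
  D = StateSpace.line → ∀ β : ℝ, (∀ x : ℝ, x ≤ 0 → X.realR x = ((β * x : ℝ) : EReal)) →
    ∀ x ∈ (if β < 0 then Set.Ioc (1 / β) 0 else Set.Iic 0), X.realF x < ⊤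

/-- `lam` is the quasi-mean-reversion: `-1 / c` if `c` is the negative solution of `R c = 1`, and
`0` if there is no such solution. -/
def IsQuasiMeanReversion (X : AffineProcess D Ω) (lam : ℝ) : Prop :=
  (∃ c : ℝ, c < 0 ∧ X.realR c = 1 ∧ lam = -1 / c) ∨
    ((¬ ∃ c : ℝ, c < 0 ∧ X.realR c = 1) ∧ lam = 0)

/-- The price of the zero-coupon bond with time-to-maturity `T` when the current short rate
is `x`. -/
def bondPrice (X : AffineProcess D Ω) (T : ℝ) (x : D.carrier) : ℝ :=
  ∫ ω, Real.exp (-∫ s in (0 : ℝ)..T, (X.r s.toNNReal ω : ℝ)) ∂(X.P x)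

/-- The yield for time-to-maturity `T` when the current short rate is `x`. -/
def yield (X : AffineProcess D Ω) (T : ℝ) (x : D.carrier) : ℝ :=
  -Real.log (X.bondPrice T x) / T

/-- The boundary between normal and humped yield curves. -/
def bYNorm (X : AffineProcess D Ω) (c : ℝ) : EReal :=
  ((1 / c : ℝ) : EReal) * eintegral (volume.restrict (Set.Ioo c 0))
    (fun u => (X.realF u - X.realF c) / (X.realR u - 1))

open Classical in
/-- The boundary between humped and inverse yield curves. -/
def bInv (X : AffineProcess D Ω) : EReal :=
  if leftDerivZero X.realR < 0 then -leftDerivZero X.realF / leftDerivZero X.realR else ⊤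

end AffineProcess

/-- A normal curve: strictly increasing on `(0, ∞)`. -/
def IsNormal (y : ℝ → ℝ) : Prop := StrictMonoOn y (Set.Ioi 0)

/-- An inverse curve: strictly decreasing on `(0, ∞)`. -/
def IsInverse (y : ℝ → ℝ) : Prop := StrictAntiOn y (Set.Ioi 0)

/-- A humped curve: exactly one local maximum and no local minimum in `(0, ∞)`. -/
def IsHumped (y : ℝ → ℝ) : Prop :=
  (∃! x : ℝ, 0 < x ∧ IsLocalMax y x) ∧ ∀ x : ℝ, 0 < x → ¬ IsLocalMin y x

end AffineYield

end

/-! Bond prices are exponentially affine: `log P(T, x) = A(T) + x B(T)` with `B' = R(B) - 1`, `A' =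
F(B)` and `A(0) = B(0) = 0`. Put `G = F + x R` and `g(s) = G(B(s))`. Then `Y(T, x) = x - (1/T) ∫₀ᵀ
g`, and the derivative of the yield is `excess g T / T²`, where `excess g T = ∫₀ᵀ g - T g(T)`. The
shape of the curve is therefore the sign pattern of the excess, a function that starts at zero,
rises while `g` falls and falls while `g` rises.

The solution `B` decreases strictly from `0` towards the stationary point `c` (`IsRiccati`), and `G`
is strictly convex or strictly increasing on `(c, 0]`. Hence `g` decreases, or decreases and then
increases, or increases (`isValley_comp`), and the excess changes sign at most once, from plus to
minus. Two questions decide between the shapes.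

What is the limit of the excess at infinity? For `R(B)` it is `c`; for `F(B)` it is `∫₀^∞ (F(B(s)) -
F(c)) ds`, which the substitution `u = B(s)` turns into minus the integral in `b_y-norm`. The total
is nonnegative exactly when `x ≤ b_y-norm` (`IsRiccati.tendsto_excess`, `zero_le_limit_iff`).

Does `g` ever drop below `g(0) = 0`? The slopes `F(u)/u` and `R(u)/u` increase to the left
derivatives at zero, so it does exactly when `x < b_inv` (`bInv_cases`; if `R'(0) ≥ 0` it always
does). `shapes_of_isRiccati` puts the two answers together.

What remains is the bond price formula and the strictness of `G`. In both state spaces the time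
integral of `r` is approximated by Riemann sums, whose transforms follow by iterating the Markov
property (`integral_exp_sum`). On the half-line these are Laplace transforms; their log-convexity
makes the one-step exponents converge locally uniformly, which yields the integral equations
(`bond_integral_eq`). That `F` and `R` are strictly convex or linear comes from a positivity
argument with exponential sums instead of the Lévy-Khintchine formula
(`IsExpPositive.strictConvexOn_or_linear`). On the line only imaginary frequencies are available at
first. There `R` is linear, the characteristic function of the time integral is explicit
(`charFun_integral`), and its analytic continuation to `-1 ≤ Re u ≤ 0` takes the bond price as its
value at `-1` (`exp_moment_of_strip`, `bondPrice_line`). -/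

namespace AffineYield

/-! ### Riemann sums as integrals of step functions -/

section StepSums

variable {E : Type*} [NormedAddCommGroup E] [NormedSpace ℝ E] [CompleteSpace E]

lemma intervalIntegral_floor_piece (g : ℕ → E) {d : ℝ} (hd : 0 < d) (k : ℕ) :
    IntervalIntegrable (fun s => g ⌊s / d⌋₊) volume (k * d) ((k + 1 : ℕ) * d) ∧
      ∫ s in (k * d)..((k + 1 : ℕ) * d), g ⌊s / d⌋₊ = d • g k := by
  have hle : (k : ℝ) * d ≤ ((k + 1 : ℕ) : ℝ) * d := by
    push_cast; nlinarith
  have hne : ∀ᵐ s : ℝ ∂volume, s ≠ ((k + 1 : ℕ) : ℝ) * d :=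
    MeasureTheory.Measure.ae_ne volume _
  have key : ∀ᵐ s : ℝ ∂volume, s ∈ Set.uIoc ((k : ℝ) * d) (((k + 1 : ℕ) : ℝ) * d) →
      g ⌊s / d⌋₊ = g k := by
    filter_upwards [hne] with s hs hmem
    rw [uIoc_of_le hle] at hmem
    have h1 : ⌊s / d⌋₊ = k := by
      rw [Nat.floor_eq_iff (by
        apply div_nonneg _ hd.le
        have : (0 : ℝ) ≤ k * d := by positivity
        linarith [hmem.1])]
      constructor
      · rw [le_div_iff₀ hd]; exact hmem.1.le
      · rw [div_lt_iff₀ hd]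
        have := lt_of_le_of_ne hmem.2 hs
        push_cast at this; exact this
    rw [h1]
  constructor
  · refine (intervalIntegrable_const (c := g k)).congr_ae ?_
    rw [Filter.EventuallyEq, ae_restrict_iff' measurableSet_uIoc]
    filter_upwards [key] with s hs hm using (hs hm).symm
  · rw [intervalIntegral.integral_congr_ae key, intervalIntegral.integral_const]
    congr 1
    push_cast; ring

lemma sum_eq_integral_floor (g : ℕ → E) {d : ℝ} (hd : 0 < d) (n : ℕ) :
    IntervalIntegrable (fun s => g ⌊s / d⌋₊) volume 0 (n * d) ∧
      ∑ k ∈ Finset.range n, d • g k = ∫ s in (0 : ℝ)..(n * d), g ⌊s / d⌋₊ := by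
  have h := fun k => intervalIntegral_floor_piece g hd k
  have h0 : ((0 : ℕ) : ℝ) * d = 0 := by simp
  constructor
  · have := IntervalIntegrable.trans_iterate (a := fun k : ℕ => (k : ℝ) * d) (n := n)
      (f := fun s => g ⌊s / d⌋₊) (μ := volume) (fun k _ => (h k).1)
    simpa [h0] using this
  · have := intervalIntegral.sum_integral_adjacent_intervals (a := fun k : ℕ => (k : ℝ) * d)
      (n := n) (f := fun s => g ⌊s / d⌋₊) (μ := volume) (fun k _ => (h k).1)
    simp only [h0] at this
    rw [← this]
    exact Finset.sum_congr rfl fun k _ => (h k).2.symm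

/-- Step sums converge to the integral of the limit of the step functions. -/
lemma tendsto_step_sum (gs : ℕ → ℕ → E) (g : ℝ → E) {T C : ℝ} (hT : 0 < T)
    (hb : ∀ᶠ n in atTop, ∀ k < n, ‖gs n k‖ ≤ C)
    (hlim : ∀ s ∈ Ioo 0 T, Tendsto (fun n : ℕ => gs n ⌊s / (T / n)⌋₊) atTop (𝓝 (g s))) :
    IntervalIntegrable g volume 0 T ∧
      Tendsto (fun n : ℕ => ∑ k ∈ Finset.range n, (T / n) • gs n k) atTop
        (𝓝 (∫ s in (0 : ℝ)..T, g s)) := by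
  have hnT : ∀ n : ℕ, 0 < n → (n : ℝ) * (T / n) = T := fun n hn => by
    field_simp
  have hpos : ∀ n : ℕ, 0 < n → 0 < T / n := fun n hn => by positivity
  have hfloor : ∀ n : ℕ, 0 < n → ∀ s ∈ Ioo 0 T, ⌊s / (T / n)⌋₊ < n := by
    intro n hn s hs
    have := hpos n hn
    rw [Nat.floor_lt (by have := hs.1; positivity), div_lt_iff₀ this, hnT n hn]
    exact hs.2
  have hne : ∀ᵐ s : ℝ ∂volume, s ≠ T := MeasureTheory.Measure.ae_ne volume _
  have hbound : ∀ᶠ n : ℕ in atTop, ∀ᵐ s : ℝ ∂volume, s ∈ Set.uIoc 0 T →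
      ‖gs n ⌊s / (T / n)⌋₊‖ ≤ C := by
    filter_upwards [hb, eventually_gt_atTop 0] with n hn hn0
    filter_upwards [hne] with s hs hm
    rw [uIoc_of_le hT.le] at hm
    exact hn _ (hfloor n hn0 s ⟨hm.1, lt_of_le_of_ne hm.2 hs⟩)
  have hlim' : ∀ᵐ s : ℝ ∂volume, s ∈ Set.uIoc 0 T →
      Tendsto (fun n : ℕ => gs n ⌊s / (T / n)⌋₊) atTop (𝓝 (g s)) := by
    filter_upwards [hne] with s hs hm
    rw [uIoc_of_le hT.le] at hm
    exact hlim s ⟨hm.1, lt_of_le_of_ne hm.2 hs⟩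
  have hint : ∀ n : ℕ, 0 < n → IntervalIntegrable (fun s => gs n ⌊s / (T / n)⌋₊) volume 0 T := by
    intro n hn
    have := (sum_eq_integral_floor (gs n) (hpos n hn) n).1
    rwa [hnT n hn] at this
  have hmeas : ∀ᶠ n : ℕ in atTop, AEStronglyMeasurable (fun s : ℝ => gs n ⌊s / (T / n)⌋₊)
      (volume.restrict (Set.uIoc 0 T)) := by
    filter_upwards [eventually_gt_atTop 0] with n hn
    exact (intervalIntegrable_iff.1 (hint n hn)).aestronglyMeasurable
  -- Measurability is known only for `n > 0`, while the limit theorem wants it at every index;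
  -- finitely many terms are dropped.
  have hmeas' : ∃ N : ℕ, ∀ n : ℕ, AEStronglyMeasurable
      (fun s : ℝ => gs (n + N) ⌊s / (T / ((n + N : ℕ) : ℝ))⌋₊)
      (volume.restrict (Set.uIoc 0 T)) := by
    obtain ⟨N, hN⟩ := eventually_atTop.1 hmeas
    exact ⟨N, fun n => hN _ (by omega)⟩
  constructor
  · obtain ⟨N, hN⟩ := hmeas'
    have hg : AEStronglyMeasurable g (volume.restrict (Set.uIoc 0 T)) := by
      refine aestronglyMeasurable_of_tendsto_ae atTop hN ?_
      rw [ae_restrict_iff' measurableSet_uIoc]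
      filter_upwards [hlim'] with s hs hm
      exact (hs hm).comp (tendsto_add_atTop_nat N)
    rw [intervalIntegrable_iff]
    refine Integrable.mono' (g := fun _ => C)
      (intervalIntegrable_iff.1 intervalIntegrable_const) hg ?_
    rw [ae_restrict_iff' measurableSet_uIoc]
    obtain ⟨M, hM⟩ := eventually_atTop.1 hbound
    have hall : ∀ᵐ s : ℝ ∂volume, ∀ n : ℕ, s ∈ Set.uIoc 0 T →
        ‖gs (n + M) ⌊s / (T / ((n + M : ℕ) : ℝ))⌋₊‖ ≤ C := by
      rw [ae_all_iff]; intro n; exact hM _ (by omega)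
    filter_upwards [hlim', hall] with s hs hs2 hm
    exact le_of_tendsto ((hs hm).comp (tendsto_add_atTop_nat M)).norm
      (Eventually.of_forall fun n => hs2 n hm)
  · have := intervalIntegral.tendsto_integral_filter_of_dominated_convergence
      (a := (0 : ℝ)) (b := T) (μ := volume)
      (F := fun (n : ℕ) s => gs n ⌊s / (T / n)⌋₊) (f := g) (l := atTop) (fun _ => C)
      hmeas hbound intervalIntegrable_const hlim'
    refine this.congr' ?_
    filter_upwards [eventually_gt_atTop 0] with n hn
    rw [(sum_eq_integral_floor (gs n) (hpos n hn) n).2, hnT n hn]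

/-- The index of the grid cell containing `s` is at distance at most the mesh from `s`. -/
lemma tendsto_floor_mul {T s : ℝ} (hT : 0 < T) (hs : 0 ≤ s) :
    Tendsto (fun n : ℕ => (⌊s / (T / n)⌋₊ : ℝ) * (T / n)) atTop (𝓝 s) := by
  have h0 : Tendsto (fun n : ℕ => T / (n : ℝ)) atTop (𝓝 0) :=
    tendsto_const_div_atTop_nhds_zero_nat T
  have h1 : Tendsto (fun n : ℕ => s - T / (n : ℝ)) atTop (𝓝 s) := by
    simpa using tendsto_const_nhds.sub h0
  refine tendsto_of_tendsto_of_tendsto_of_le_of_le' h1 tendsto_const_nhds ?_ ?_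
  · filter_upwards [eventually_gt_atTop 0] with n hn
    have hp : 0 < T / n := by positivity
    have := Nat.lt_floor_add_one (s / (T / n))
    rw [div_lt_iff₀ hp] at this
    linarith
  · filter_upwards [eventually_gt_atTop 0] with n hn
    have hp : 0 < T / n := by positivity
    have := Nat.floor_le (a := s / (T / n)) (by positivity)
    rwa [le_div_iff₀ hp] at this

end StepSums

/-! ### Pointwise limits of convex functions -/

section ConvexLimits

/-- Slopes increase, so to the right of `k` the function stays above the secant through `l` and `k`.
This is the source of lower bounds below; upper bounds come from the maximum of the values at two
end points. -/
lemma convexOn_extrapolation {f : ℝ → ℝ} {S : Set ℝ} (hf : ConvexOn ℝ S f) {l k v : ℝ}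
    (hl : l ∈ S) (hv : v ∈ S) (hlk : l < k) (hkv : k ≤ v) :
    f k - (v - k) / (k - l) * |f k - f l| ≤ f v := by
  rcases hkv.eq_or_lt with rfl | hkv
  · simp
  · have h := hf.slope_mono_adjacent hl hv hlk hkv
    rw [le_div_iff₀ (by linarith)] at h
    have h2 : -((v - k) / (k - l) * |f k - f l|) ≤ (f k - f l) / (k - l) * (v - k) := by
      have : -|f k - f l| ≤ f k - f l := neg_abs_le _
      have h3 : 0 ≤ (v - k) / (k - l) := div_nonneg (by linarith) (by linarith)
      calc -((v - k) / (k - l) * |f k - f l|) = (v - k) / (k - l) * (-|f k - f l|) := by ring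
        _ ≤ (v - k) / (k - l) * (f k - f l) := by gcongr
        _ = _ := by ring
    linarith

/-- Pointwise convergent convex functions on `(-∞, 0]` are eventually uniformly bounded on compact
intervals. -/
lemma convexOn_bounded_of_tendsto {ι : Type*} {l : Filter ι} {fs : ι → ℝ → ℝ} {f : ℝ → ℝ}
    (hc : ∀ᶠ i in l, ConvexOn ℝ (Iic 0) (fs i))
    (hlim : ∀ u ≤ 0, Tendsto (fun i => fs i u) l (𝓝 (f u))) {K : ℝ} (hK : 0 ≤ K) :
    ∃ C, ∀ᶠ i in l, ∀ v ∈ Icc (-K) 0, |fs i v| ≤ C := by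
  have b : ∀ u ≤ 0, ∀ᶠ i in l, |fs i u| ≤ |f u| + 1 := fun u hu =>
    ((hlim u hu).abs.eventually_lt_const (lt_add_one _)).mono fun i h => h.le
  -- The end point values bound the functions from above. The term with factor `K` is the loss from
  -- extrapolating the secant through `-K-1` and `-K` over a distance of at most `K`.
  refine ⟨|f (-K)| + |f 0| + K * (|f (-K)| + |f (-K-1)| + 2) + 4, ?_⟩
  filter_upwards [hc, b (-K) (by linarith), b 0 le_rfl, b (-K-1) (by linarith)]
    with i hi h1 h2 h3 v hv
  have up : fs i v ≤ max (fs i (-K)) (fs i 0) :=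
    hi.le_max_of_mem_Icc (by simpa using hK) (by simp) hv
  have lo := convexOn_extrapolation hi (l := -K-1) (k := -K) (v := v)
    (by simp; linarith) (by simpa using hv.2) (by linarith) hv.1
  have e : (v - -K) / (-K - (-K-1)) = v + K := by ring_nf
  rw [e] at lo
  have h4 : (v + K) * |fs i (-K) - fs i (-K-1)| ≤ K * (|f (-K)| + |f (-K-1)| + 2) := by
    apply mul_le_mul _ _ (abs_nonneg _) hK
    · linarith [hv.2]
    · calc _ ≤ |fs i (-K)| + |fs i (-K-1)| := abs_sub _ _
        _ ≤ _ := by linarith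
  have h5 : 0 ≤ K * (|f (-K)| + |f (-K-1)| + 2) := by positivity
  rw [abs_le] at h1 h2 ⊢
  have := abs_nonneg (f 0)
  have := abs_nonneg (f (-K))
  constructor
  · linarith
  · refine up.trans (max_le ?_ ?_) <;> linarith

/-- Pointwise convergent convex functions on `(-∞, 0]` with continuous limit converge
continuously. -/
lemma convexOn_tendsto_of_tendsto {ι : Type*} {l : Filter ι} {fs : ι → ℝ → ℝ} {f : ℝ → ℝ}
    (hc : ∀ᶠ i in l, ConvexOn ℝ (Iic 0) (fs i))
    (hlim : ∀ u ≤ 0, Tendsto (fun i => fs i u) l (𝓝 (f u))) (hf : ContinuousOn f (Iic 0))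
    {vs : ι → ℝ} {v : ℝ} (hvs : ∀ᶠ i in l, vs i ≤ 0) (hv : v ≤ 0) (hvlim : Tendsto vs l (𝓝 v)) :
    Tendsto (fun i => fs i (vs i)) l (𝓝 (f v)) := by
  have hfc : ∀ ε > 0, ∃ η > 0, ∀ u ≤ 0, |u - v| ≤ η → |f u - f v| < ε := by
    intro ε hε
    have := Metric.continuousOn_iff.1 hf v hv ε hε
    obtain ⟨η, hη, h⟩ := this
    refine ⟨η / 2, by positivity, fun u hu huv => ?_⟩
    have := h u hu (by rw [Real.dist_eq]; linarith)
    rwa [Real.dist_eq] at this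
  rw [Metric.tendsto_nhds]
  intro ε hε
  obtain ⟨η, hη, hη2⟩ := hfc (ε / 16) (by positivity)
  -- Values at `v - d` and `p` bound `fs i (vs i)` from above, the secant through `v - 2 * d` and `v
  -- - d` from below. The right neighbour `p` is capped at `0` because `v` may be the end point.
  set d := η / 2 with hd
  have hd0 : 0 < d := by positivity
  set p := min (v + d) 0 with hp
  have hp0 : p ≤ 0 := min_le_right _ _
  have hvp : v ≤ p := le_min (by linarith) hv
  have hpd : p ≤ v + d := min_le_left _ _
  have ev : ∀ u ≤ 0, |u - v| ≤ η → ∀ᶠ i in l, |fs i u - f v| < ε / 8 := by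
    intro u hu huv
    have h1 := hη2 u hu huv
    have h2 := Metric.tendsto_nhds.1 (hlim u hu) (ε / 16) (by positivity)
    filter_upwards [h2] with i hi
    rw [Real.dist_eq] at hi
    calc |fs i u - f v| = |(fs i u - f u) + (f u - f v)| := by ring_nf
      _ ≤ _ := abs_add_le _ _
      _ < _ := by linarith
  have e1 := ev (v - 2 * d) (by linarith) (by rw [abs_le]; constructor <;> linarith)
  have e2 := ev (v - d) (by linarith) (by rw [abs_le]; constructor <;> linarith)
  have e3 := ev p hp0 (by rw [abs_le]; constructor <;> linarith)
  have e4 := Metric.tendsto_nhds.1 hvlim d hd0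
  filter_upwards [hc, hvs, e1, e2, e3, e4] with i hi hvi h1 h2 h3 h4
  rw [Real.dist_eq, abs_lt] at h4
  have hmem : vs i ∈ Icc (v - d) p := ⟨by linarith, le_min (by linarith) hvi⟩
  have up : fs i (vs i) ≤ max (fs i (v - d)) (fs i p) :=
    hi.le_max_of_mem_Icc (by simp; linarith) (by simpa using hp0) hmem
  have lo := convexOn_extrapolation hi (l := v - 2 * d) (k := v - d) (v := vs i)
    (by simp; linarith) (by simpa using hvi) (by linarith) hmem.1
  have hq : (vs i - (v - d)) / (v - d - (v - 2 * d)) ≤ 2 := by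
    rw [div_le_iff₀ (by linarith)]; linarith [hmem.2]
  have h5 : |fs i (v - d) - fs i (v - 2 * d)| ≤ ε / 4 := by
    calc _ = |(fs i (v - d) - f v) - (fs i (v - 2 * d) - f v)| := by ring_nf
      _ ≤ _ := abs_sub _ _
      _ ≤ _ := by linarith
  have h6 : (vs i - (v - d)) / (v - d - (v - 2 * d)) * |fs i (v - d) - fs i (v - 2 * d)|
      ≤ 2 * (ε / 4) := mul_le_mul hq h5 (abs_nonneg _) (by norm_num)
  rw [abs_lt] at h1 h2 h3
  rw [Real.dist_eq, abs_lt]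
  constructor
  · linarith
  · have : max (fs i (v - d)) (fs i p) < f v + ε := max_lt (by linarith) (by linarith)
    linarith

/-- A convex function that is affine at all midpoints and vanishes at zero is linear. -/
lemma linear_of_convexOn_of_midpoint {g : ℝ → ℝ} (hg : ConvexOn ℝ (Iic 0) g) (h0 : g 0 = 0)
    (hmid : ∀ u ≤ 0, ∀ v ≤ 0, g ((u + v) / 2) = (g u + g v) / 2) :
    ∀ u ≤ 0, g u = -g (-1) * u := by
  have key : ∀ u ≤ 0, ∀ s ∈ Icc (0 : ℝ) 1, g (s * u) = s * g u := by
    intro u hu s hs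
    have h1 := hg.2 (show u ∈ Iic 0 from hu) (show (0 : ℝ) ∈ Iic 0 by simp) hs.1
        (by linarith [hs.2])
      (add_sub_cancel s 1)
    have h2 := hg.2 (show u ∈ Iic 0 from hu) (show (0 : ℝ) ∈ Iic 0 by simp)
        (by linarith [hs.2]) hs.1
      (sub_add_cancel 1 s)
    simp only [smul_eq_mul, mul_zero, add_zero, h0] at h1 h2
    have h3 := hmid (s * u) (by nlinarith [hs.1]) ((1 - s) * u) (by nlinarith [hs.2])
    have h4 := hmid u hu 0 le_rfl
    have : (s * u + (1 - s) * u) / 2 = (u + 0) / 2 := by ring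
    rw [this, h4, h0] at h3
    linarith
  intro u hu
  rcases le_or_gt (-1) u with h | h
  · have := key (-1) (by norm_num) (-u) ⟨by linarith, by linarith⟩
    simp only [mul_neg, mul_one, neg_neg] at this
    rw [this]; ring
  · have := key u hu (-1 / u) ⟨div_nonneg_of_nonpos (by norm_num) hu, by
      rw [div_le_one_of_neg (by linarith)]; exact h.le⟩
    have e : -1 / u * u = -1 := by field_simp [show u ≠ 0 by linarith]
    rw [e] at this
    rw [this]; field_simp [show u ≠ 0 by linarith]

end ConvexLimits

/-! ### Holomorphy of parameter integrals -/

section Holomorphic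

/-- The integral of a dominated family of holomorphic functions is holomorphic. -/
lemma differentiableOn_integral_of_dominated {α : Type*} [MeasurableSpace α] {μ : Measure α}
    {U : Set ℂ} (hU : IsOpen U) {f : α → ℂ → ℂ} {bound : α → ℝ}
    (hm : ∀ z ∈ U, AEStronglyMeasurable (fun a => f a z) μ)
    (hd : ∀ᵐ a ∂μ, DifferentiableOn ℂ (f a) U)
    (hb : ∀ᵐ a ∂μ, ∀ z ∈ U, ‖f a z‖ ≤ bound a) (hbi : Integrable bound μ) :
    DifferentiableOn ℂ (fun z => ∫ a, f a z ∂μ) U := by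
  intro z₀ hz₀
  obtain ⟨ε, hε, hball⟩ := Metric.isOpen_iff.1 hU z₀ hz₀
  have hsub : ∀ z ∈ Metric.ball z₀ (ε / 2), Metric.closedBall z (ε / 4) ⊆ U := by
    intro z hz w hw
    apply hball
    rw [Metric.mem_ball] at hz ⊢
    rw [Metric.mem_closedBall] at hw
    calc dist w z₀ ≤ dist w z + dist z z₀ := dist_triangle _ _ _
      _ < ε := by linarith
  have hderiv : ∀ᵐ a ∂μ, ∀ z ∈ Metric.ball z₀ (ε / 2), HasDerivAt (f a) (deriv (f a) z) z := by
    filter_upwards [hd] with a ha z hz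
    have hzU : z ∈ U := hsub z hz (Metric.mem_closedBall_self (by positivity))
    exact ((ha z hzU).differentiableAt (hU.mem_nhds hzU)).hasDerivAt
  -- The derivative is the almost everywhere limit of difference quotients along a sequence, hence
  -- measurable.
  have hmeas' : AEStronglyMeasurable (fun a => deriv (f a) z₀) μ := by
    let h : ℕ → ℂ := fun n => ((ε / 4 / (n + 1) : ℝ) : ℂ)
    have hpos : ∀ n : ℕ, 0 < ε / 4 / ((n : ℝ) + 1) := fun n => by positivity
    have hh0 : Tendsto h atTop (𝓝[≠] 0) := by
      rw [tendsto_nhdsWithin_iff]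
      constructor
      · have : Tendsto (fun n : ℕ => ε / 4 / ((n : ℝ) + 1)) atTop (𝓝 0) := by
          have := tendsto_one_div_add_atTop_nhds_zero_nat (𝕜 := ℝ)
          simpa [div_eq_mul_inv] using this.const_mul (ε / 4)
        have := (Complex.continuous_ofReal.tendsto 0).comp this
        simpa [h, Function.comp_def] using this
      · exact Eventually.of_forall fun n => by
          simp only [h, mem_compl_iff, mem_singleton_iff, Complex.ofReal_eq_zero]
          exact (hpos n).ne'
    refine aestronglyMeasurable_of_tendsto_ae atTop
      (f := fun n a => (h n)⁻¹ • (f a (z₀ + h n) - f a z₀)) (fun n => ?_) ?_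
    · have hmem : z₀ + h n ∈ U := ?_
      · exact ((hm _ hmem).sub (hm _ hz₀)).const_smul ((h n)⁻¹)
      apply hball
      rw [Metric.mem_ball, dist_eq_norm, add_sub_cancel_left]
      simp only [h, Complex.norm_real, Real.norm_eq_abs, abs_of_pos (hpos n)]
      rw [div_lt_iff₀ (by positivity)]
      have : (0 : ℝ) ≤ n := n.cast_nonneg
      nlinarith
    · filter_upwards [hderiv] with a ha
      have := (ha z₀ (Metric.mem_ball_self (by positivity)))
      rw [hasDerivAt_iff_tendsto_slope_zero] at this
      exact this.comp hh0
  have := hasDerivAt_integral_of_dominated_loc_of_deriv_le (μ := μ) (𝕜 := ℂ)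
    (F := fun z a => f a z) (F' := fun z a => deriv (f a) z) (x₀ := z₀)
    (s := Metric.ball z₀ (ε / 2)) (bound := fun a => bound a / (ε / 4))
    (Metric.ball_mem_nhds _ (by positivity)) ?_ ?_ hmeas' ?_ (hbi.div_const _) hderiv
  · exact this.2.differentiableAt.differentiableWithinAt
  · filter_upwards [hU.mem_nhds hz₀] with z hz using hm z hz
  · refine hbi.mono' (hm z₀ hz₀) ?_
    filter_upwards [hb] with a ha using ha z₀ hz₀
  -- Cauchy's estimate on circles of radius `ε / 4` dominates the derivatives.
  · filter_upwards [hb, hd] with a ha hda z hz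
    refine Complex.norm_deriv_le_of_forall_mem_sphere_norm_le (by positivity) ?_ ?_
    · refine DifferentiableOn.diffContOnCl ?_
      rw [closure_ball _ (by positivity)]
      exact hda.mono (hsub z hz)
    · intro w hw
      exact ha w (hsub z hz (Metric.sphere_subset_closedBall hw))

end Holomorphic

/-! ### Exponential moments by analytic continuation -/

section Strip

/-- The closed vertical strip `-1 ≤ Re u ≤ 0`. -/
def strip : Set ℂ := {u | u.re ∈ Icc (-1 : ℝ) 0}

/-- Gaussian weight centred at `-1`. -/
noncomputable def gaussWeight (ε : ℝ) (u : ℂ) : ℂ := Complex.exp ((u + 1) ^ 2 / (2 * ε))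

lemma norm_gaussWeight (ε : ℝ) (x y : ℝ) :
    ‖gaussWeight ε (x + y * Complex.I)‖ = Real.exp (((x + 1) ^ 2 - y ^ 2) / (2 * ε)) := by
  rw [gaussWeight, Complex.norm_exp]
  congr 1
  have : ((x : ℂ) + y * Complex.I + 1) ^ 2 / (2 * (ε : ℂ))
      = ((((x + 1) ^ 2 - y ^ 2) / (2 * ε) : ℝ) : ℂ)
        + ((2 * (x + 1) * y / (2 * ε) : ℝ) : ℂ) * Complex.I := by
    push_cast
    have : ((x : ℂ) + y * Complex.I + 1) ^ 2
      = (x + 1) ^ 2 + y ^ 2 * Complex.I ^ 2 + 2 * (x + 1) * y * Complex.I := by ring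
    rw [this, Complex.I_sq]; ring
  rw [this, Complex.add_re, Complex.ofReal_re, Complex.re_ofReal_mul, Complex.I_re, mul_zero,
    add_zero]

lemma differentiable_gaussWeight (ε : ℝ) : Differentiable ℂ (gaussWeight ε) := by
  unfold gaussWeight; fun_prop

lemma integrable_exp_quad {ε : ℝ} (hε : 0 < ε) (a : ℝ) :
    Integrable fun y : ℝ => Real.exp ((a - y ^ 2) / (2 * ε)) := by
  have := (integrable_exp_neg_mul_sq (b := 1 / (2 * ε)) (by positivity)).const_mul
    (Real.exp (a / (2 * ε)))
  refine this.congr (Eventually.of_forall fun y => ?_)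
  simp only
  rw [← Real.exp_add]; congr 1; field_simp; ring

lemma integrable_mul_gaussWeight {ε : ℝ} (hε : 0 < ε) {H : ℂ → ℂ} {C : ℝ}
    (hc : ContinuousOn H strip) (hb : ∀ u ∈ strip, ‖H u‖ ≤ C) {x : ℝ} (hx : x ∈ Icc (-1 : ℝ) 0) :
    Integrable fun y : ℝ => H (x + y * Complex.I) * gaussWeight ε (x + y * Complex.I) := by
  have hmem : ∀ y : ℝ, (x : ℂ) + y * Complex.I ∈ strip := fun y => by simpa [strip] using hx
  refine ((integrable_exp_quad hε ((x + 1) ^ 2)).const_mul C).mono' ?_ ?_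
  · refine Continuous.aestronglyMeasurable (Continuous.mul ?_ ?_)
    · exact hc.comp_continuous (by fun_prop) hmem
    · exact (differentiable_gaussWeight ε).continuous.comp (by fun_prop)
  · refine Eventually.of_forall fun y => ?_
    rw [norm_mul, norm_gaussWeight]
    gcongr
    exact hb _ (hmem y)

/-- Shifting the line of integration across the strip. -/
lemma integral_shift_gaussWeight {ε : ℝ} (hε : 0 < ε) {H : ℂ → ℂ} {C : ℝ}
    (hc : ContinuousOn H strip) (hb : ∀ u ∈ strip, ‖H u‖ ≤ C)
    (hd : DifferentiableOn ℂ H {u | u.re ∈ Ioo (-1 : ℝ) 0}) :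
    ∫ y : ℝ, H (y * Complex.I) * gaussWeight ε (y * Complex.I)
      = ∫ y : ℝ, H (-1 + y * Complex.I) * gaussWeight ε (-1 + y * Complex.I) := by
  set Φ : ℂ → ℂ := fun u => H u * gaussWeight ε u with hΦ
  have hC : 0 ≤ C := (norm_nonneg _).trans (hb 0 (by simp [strip]))
  have i0 := integrable_mul_gaussWeight hε hc hb (x := 0) (by simp)
  have i1 := integrable_mul_gaussWeight hε hc hb (x := -1) (by simp)
  simp only [Complex.ofReal_zero, zero_add, Complex.ofReal_neg, Complex.ofReal_one] at i0 i1
  have t0 := intervalIntegral_tendsto_integral i0 tendsto_neg_atTop_atBot tendsto_id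
  have t1 := intervalIntegral_tendsto_integral i1 tendsto_neg_atTop_atBot tendsto_id
  -- Cauchy's theorem on the rectangle `[-1, 0] × [-R, R]`.
  have hrect : ∀ R : ℝ, 0 < R →
      (((∫ x : ℝ in (-1 : ℝ)..0, Φ (x + ((-R : ℝ) : ℂ) * Complex.I))
        - ∫ x : ℝ in (-1 : ℝ)..0, Φ (x + (R : ℂ) * Complex.I))
        + Complex.I • ∫ y : ℝ in (-R)..R, Φ (((0 : ℝ) : ℂ) + y * Complex.I))
        - Complex.I • ∫ y : ℝ in (-R)..R, Φ (((-1 : ℝ) : ℂ) + y * Complex.I) = 0 := by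
    intro R hR
    have := Complex.integral_boundary_rect_eq_zero_of_continuousOn_of_differentiableOn Φ
      (⟨-1, -R⟩ : ℂ) (⟨0, R⟩ : ℂ) ?_ ?_
    · exact this
    · refine ContinuousOn.mul (hc.mono ?_)
        (differentiable_gaussWeight ε).continuous.continuousOn
      intro u hu
      rw [Complex.mem_reProdIm, uIcc_of_le (by norm_num)] at hu
      exact hu.1
    · refine DifferentiableOn.mul (hd.mono ?_) (differentiable_gaussWeight ε).differentiableOn
      intro u hu
      rw [Complex.mem_reProdIm] at hu
      simpa using hu.1
  -- On the horizontal sides the weight is at most `exp ((1 - R²) / (2ε))`, so they vanish in the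
  -- limit.
  have hside : ∀ σ : ℝ, |σ| = 1 → Tendsto
      (fun R : ℝ => ∫ x : ℝ in (-1 : ℝ)..0, Φ (x + ((σ * R : ℝ) : ℂ) * Complex.I)) atTop (𝓝 0) := by
    intro σ hσ
    have hσ2 : σ ^ 2 = 1 := by rw [← sq_abs, hσ]; norm_num
    have hg : Tendsto (fun R : ℝ => C * Real.exp ((1 - R ^ 2) / (2 * ε))) atTop (𝓝 0) := by
      rw [show (0 : ℝ) = C * 0 by simp]
      refine Tendsto.const_mul _ (Real.tendsto_exp_atBot.comp ?_)
      refine Tendsto.atBot_div_const (by positivity) ?_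
      exact tendsto_atBot_add_const_left _ _
        (tendsto_neg_atTop_atBot.comp (tendsto_pow_atTop two_ne_zero))
    refine squeeze_zero_norm (fun R => ?_) hg
    have := intervalIntegral.norm_integral_le_of_norm_le_const (a := (-1 : ℝ)) (b := 0)
      (C := C * Real.exp ((1 - R ^ 2) / (2 * ε)))
      (f := fun x : ℝ => Φ (x + ((σ * R : ℝ) : ℂ) * Complex.I)) ?_
    · simpa using this
    · intro x hx
      rw [uIoc_of_le (by norm_num)] at hx
      simp only [hΦ]
      rw [norm_mul, norm_gaussWeight]
      refine mul_le_mul (hb _ (by simp [strip]; exact ⟨hx.1.le, hx.2⟩)) ?_ (Real.exp_pos _).le hC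
      rw [Real.exp_le_exp]
      have h1 : (x + 1) ^ 2 ≤ 1 := by nlinarith [hx.1, hx.2]
      have h2 : (σ * R) ^ 2 = R ^ 2 := by rw [mul_pow, hσ2, one_mul]
      rw [h2]
      gcongr
  have s1 := hside (-1) (by simp)
  have s2 := hside 1 (by simp)
  simp only [neg_mul, one_mul] at s1 s2
  have hlim : Tendsto (fun R : ℝ =>
      (((∫ x : ℝ in (-1 : ℝ)..0, Φ (x + ((-R : ℝ) : ℂ) * Complex.I))
        - ∫ x : ℝ in (-1 : ℝ)..0, Φ (x + (R : ℂ) * Complex.I))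
        + Complex.I • ∫ y : ℝ in (-R)..R, Φ (((0 : ℝ) : ℂ) + y * Complex.I))
        - Complex.I • ∫ y : ℝ in (-R)..R, Φ (((-1 : ℝ) : ℂ) + y * Complex.I)) atTop
      (𝓝 (((0 - 0) + Complex.I • ∫ y : ℝ, Φ (y * Complex.I))
        - Complex.I • ∫ y : ℝ, Φ (-1 + y * Complex.I))) := by
    refine ((s1.sub s2).add (Tendsto.const_smul ?_ _)).sub (Tendsto.const_smul ?_ _)
    · simpa using t0
    · simpa using t1
  have hz : Tendsto (fun R : ℝ =>
      (((∫ x : ℝ in (-1 : ℝ)..0, Φ (x + ((-R : ℝ) : ℂ) * Complex.I))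
        - ∫ x : ℝ in (-1 : ℝ)..0, Φ (x + (R : ℂ) * Complex.I))
        + Complex.I • ∫ y : ℝ in (-R)..R, Φ (((0 : ℝ) : ℂ) + y * Complex.I))
        - Complex.I • ∫ y : ℝ in (-R)..R, Φ (((-1 : ℝ) : ℂ) + y * Complex.I)) atTop (𝓝 0) :=
    tendsto_const_nhds.congr' (by
      filter_upwards [eventually_gt_atTop 0] with R hR using (hrect R hR).symm)
  have := tendsto_nhds_unique hlim hz
  rw [sub_self, zero_add, ← smul_sub, smul_eq_zero] at this
  rcases this with h | h
  · exact absurd h Complex.I_ne_zero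
  · exact sub_eq_zero.1 h

/-- The normalising constant is left as an integral, since it cancels in every use. -/
lemma integral_fourier_gaussian {ε : ℝ} (hε : 0 < ε) (z : ℝ) :
    ∫ y : ℝ, Complex.exp (y * Complex.I * z) * (Real.exp (-(y ^ 2) / (2 * ε)) : ℝ)
      = ((∫ y : ℝ, Real.exp (-(y ^ 2) / (2 * ε)) : ℝ) : ℂ) * (Real.exp (-(ε * z ^ 2 / 2)) : ℝ) := by
  have hb : (-(1 / (2 * ε) : ℂ)).re < 0 := by
    have : (-(1 / (2 * ε) : ℂ)) = ((-(1 / (2 * ε)) : ℝ) : ℂ) := by push_cast; ring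
    rw [this, Complex.ofReal_re]
    have : 0 < 1 / (2 * ε) := by positivity
    linarith
  have hε' : (ε : ℂ) ≠ 0 := by exact_mod_cast hε.ne'
  have h1 := integral_cexp_quadratic hb (Complex.I * z) 0
  have h2 := integral_cexp_quadratic hb 0 0
  have e1 : ∀ y : ℝ, Complex.exp (y * Complex.I * z) * (Real.exp (-(y ^ 2) / (2 * ε)) : ℝ)
      = Complex.exp (-(1 / (2 * ε) : ℂ) * y ^ 2 + Complex.I * z * y + 0) := by
    intro y
    rw [Complex.ofReal_exp, ← Complex.exp_add]; congr 1; push_cast; ring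
  have e2 : ((∫ y : ℝ, Real.exp (-(y ^ 2) / (2 * ε)) : ℝ) : ℂ)
      = ∫ y : ℝ, Complex.exp (-(1 / (2 * ε) : ℂ) * y ^ 2 + 0 * y + 0) := by
    rw [← integral_complex_ofReal]
    congr 1; ext y
    rw [Complex.ofReal_exp]; congr 1; push_cast; ring
  simp_rw [e1]
  rw [e2, h1, h2, mul_assoc, Complex.ofReal_exp, ← Complex.exp_add]
  congr 2
  push_cast
  rw [mul_pow, Complex.I_sq]
  field_simp
  ring

/-- If a characteristic function extends to a bounded continuous function on the strip
`-1 ≤ Re u ≤ 0` that is holomorphic inside, the extension gives the exponential moment. -/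
lemma exp_moment_of_strip {Ω : Type*} [MeasurableSpace Ω] {μ : Measure Ω} [IsProbabilityMeasure μ]
    {Z : Ω → ℝ} (hZ : AEMeasurable Z μ) {H : ℂ → ℂ} {C : ℝ}
    (hc : ContinuousOn H strip) (hb : ∀ u ∈ strip, ‖H u‖ ≤ C)
    (hd : DifferentiableOn ℂ H {u | u.re ∈ Ioo (-1 : ℝ) 0})
    (hchar : ∀ y : ℝ, ∫ ω, Complex.exp (y * Complex.I * (Z ω : ℂ)) ∂μ = H (y * Complex.I)) :
    ((∫ ω, Real.exp (-Z ω) ∂μ : ℝ) : ℂ) = H (-1) := by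
  have hw : ∀ ε y : ℝ, gaussWeight ε (-1 + y * Complex.I)
      = (Real.exp (-(y ^ 2) / (2 * ε)) : ℝ) := by
    intro ε y
    rw [gaussWeight, Complex.ofReal_exp]
    congr 1
    push_cast
    rw [neg_add_cancel_comm, mul_pow, Complex.I_sq]; ring
  -- A damped form of the claim. The expectation is inserted for `H` on the imaginary axis and
  -- Fubini applied; then the line is shifted back to `Re u = -1` for the entire function `u ↦ exp
  -- (u Z)` at each fixed `ω`. Only the damped moment appears, so no exponential integrability of
  -- `Z` is presupposed.
  have step1 : ∀ ε > 0, ((∫ ω, Real.exp (-Z ω) * Real.exp (-(ε * (Z ω) ^ 2 / 2)) ∂μ : ℝ) : ℂ)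
      * (∫ y : ℝ, Real.exp (-(y ^ 2) / (2 * ε)) : ℝ)
      = ∫ y : ℝ, H (-1 + y * Complex.I) * (Real.exp (-(y ^ 2) / (2 * ε)) : ℝ) := by
    intro ε hε
    have h1 := integral_shift_gaussWeight hε hc hb hd
    simp_rw [hw] at h1
    rw [← h1]
    simp_rw [← hchar, ← integral_mul_const]
    have hgi : Integrable fun y : ℝ => gaussWeight ε (y * Complex.I) := by
      have := integrable_mul_gaussWeight hε (H := fun _ => 1) (C := 1) continuousOn_const
        (by simp) (x := 0) (by simp)
      simpa using this
    have hnorm : ∀ (y : ℝ) ω, ‖Complex.exp (y * Complex.I * (Z ω : ℂ))‖ = 1 := by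
      intro y ω
      have : (y : ℂ) * Complex.I * (Z ω : ℂ) = ((y * Z ω : ℝ) : ℂ) * Complex.I := by
        push_cast; ring
      rw [this, Complex.norm_exp_ofReal_mul_I]
    rw [integral_integral_swap]
    · rw [← integral_complex_ofReal, ← integral_mul_const]
      refine integral_congr_ae (Eventually.of_forall fun ω => ?_)
      have h2 := integral_shift_gaussWeight hε (H := fun u => Complex.exp (u * (Z ω : ℂ)))
        (C := Real.exp |Z ω|) (by fun_prop) (by
          intro u hu
          rw [Complex.norm_exp, Real.exp_le_exp, Complex.re_mul_ofReal]
          calc u.re * Z ω ≤ |u.re * Z ω| := le_abs_self _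
            _ = |u.re| * |Z ω| := abs_mul _ _
            _ ≤ 1 * |Z ω| := by
              gcongr
              rw [abs_le]; exact ⟨hu.1, hu.2.trans (by norm_num)⟩
            _ = _ := one_mul _) (by fun_prop)
      simp only at h2 ⊢
      rw [h2]
      simp_rw [hw]
      have h3 : ∀ y : ℝ, Complex.exp ((-1 + y * Complex.I) * (Z ω : ℂ))
          * (Real.exp (-(y ^ 2) / (2 * ε)) : ℝ) = (Real.exp (-Z ω) : ℝ) *
            (Complex.exp (y * Complex.I * (Z ω : ℂ)) * (Real.exp (-(y ^ 2) / (2 * ε)) : ℝ)) := by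
        intro y
        rw [← mul_assoc, Complex.ofReal_exp (-Z ω), ← Complex.exp_add]
        congr 2
        push_cast; ring
      simp_rw [h3]
      rw [integral_const_mul, integral_fourier_gaussian hε]
      push_cast; ring
    · refine Integrable.mono' (g := fun p : ℝ × Ω => ‖gaussWeight ε (p.1 * Complex.I)‖)
        (hgi.norm.comp_fst μ) ?_ ?_
      · refine AEStronglyMeasurable.mul ?_ (hgi.comp_fst μ).aestronglyMeasurable
        have hZ2 : AEMeasurable (fun p : ℝ × Ω => Z p.2) (volume.prod μ) :=
          hZ.comp_quasiMeasurePreserving Measure.quasiMeasurePreserving_snd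
        have : AEMeasurable (fun p : ℝ × Ω => Complex.exp (p.1 * Complex.I * (Z p.2 : ℂ)))
            (volume.prod μ) := by fun_prop
        exact this.aestronglyMeasurable
      · refine Eventually.of_forall fun p => ?_
        simp only [Function.uncurry]
        rw [norm_mul, hnorm, one_mul]
  have hc1 : (0 : ℝ) < ∫ y : ℝ, Real.exp (-(y ^ 2) / 2) := by
    have := integral_gaussian (1 / 2)
    have e : ∀ y : ℝ, -(y ^ 2) / 2 = -(1 / 2) * y ^ 2 := fun y => by ring
    simp_rw [e]
    rw [this]; positivity
  set c1 := ∫ y : ℝ, Real.exp (-(y ^ 2) / 2) with hc1def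
  -- With `ε = δ²` and `y` replaced by `δ y` the Gaussian weight no longer depends on `δ`, and
  -- dominated convergence applies on the right as `δ → 0`.
  have step2 : ∀ δ > 0, ((∫ ω, Real.exp (-Z ω) * Real.exp (-(δ ^ 2 * (Z ω) ^ 2 / 2)) ∂μ : ℝ) : ℂ)
      * (c1 : ℂ) = ∫ y : ℝ, H (-1 + ((δ * y : ℝ) : ℂ) * Complex.I) *
          (Real.exp (-(y ^ 2) / 2) : ℝ) := by
    intro δ hδ
    have h1 := step1 (δ ^ 2) (by positivity)
    have h2 := Measure.integral_comp_mul_left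
      (fun y : ℝ => Real.exp (-(y ^ 2) / (2 * δ ^ 2))) δ
    have h3 := Measure.integral_comp_mul_left
      (fun y : ℝ => H (-1 + y * Complex.I) * (Real.exp (-(y ^ 2) / (2 * δ ^ 2)) : ℝ)) δ
    have e : ∀ y : ℝ, -((δ * y) ^ 2) / (2 * δ ^ 2) = -(y ^ 2) / 2 := fun y => by field_simp
    simp only [e] at h2 h3
    rw [hc1def, h2, h3, ← h1, abs_of_pos (by positivity)]
    simp only [smul_eq_mul, Complex.ofReal_mul, Complex.real_smul]
    ring
  let δ : ℕ → ℝ := fun n => 1 / ((n : ℝ) + 1)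
  have hδpos : ∀ n, 0 < δ n := fun n => by positivity
  have hδ0 : Tendsto δ atTop (𝓝 0) := tendsto_one_div_add_atTop_nhds_zero_nat
  let m : ℕ → ℝ := fun n => ∫ ω, Real.exp (-Z ω) * Real.exp (-(δ n ^ 2 * (Z ω) ^ 2 / 2)) ∂μ
  have hmlim : Tendsto (fun n => (m n : ℂ)) atTop (𝓝 (H (-1))) := by
    have h1 : Tendsto (fun n => ∫ y : ℝ, H (-1 + ((δ n * y : ℝ) : ℂ) * Complex.I)
        * (Real.exp (-(y ^ 2) / 2) : ℝ)) atTop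
        (𝓝 (∫ y : ℝ, H (-1) * (Real.exp (-(y ^ 2) / 2) : ℝ))) := by
      have hmem : ∀ t : ℝ, (-1 + (t : ℂ) * Complex.I) ∈ strip := fun t => by simp [strip]
      have hcont : Continuous fun t : ℝ => H (-1 + (t : ℂ) * Complex.I) :=
        hc.comp_continuous (by fun_prop) hmem
      refine tendsto_integral_of_dominated_convergence
        (fun y => C * Real.exp ((0 - y ^ 2) / (2 * 1))) ?_
        ((integrable_exp_quad one_pos 0).const_mul C) ?_ ?_
      · intro n
        refine Continuous.aestronglyMeasurable (Continuous.mul ?_ (by fun_prop))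
        exact hcont.comp (by fun_prop : Continuous fun y : ℝ => δ n * y)
      · intro n
        refine Eventually.of_forall fun y => ?_
        rw [norm_mul, Complex.norm_real, Real.norm_eq_abs, Real.abs_exp]
        have : (0 - y ^ 2) / (2 * 1) = -(y ^ 2) / 2 := by ring
        rw [this]
        gcongr
        exact hb _ (hmem _)
      · refine Eventually.of_forall fun y => ?_
        refine Tendsto.mul_const _ ?_
        have h2 : Tendsto (fun n => δ n * y) atTop (𝓝 0) := by simpa using hδ0.mul_const y
        have h3 := (hcont.tendsto 0).comp h2
        simpa [Function.comp_def] using h3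
    rw [integral_const_mul, integral_complex_ofReal, ← hc1def] at h1
    have h2 := h1.div_const (c1 : ℂ)
    have hne : (c1 : ℂ) ≠ 0 := by exact_mod_cast hc1.ne'
    rw [mul_div_cancel_right₀ _ hne] at h2
    refine h2.congr fun n => ?_
    rw [← step2 (δ n) (hδpos n), mul_div_cancel_right₀ _ hne]
  have hre : Tendsto m atTop (𝓝 (H (-1)).re) := by
    have := (Complex.continuous_re.tendsto _).comp hmlim
    simpa [Function.comp_def] using this
  have him : (H (-1)).im = 0 := by
    have := (Complex.continuous_im.tendsto _).comp hmlim
    simp only [Function.comp_def, Complex.ofReal_im] at this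
    exact (tendsto_nhds_unique this tendsto_const_nhds)
  have hint : ∀ n, Integrable
      (fun ω => Real.exp (-Z ω) * Real.exp (-(δ n ^ 2 * (Z ω) ^ 2 / 2))) μ := by
    intro n
    refine Integrable.of_bound (C := Real.exp (1 / (2 * δ n ^ 2)))
      (by
        have : AEMeasurable (fun ω => Real.exp (-Z ω) * Real.exp (-(δ n ^ 2 * (Z ω) ^ 2 / 2))) μ := by
          fun_prop
        exact this.aestronglyMeasurable) (Eventually.of_forall fun ω => ?_)
    rw [← Real.exp_add, Real.norm_eq_abs, Real.abs_exp, Real.exp_le_exp]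
    have h1 := hδpos n
    rw [le_div_iff₀ (by positivity)]
    nlinarith [sq_nonneg (δ n ^ 2 * Z ω + 1)]
  -- The damped moments increase to the moment itself, so monotone convergence identifies it, and
  -- its finiteness, with the limit already found.
  have hlint : Tendsto (fun n => ∫⁻ ω, ENNReal.ofReal
      (Real.exp (-Z ω) * Real.exp (-(δ n ^ 2 * (Z ω) ^ 2 / 2))) ∂μ) atTop
      (𝓝 (∫⁻ ω, ENNReal.ofReal (Real.exp (-Z ω)) ∂μ)) := by
    refine lintegral_tendsto_of_tendsto_of_monotone (fun n => by fun_prop) ?_ ?_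
    · refine Eventually.of_forall fun ω => ?_
      intro n k hnk
      refine ENNReal.ofReal_le_ofReal ?_
      have : δ k ≤ δ n := by
        simp only [δ]; gcongr
      have := (hδpos k).le
      gcongr
    · refine Eventually.of_forall fun ω => ?_
      refine ENNReal.tendsto_ofReal ?_
      have : Tendsto (fun n => Real.exp (-(δ n ^ 2 * (Z ω) ^ 2 / 2))) atTop
          (𝓝 (Real.exp (-((0 : ℝ) ^ 2 * (Z ω) ^ 2 / 2)))) := by
        refine (Real.continuous_exp.tendsto _).comp ?_
        exact ((((hδ0.pow 2).mul_const _).div_const _).neg)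
      simpa using this.const_mul (Real.exp (-Z ω))
  have heq : ∀ n, ∫⁻ ω, ENNReal.ofReal
      (Real.exp (-Z ω) * Real.exp (-(δ n ^ 2 * (Z ω) ^ 2 / 2))) ∂μ = ENNReal.ofReal (m n) := by
    intro n
    rw [ofReal_integral_eq_lintegral_ofReal (hint n) (Eventually.of_forall fun ω => by positivity)]
  simp_rw [heq] at hlint
  have hfin := tendsto_nhds_unique hlint (ENNReal.tendsto_ofReal hre)
  have hnn : 0 ≤ (H (-1)).re :=
    ge_of_tendsto hre (Eventually.of_forall fun n => integral_nonneg fun ω => by positivity)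
  have : ∫ ω, Real.exp (-Z ω) ∂μ = (H (-1)).re := by
    rw [integral_eq_lintegral_of_nonneg_ae (Eventually.of_forall fun ω => (Real.exp_pos _).le)
      (by
        have : AEMeasurable (fun ω => Real.exp (-Z ω)) μ := by fun_prop
        exact this.aestronglyMeasurable), hfin, ENNReal.toReal_ofReal hnn]
  rw [this]
  apply Complex.ext <;> simp [him]

end Strip

/-! ### Monotonicity of averages -/

section Averages

/-- The amount by which the integral of `g` over `[0, T]` exceeds `T g(T)`. -/
noncomputable def excess (g : ℝ → ℝ) (T : ℝ) : ℝ := (∫ s in (0 : ℝ)..T, g s) - T * g T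

variable {g : ℝ → ℝ}

lemma intervalIntegrable_of_continuousOn_Ici (hg : ContinuousOn g (Ici 0)) {a b : ℝ} (ha : 0 ≤ a)
    (hb : 0 ≤ b) : IntervalIntegrable g volume a b := by
  refine (hg.mono fun x hx => ?_).intervalIntegrable
  exact (le_min ha hb).trans hx.1

lemma excess_neg (g : ℝ → ℝ) (T : ℝ) : excess (fun s => -g s) T = -excess g T := by
  simp only [excess, intervalIntegral.integral_neg]; ring

/-- The increment is `∫ₐᵇ (g - g b) + a (g a - g b)`, in which both terms are nonnegative and the
first is positive. No differentiability of `g` is needed. -/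
lemma excess_lt_of_strictAntiOn (hg : ContinuousOn g (Ici 0)) {a b : ℝ} (ha : 0 ≤ a) (hab : a < b)
    (h : StrictAntiOn g (Icc a b)) : excess g a < excess g b := by
  have hb : 0 ≤ b := ha.trans hab.le
  have h1 : ∫ s in a..b, g b < ∫ s in a..b, g s := by
    refine intervalIntegral.integral_lt_integral_of_continuousOn_of_le_of_exists_lt hab
      continuousOn_const (hg.mono fun x hx => ha.trans hx.1) ?_ ⟨a, left_mem_Icc.2 hab.le, ?_⟩
    · exact fun x hx => h.antitoneOn ⟨hx.1.le, hx.2⟩ (right_mem_Icc.2 hab.le) hx.2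
    · exact h (left_mem_Icc.2 hab.le) (right_mem_Icc.2 hab.le) hab
  have h2 := intervalIntegral.integral_add_adjacent_intervals
    (intervalIntegrable_of_continuousOn_Ici hg le_rfl ha)
    (intervalIntegrable_of_continuousOn_Ici hg ha hb)
  have h3 := h (left_mem_Icc.2 hab.le) (right_mem_Icc.2 hab.le) hab
  rw [intervalIntegral.integral_const, smul_eq_mul] at h1
  simp only [excess]
  nlinarith

lemma excess_lt_of_strictMonoOn (hg : ContinuousOn g (Ici 0)) {a b : ℝ} (ha : 0 ≤ a) (hab : a < b)
    (h : StrictMonoOn g (Icc a b)) : excess g b < excess g a := by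
  have := excess_lt_of_strictAntiOn (g := fun s => -g s) hg.neg ha hab
    (fun x hx y hy hxy => neg_lt_neg (h hx hy hxy))
  rw [excess_neg, excess_neg] at this
  linarith

lemma excess_zero (g : ℝ → ℝ) : excess g 0 = 0 := by simp [excess]

/-- The negative of the average of `g` over `[0, T]`, up to a constant. -/
lemma hasDerivAt_average (hg : ContinuousOn g (Ici 0)) (r : ℝ) {T : ℝ} (hT : 0 < T) :
    HasDerivAt (fun T => r - (∫ s in (0 : ℝ)..T, g s) / T) (excess g T / T ^ 2) T := by
  have h1 : HasDerivAt (fun T => ∫ s in (0 : ℝ)..T, g s) (g T) T := by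
    refine intervalIntegral.integral_hasDerivAt_right
      (intervalIntegrable_of_continuousOn_Ici hg le_rfl hT.le) ?_ ?_
    · exact hg.stronglyMeasurableAtFilter_nhdsWithin measurableSet_Ici T |>.filter_mono
        (by rw [nhdsWithin_eq_nhds.2 (Ici_mem_nhds hT)])
    · exact hg.continuousAt (Ici_mem_nhds hT)
  have h2 := (h1.div (hasDerivAt_id T) hT.ne').const_sub r
  refine h2.congr_deriv ?_
  simp only [excess, id]
  ring

lemma strictMonoOn_average (hg : ContinuousOn g (Ici 0)) (r : ℝ) {S : Set ℝ} (hS : Convex ℝ S)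
    (hS0 : S ⊆ Ioi 0) (h : ∀ T ∈ interior S, 0 < excess g T) :
    StrictMonoOn (fun T => r - (∫ s in (0 : ℝ)..T, g s) / T) S := by
  refine strictMonoOn_of_deriv_pos hS
    (fun T hT => (hasDerivAt_average hg r (hS0 hT)).continuousAt.continuousWithinAt) fun T hT => ?_
  have hT0 : 0 < T := hS0 (interior_subset hT)
  rw [(hasDerivAt_average hg r hT0).deriv]
  exact div_pos (h T hT) (by positivity)

lemma strictAntiOn_average (hg : ContinuousOn g (Ici 0)) (r : ℝ) {S : Set ℝ} (hS : Convex ℝ S)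
    (hS0 : S ⊆ Ioi 0) (h : ∀ T ∈ interior S, excess g T < 0) :
    StrictAntiOn (fun T => r - (∫ s in (0 : ℝ)..T, g s) / T) S := by
  refine strictAntiOn_of_deriv_neg hS
    (fun T hT => (hasDerivAt_average hg r (hS0 hT)).continuousAt.continuousWithinAt) fun T hT => ?_
  have hT0 : 0 < T := hS0 (interior_subset hT)
  rw [(hasDerivAt_average hg r hT0).deriv]
  exact div_neg_of_neg_of_pos (h T hT) (by positivity)

lemma isHumped_average (hg : ContinuousOn g (Ici 0)) (r : ℝ) {a : ℝ} (ha : 0 < a)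
    (h1 : ∀ T ∈ Ioo 0 a, 0 < excess g T) (h2 : ∀ T ∈ Ioi a, excess g T < 0) :
    IsHumped (fun T => r - (∫ s in (0 : ℝ)..T, g s) / T) := by
  have hm := strictMonoOn_average hg r (S := Ioc 0 a) (convex_Ioc 0 a) (fun x hx => hx.1)
    (by rw [interior_Ioc]; exact h1)
  have hn := strictAntiOn_average hg r (S := Ici a) (convex_Ici a) (fun x hx => ha.trans_le hx)
    (by rw [interior_Ici]; exact h2)
  have crit : ∀ x, 0 < x → excess g x / x ^ 2 = 0 → x = a := by
    intro x hx h0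
    have h0 : excess g x = 0 := by
      rcases div_eq_zero_iff.1 h0 with h | h
      · exact h
      · exact absurd h (by positivity)
    rcases lt_trichotomy x a with h | h | h
    · exact absurd h0 (h1 x ⟨hx, h⟩).ne'
    · exact h
    · exact absurd h0 (h2 x h).ne
  refine ⟨⟨a, ⟨ha, ?_⟩, ?_⟩, ?_⟩
  · filter_upwards [Ioi_mem_nhds ha] with z hz
    rcases le_or_gt z a with h | h
    · exact hm.monotoneOn ⟨hz, h⟩ ⟨ha, le_rfl⟩ h
    · exact hn.antitoneOn self_mem_Ici h.le h.le
  · rintro x ⟨hx, hmax⟩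
    exact crit x hx (hmax.hasDerivAt_eq_zero (hasDerivAt_average hg r hx))
  · intro x hx hmin
    have := crit x hx (hmin.hasDerivAt_eq_zero (hasDerivAt_average hg r hx))
    subst this
    obtain ⟨z, hz1, hz2⟩ := ((hmin.filter_mono nhdsWithin_le_nhds).and
      (self_mem_nhdsWithin (a := x) (s := Ioi x))).exists
    exact absurd (hn self_mem_Ici (le_of_lt hz2) hz2) (not_lt.2 hz1)

/-- The three ways in which `g` may vary: decreasing, first decreasing and then increasing, or
increasing. -/
def IsValley (g : ℝ → ℝ) : Prop :=
  StrictAntiOn g (Ici 0) ∨ (∃ a, 0 < a ∧ StrictAntiOn g (Icc 0 a) ∧ StrictMonoOn g (Ici a)) ∨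
    StrictMonoOn g (Ici 0)

lemma excess_pos_of_strictAntiOn (hg : ContinuousOn g (Ici 0)) {T : ℝ} (hT : 0 < T)
    (h : StrictAntiOn g (Icc 0 T)) : 0 < excess g T := by
  have := excess_lt_of_strictAntiOn hg le_rfl hT h
  rwa [excess_zero] at this

/-- After `a` the excess decreases strictly, so beyond a nonpositive value it stays below its value
at `T + 1`, which is strictly negative; the limit cannot creep back to zero. -/
lemma limit_neg_of_excess_nonpos (hg : ContinuousOn g (Ici 0)) {a T : ℝ} (ha : 0 ≤ a)
    (h : StrictMonoOn g (Ici a)) {l : EReal}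
    (hl : Tendsto (fun T => (excess g T : EReal)) atTop (𝓝 l)) (haT : a ≤ T)
    (hT : excess g T ≤ 0) : l < 0 := by
  have h1 : excess g (T + 1) < excess g T :=
    excess_lt_of_strictMonoOn hg (ha.trans haT) (lt_add_one T) (h.mono fun x hx => haT.trans hx.1)
  have h2 : l ≤ (excess g (T + 1) : EReal) := by
    refine le_of_tendsto hl ?_
    filter_upwards [eventually_gt_atTop (T + 1)] with s hs
    exact EReal.coe_le_coe_iff.2 (excess_lt_of_strictMonoOn hg (by linarith) hs
      (h.mono fun x hx => by have := hx.1; simp only [mem_Ici]; linarith)).le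
  refine h2.trans_lt ?_
  exact_mod_cast h1.trans_le hT

lemma excess_neg_of_limit_neg {l : EReal}
    (hl : Tendsto (fun T => (excess g T : EReal)) atTop (𝓝 l)) (h : l < 0) :
    ∀ᶠ T in atTop, excess g T < 0 := by
  filter_upwards [hl.eventually_lt_const h] with T hT
  exact_mod_cast hT

/-- A nonpositive excess can occur only where `g` has begun to increase, and from there it would
lead to a negative limit. -/
lemma IsValley.isNormal (hv : IsValley g) (hg : ContinuousOn g (Ici 0)) (r : ℝ) {l : EReal}
    (hl : Tendsto (fun T => (excess g T : EReal)) atTop (𝓝 l)) (h0 : 0 ≤ l) :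
    IsNormal (fun T => r - (∫ s in (0 : ℝ)..T, g s) / T) := by
  refine strictMonoOn_average hg r (convex_Ioi 0) subset_rfl ?_
  rw [interior_Ioi]
  intro T hT
  rcases hv with h | ⟨a, ha, h1, h2⟩ | h
  · exact excess_pos_of_strictAntiOn hg hT (h.mono fun x hx => hx.1)
  · rcases le_or_gt T a with hTa | hTa
    · exact excess_pos_of_strictAntiOn hg hT (h1.mono (Icc_subset_Icc_right hTa))
    · by_contra hn
      exact absurd h0 (not_le.2 (limit_neg_of_excess_nonpos hg ha.le h2 hl hTa.le (not_lt.1 hn)))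
  · exact absurd h0 (not_le.2 (limit_neg_of_excess_nonpos hg le_rfl h hl le_rfl
      (excess_zero g).le))

/-- The negative limit rules out a decreasing `g`, and a value below `g 0` rules out an increasing
one. In the remaining case the excess is positive up to the turning point `a` and then falls
strictly to a negative limit; its single zero is the hump. -/
lemma IsValley.isHumped (hv : IsValley g) (hg : ContinuousOn g (Ici 0)) (r : ℝ) {l : EReal}
    (hl : Tendsto (fun T => (excess g T : EReal)) atTop (𝓝 l)) (h0 : l < 0)
    (ht : ∃ t, 0 < t ∧ g t < g 0) :
    IsHumped (fun T => r - (∫ s in (0 : ℝ)..T, g s) / T) := by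
  have hev := excess_neg_of_limit_neg hl h0
  rcases hv with h | ⟨a, ha, h1, h2⟩ | h
  · obtain ⟨T, hT, hT0⟩ := (hev.and (eventually_gt_atTop 0)).exists
    exact absurd hT (not_lt.2 (excess_pos_of_strictAntiOn hg hT0 (h.mono fun x hx => hx.1)).le)
  · have hpos : ∀ T ∈ Ioc 0 a, 0 < excess g T := fun T hT =>
      excess_pos_of_strictAntiOn hg hT.1 (h1.mono (Icc_subset_Icc_right hT.2))
    obtain ⟨T, hT, hTa⟩ := (hev.and (eventually_gt_atTop a)).exists
    have hcont : ContinuousOn (excess g) (Icc a T) := by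
      have : ContinuousOn (fun T => ∫ s in (0 : ℝ)..T, g s) (Icc a T) := by
        have h3 := intervalIntegral.continuousOn_primitive_interval' (a := 0) (b₁ := 0) (b₂ := T)
          (intervalIntegrable_of_continuousOn_Ici hg le_rfl (ha.trans hTa).le) left_mem_uIcc
        rw [uIcc_of_le (ha.trans hTa).le] at h3
        exact h3.mono (Icc_subset_Icc_left ha.le)
      exact this.sub (continuousOn_id.mul (hg.mono fun x hx => ha.le.trans hx.1))
    obtain ⟨z, hz, hz0⟩ := intermediate_value_Icc' hTa.le hcont
      ⟨hT.le, (hpos a ⟨ha, le_rfl⟩).le⟩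
    have haz : a < z := by
      rcases hz.1.eq_or_lt with h | h
      · rw [← h] at hz0; exact absurd hz0 (hpos a ⟨ha, le_rfl⟩).ne'
      · exact h
    refine isHumped_average hg r (ha.trans haz) (fun t htz => ?_) fun t htz => ?_
    · rcases le_or_gt t a with hta | hta
      · exact hpos t ⟨htz.1, hta⟩
      · have := excess_lt_of_strictMonoOn hg htz.1.le htz.2
          (h2.mono fun x hx => hta.le.trans hx.1)
        rwa [hz0] at this
    · have := excess_lt_of_strictMonoOn hg (ha.trans haz).le htz
        (h2.mono fun x hx => haz.le.trans hx.1)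
      rwa [hz0] at this
  · obtain ⟨t, ht0, htg⟩ := ht
    exact absurd (h self_mem_Ici ht0.le ht0) (not_lt.2 htg.le)

/-- If `g` never drops below `g 0`, it cannot begin by decreasing, so only the increasing case is
left. -/
lemma IsValley.isInverse (hv : IsValley g) (hg : ContinuousOn g (Ici 0)) (r : ℝ)
    (ht : ∀ t, 0 < t → g 0 ≤ g t) :
    IsInverse (fun T => r - (∫ s in (0 : ℝ)..T, g s) / T) := by
  rcases hv with h | ⟨a, ha, h1, h2⟩ | h
  · exact absurd (ht 1 one_pos) (not_le.2 (h self_mem_Ici (zero_le_one' ℝ) one_pos))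
  · exact absurd (ht a ha) (not_le.2 (h1 (left_mem_Icc.2 ha.le) (right_mem_Icc.2 ha.le) ha))
  · refine strictAntiOn_average hg r (convex_Ioi 0) subset_rfl ?_
    rw [interior_Ioi]
    intro T hT
    have := excess_lt_of_strictMonoOn hg le_rfl hT (h.mono fun x hx => hx.1)
    rwa [excess_zero] at this

end Averages

/-! ### Convex functions along a decreasing trajectory -/

section Valley

/-- The chord inequality cleared of denominators, so that `u = w` is allowed. -/
lemma convexOn_between {f : ℝ → ℝ} {S : Set ℝ} (hf : ConvexOn ℝ S f) {u v w : ℝ} (hu : u ∈ S)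
    (hw : w ∈ S) (huv : u ≤ v) (hvw : v ≤ w) :
    (w - u) * f v ≤ (w - v) * f u + (v - u) * f w := by
  rcases (huv.trans hvw).eq_or_lt with h | h
  · have : v = u := le_antisymm (h ▸ hvw) huv
    subst this; subst h; simp
  · have hne : w - u ≠ 0 := by linarith
    have h1 := hf.2 hu hw (div_nonneg (sub_nonneg.2 hvw) (sub_nonneg.2 h.le))
      (div_nonneg (sub_nonneg.2 huv) (sub_nonneg.2 h.le)) (by field_simp; ring)
    have e : ((w - v) / (w - u)) • u + ((v - u) / (w - u)) • w = v := by
      simp only [smul_eq_mul]; field_simp; ring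
    rw [e] at h1
    simp only [smul_eq_mul] at h1
    calc (w - u) * f v ≤ (w - u) * ((w - v) / (w - u) * f u + (v - u) / (w - u) * f w) := by
          gcongr
      _ = _ := by field_simp

/-- A continuous function on `(c, 0]` that is strictly increasing or strictly convex first
decreases and then increases. -/
lemma isValley_comp {c : ℝ} {G B : ℝ → ℝ} (hG : ContinuousOn G (Ioc c 0))
    (hGs : StrictMonoOn G (Ioc c 0) ∨ StrictConvexOn ℝ (Ioc c 0) G)
    (hB : ContinuousOn B (Ici 0)) (hB0 : B 0 = 0) (hBa : StrictAntiOn B (Ici 0))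
    (hBc : ∀ t, 0 ≤ t → c < B t) (hlim : Tendsto B atTop (𝓝 c)) :
    IsValley (fun s => G (B s)) := by
  have hmem : ∀ t, 0 ≤ t → B t ∈ Ioc c 0 := fun t ht => ⟨hBc t ht, by
    rw [← hB0]; exact hBa.antitoneOn self_mem_Ici ht ht⟩
  have hmono : StrictMonoOn G (Ioc c 0) → IsValley (fun s => G (B s)) := fun h =>
    Or.inl fun x hx y hy hxy => h (hmem y hy) (hmem x hx) (hBa hx hy hxy)
  rcases hGs with h | hsc
  · exact hmono h
  by_cases hmin : ∃ w ∈ Ioc c 0, ∀ u ∈ Ioc c 0, G w ≤ G u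
  · obtain ⟨w, hw, hmin⟩ := hmin
    have huniq : ∀ v ∈ Ioc c 0, v ≠ w → G w < G v := by
      intro v hv hne
      refine lt_of_le_of_ne (hmin v hv) fun heq => ?_
      have h1 := hsc.2 hw hv hne.symm (show (0 : ℝ) < 1 / 2 by norm_num)
        (show (0 : ℝ) < 1 / 2 by norm_num) (by norm_num)
      have h2 := hmin _ (hsc.1 hw hv (show (0 : ℝ) ≤ 1 / 2 by norm_num)
        (show (0 : ℝ) ≤ 1 / 2 by norm_num) (by norm_num))
      rw [← heq] at h1
      simp only [smul_eq_mul] at h1 h2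
      linarith
    have hanti : StrictAntiOn G (Ioc c w) := by
      intro u hu v hv huv
      have hu' : u ∈ Ioc c 0 := ⟨hu.1, hu.2.trans hw.2⟩
      rcases hv.2.eq_or_lt with h | h
      · rw [h]; exact huniq u hu' (by rintro rfl; exact absurd h huv.ne')
      · have h1 := convexOn_between hsc.convexOn hu' hw huv.le h.le
        have h2 := huniq u hu' (by rintro rfl; linarith)
        nlinarith
    have hmono' : StrictMonoOn G (Icc w 0) := by
      intro u hu v hv huv
      have hv' : v ∈ Ioc c 0 := ⟨hw.1.trans_le hv.1, hv.2⟩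
      rcases hu.1.eq_or_lt with h | h
      · rw [← h]; exact huniq v hv' (by rintro rfl; linarith)
      · have h1 := convexOn_between hsc.convexOn hw hv' h.le huv.le
        have h2 := huniq v hv' (by rintro rfl; linarith)
        nlinarith
    rcases hw.2.eq_or_lt with h0 | h0
    · right; right
      rw [h0] at hanti
      exact fun x hx y hy hxy => hanti (hmem y hy) (hmem x hx) (hBa hx hy hxy)
    · right; left
      obtain ⟨T, hT, hT0⟩ := ((hlim.eventually_lt_const hw.1).and (eventually_gt_atTop 0)).exists
      obtain ⟨a, ha, haw⟩ := intermediate_value_Icc' hT0.le (hB.mono fun x hx => hx.1)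
        (show w ∈ Icc (B T) (B 0) from ⟨hT.le, by rw [hB0]; exact hw.2⟩)
      have ha0 : 0 < a := by
        rcases ha.1.eq_or_lt with h | h
        · rw [← h, hB0] at haw; linarith
        · exact h
      refine ⟨a, ha0, ?_, ?_⟩
      · intro x hx y hy hxy
        have m : ∀ z ∈ Icc 0 a, B z ∈ Icc w 0 := fun z hz => ⟨by
          rw [← haw]; exact hBa.antitoneOn hz.1 ha0.le hz.2, (hmem z hz.1).2⟩
        exact hmono' (m y hy) (m x hx) (hBa hx.1 hy.1 hxy)
      · intro x hx y hy hxy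
        have m : ∀ z ∈ Ici a, B z ∈ Ioc c w := fun z hz => ⟨(hmem z (ha0.le.trans hz)).1, by
          rw [← haw]; exact hBa.antitoneOn ha0.le (ha0.le.trans hz) hz⟩
        exact hanti (m y hy) (m x hx) (hBa (ha0.le.trans hx) (ha0.le.trans hy) hxy)
  -- Without a minimiser `G` is strictly increasing. If `G v ≤ G u` with `u < v`, convexity keeps
  -- `G` above `G u` on the left of `u`, and the minimum over the compact interval `[u, 0]` would be
  -- a global one.
  · refine hmono fun u hu v hv huv => ?_
    by_contra hcon
    rw [not_lt] at hcon
    apply hmin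
    obtain ⟨w, hw, hwmin⟩ := isCompact_Icc.exists_isMinOn (nonempty_Icc.2 hu.2)
      (hG.mono fun x (hx : x ∈ Icc u 0) => ⟨hu.1.trans_le hx.1, hx.2⟩)
    refine ⟨w, ⟨hu.1.trans_le hw.1, hw.2⟩, fun z hz => ?_⟩
    rcases le_or_gt u z with h | h
    · exact hwmin ⟨h, hz.2⟩
    · have h1 : G w ≤ G u := hwmin (left_mem_Icc.2 hu.2)
      have h2 := hsc.convexOn.slope_mono_adjacent hz hv h huv
      have h3 : (G v - G u) / (v - u) ≤ 0 := div_nonpos_of_nonpos_of_nonneg (by linarith)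
        (by linarith)
      have h4 := h2.trans h3
      rw [div_le_iff₀ (by linarith)] at h4
      linarith

end Valley

/-! ### The Riccati equation -/

section Riccati

/-- `B` solves `B' = ρ(B) - 1`, `B 0 = 0` in `(-∞, 0]`, where `ρ` is convex with `ρ 0 = 0`,
`ρ c = 1`. -/
structure IsRiccati (c : ℝ) (ρ B : ℝ → ℝ) : Prop where
  neg : c < 0
  convexOn : ConvexOn ℝ (Iic 0) ρ
  continuousOn : ContinuousOn ρ (Iic 0)
  map_zero : ρ 0 = 0
  map_c : ρ c = 1
  nonpos : ∀ t, 0 ≤ t → B t ≤ 0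
  intervalIntegrable : ∀ T, 0 < T → IntervalIntegrable (fun s => ρ (B s) - 1) volume 0 T
  eq_integral : ∀ T, 0 ≤ T → B T = ∫ s in (0 : ℝ)..T, (ρ (B s) - 1)

lemma exists_subgradient {S : Set ℝ} {f : ℝ → ℝ} (hf : ConvexOn ℝ S f) {x : ℝ}
    (hx : x ∈ interior S) : ∃ m, ∀ y ∈ S, f x + m * (y - x) ≤ f y := by
  refine ⟨derivWithin f (Ioi x) x, fun y hy => ?_⟩
  rcases lt_trichotomy y x with h | h | h
  · have h1 := (hf.slope_le_leftDeriv_of_mem_interior hy hx h).trans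
      (hf.leftDeriv_le_rightDeriv_of_mem_interior hx)
    rw [slope_def_field, div_le_iff₀ (by linarith)] at h1
    linarith
  · subst h; simp
  · have h1 := hf.rightDeriv_le_slope_of_mem_interior hx hy h
    rw [slope_def_field, le_div_iff₀ (by linarith)] at h1
    linarith

namespace IsRiccati

variable {c : ℝ} {ρ B : ℝ → ℝ} (h : IsRiccati c ρ B)
include h

lemma zero : B 0 = 0 := by
  have := h.eq_integral 0 le_rfl
  simpa using this

lemma continuousOn_sol : ContinuousOn B (Ici 0) := by
  intro t ht
  have h1 := intervalIntegral.continuousOn_primitive_interval' (a := 0) (b₁ := 0) (b₂ := t + 1)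
    (h.intervalIntegrable (t + 1) (by have := mem_Ici.1 ht; linarith)) left_mem_uIcc
  rw [uIcc_of_le (by have := mem_Ici.1 ht; linarith)] at h1
  have h2 : ContinuousOn B (Icc 0 (t + 1)) := h1.congr fun s hs => h.eq_integral s hs.1
  have h3 := h2 t ⟨ht, by linarith⟩
  refine h3.mono_of_mem_nhdsWithin ?_
  rw [← Ici_inter_Iic]
  exact inter_mem_nhdsWithin _ (Iic_mem_nhds (by linarith))

lemma continuousOn_rho : ContinuousOn (fun t => ρ (B t)) (Ici 0) :=
  h.continuousOn.comp h.continuousOn_sol fun t ht => h.nonpos t ht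

lemma hasDerivAt {t : ℝ} (ht : 0 < t) : HasDerivAt B (ρ (B t) - 1) t := by
  have hc : ContinuousOn (fun t => ρ (B t) - 1) (Ici 0) := h.continuousOn_rho.sub continuousOn_const
  have h1 : HasDerivAt (fun T => ∫ s in (0 : ℝ)..T, (ρ (B s) - 1)) (ρ (B t) - 1) t := by
    refine intervalIntegral.integral_hasDerivAt_right (h.intervalIntegrable t ht) ?_ ?_
    · exact hc.stronglyMeasurableAtFilter_nhdsWithin measurableSet_Ici t |>.filter_mono
        (by rw [nhdsWithin_eq_nhds.2 (Ici_mem_nhds ht)])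
    · exact hc.continuousAt (Ici_mem_nhds ht)
  refine h1.congr_of_eventuallyEq ?_
  filter_upwards [Ioi_mem_nhds ht] with s hs using h.eq_integral s (le_of_lt hs)

lemma exists_slope : ∃ m, ∀ u ≤ 0, 1 + m * (u - c) ≤ ρ u := by
  obtain ⟨m, hm⟩ := exists_subgradient h.convexOn (x := c) (by
    rw [interior_Iic]; exact h.neg)
  exact ⟨m, fun u hu => by have := hm u hu; rwa [h.map_c] at this⟩

/-- Grönwall's argument with a subgradient `m` of `ρ` at `c`: `B' ≥ m (B - c)`, so `exp (-m t) (B -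
c)` never falls below its initial value `-c > 0`. Thus `c` is not reached in finite time. -/
lemma lt_sol {t : ℝ} (ht : 0 ≤ t) : c < B t := by
  obtain ⟨m, hm⟩ := h.exists_slope
  have hd : ∀ s, 0 < s → HasDerivAt (fun s => Real.exp (-m * s) * (B s - c))
      (Real.exp (-m * s) * (-m) * (B s - c) + Real.exp (-m * s) * (ρ (B s) - 1)) s := by
    intro s hs
    have h1 : HasDerivAt (fun s : ℝ => Real.exp (-m * s)) (Real.exp (-m * s) * (-m)) s := by
      simpa using ((hasDerivAt_id s).const_mul (-m)).exp
    exact h1.mul ((h.hasDerivAt hs).sub_const c)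
  have hmono : MonotoneOn (fun s => Real.exp (-m * s) * (B s - c)) (Ici 0) := by
    refine monotoneOn_of_deriv_nonneg (convex_Ici 0) ?_ ?_ ?_
    · exact ContinuousOn.mul (by fun_prop) (h.continuousOn_sol.sub continuousOn_const)
    · rw [interior_Ici]
      exact fun s hs => (hd s hs).differentiableAt.differentiableWithinAt
    · rw [interior_Ici]
      intro s hs
      rw [(hd s hs).deriv]
      have h2 := hm (B s) (h.nonpos s (le_of_lt hs))
      have h3 := Real.exp_pos (-m * s)
      have : Real.exp (-m * s) * (-m) * (B s - c) + Real.exp (-m * s) * (ρ (B s) - 1)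
        = Real.exp (-m * s) * (ρ (B s) - (1 + m * (B s - c))) := by ring
      rw [this]
      exact mul_nonneg h3.le (by linarith)
  have h4 := hmono self_mem_Ici ht ht
  simp only [mul_zero, Real.exp_zero, one_mul, h.zero] at h4
  have h5 : 0 < Real.exp (-m * t) * (B t - c) := by linarith [h.neg]
  have := (pos_iff_pos_of_mul_pos h5).1 (Real.exp_pos _)
  linarith

lemma rho_le {u : ℝ} (hu : u ∈ Icc c 0) : ρ u ≤ u / c := by
  have h1 := convexOn_between h.convexOn (u := c) (v := u) (w := 0) h.neg.le (by simp) hu.1 hu.2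
  rw [h.map_c, h.map_zero] at h1
  rw [le_div_iff_of_neg h.neg]
  linarith

lemma rho_lt_one {u : ℝ} (hu : u ∈ Ioc c 0) : ρ u < 1 := by
  refine (h.rho_le ⟨hu.1.le, hu.2⟩).trans_lt ?_
  rw [div_lt_one_of_neg h.neg]
  exact hu.1

lemma mem {t : ℝ} (ht : 0 ≤ t) : B t ∈ Ioc c 0 := ⟨h.lt_sol ht, h.nonpos t ht⟩

lemma strictAntiOn : StrictAntiOn B (Ici 0) := by
  refine strictAntiOn_of_deriv_neg (convex_Ici 0) h.continuousOn_sol ?_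
  rw [interior_Ici]
  intro t ht
  rw [(h.hasDerivAt ht).deriv]
  linarith [h.rho_lt_one (h.mem (le_of_lt ht))]

/-- The chord of `ρ` over `[c, 0]` gives `B' ≤ (B - c) / c`; hence exponential convergence to `c` at
rate `-1 / c`, the quasi-mean-reversion. -/
lemma sol_sub_le {t : ℝ} (ht : 0 ≤ t) : B t - c ≤ -c * Real.exp (t / c) := by
  have hd : ∀ s, 0 < s → HasDerivAt (fun s => Real.exp (-s / c) * (B s - c))
      (Real.exp (-s / c) * (-1 / c) * (B s - c) + Real.exp (-s / c) * (ρ (B s) - 1)) s := by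
    intro s hs
    have h1 : HasDerivAt (fun s : ℝ => Real.exp (-s / c)) (Real.exp (-s / c) * (-1 / c)) s := by
      simpa using ((hasDerivAt_id s).neg.div_const c).exp
    exact h1.mul ((h.hasDerivAt hs).sub_const c)
  have hanti : AntitoneOn (fun s => Real.exp (-s / c) * (B s - c)) (Ici 0) := by
    refine antitoneOn_of_deriv_nonpos (convex_Ici 0) ?_ ?_ ?_
    · exact ContinuousOn.mul (by fun_prop) (h.continuousOn_sol.sub continuousOn_const)
    · rw [interior_Ici]
      exact fun s hs => (hd s hs).differentiableAt.differentiableWithinAt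
    · rw [interior_Ici]
      intro s hs
      rw [(hd s hs).deriv]
      have h2 := h.rho_le ⟨(h.lt_sol (le_of_lt hs)).le, h.nonpos s (le_of_lt hs)⟩
      have h3 := Real.exp_pos (-s / c)
      have : Real.exp (-s / c) * (-1 / c) * (B s - c) + Real.exp (-s / c) * (ρ (B s) - 1)
        = Real.exp (-s / c) * (ρ (B s) - B s / c) := by
        have := h.neg.ne
        field_simp; ring
      rw [this]
      exact mul_nonpos_of_nonneg_of_nonpos h3.le (by linarith)
  have h4 := hanti self_mem_Ici ht ht
  simp only [neg_zero, zero_div, Real.exp_zero, one_mul, h.zero] at h4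
  have h5 : Real.exp (-t / c) * Real.exp (t / c) = 1 := by
    rw [← Real.exp_add, neg_div, neg_add_cancel, Real.exp_zero]
  have h6 := mul_le_mul_of_nonneg_right h4 (Real.exp_pos (t / c)).le
  calc B t - c = Real.exp (-t / c) * (B t - c) * Real.exp (t / c) := by
        rw [mul_right_comm, h5, one_mul]
    _ ≤ _ := h6
    _ = _ := by ring

lemma tendsto_mul_exp : Tendsto (fun t => t * Real.exp (t / c)) atTop (𝓝 0) := by
  have h1 := Real.tendsto_pow_mul_exp_neg_atTop_nhds_zero 1
  have h2 : Tendsto (fun t : ℝ => t / -c) atTop atTop :=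
    tendsto_id.atTop_div_const (by linarith [h.neg])
  have h3 := (h1.comp h2).const_mul (-c)
  rw [mul_zero] at h3
  refine h3.congr fun t => ?_
  have := h.neg.ne
  simp only [Function.comp_apply, pow_one]
  rw [← mul_assoc]
  congr 1
  · field_simp
  · congr 1; field_simp

lemma tendsto_sol : Tendsto B atTop (𝓝 c) := by
  have h1 : Tendsto (fun t => c + -c * Real.exp (t / c)) atTop (𝓝 (c + -c * 0)) := by
    refine tendsto_const_nhds.add (Tendsto.const_mul _ (Real.tendsto_exp_atBot.comp ?_))
    exact tendsto_id.atTop_div_const_of_neg h.neg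
  rw [mul_zero, add_zero] at h1
  refine tendsto_of_tendsto_of_tendsto_of_le_of_le' tendsto_const_nhds h1 ?_ ?_
  · filter_upwards [eventually_ge_atTop 0] with t ht using (h.lt_sol ht).le
  · filter_upwards [eventually_ge_atTop 0] with t ht
    linarith [h.sol_sub_le ht]

/-- The subgradient at `c` bounds `ρ (B t) - 1` below by a multiple of `B t - c`, whose exponential
decay beats the factor `t`. This is the boundary term in the excess of `ρ ∘ B`. -/
lemma tendsto_mul_rho : Tendsto (fun t => t * (ρ (B t) - 1)) atTop (𝓝 0) := by
  obtain ⟨m, hm⟩ := h.exists_slope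
  have h1 := h.tendsto_mul_exp.const_mul (-|m| * -c)
  rw [mul_zero] at h1
  refine tendsto_of_tendsto_of_tendsto_of_le_of_le' h1 tendsto_const_nhds ?_ ?_
  · filter_upwards [eventually_ge_atTop 0] with t ht
    have h2 := hm (B t) (h.nonpos t ht)
    have h3 := h.sol_sub_le ht
    have h4 := h.lt_sol ht
    have h5 : -|m| * (B t - c) ≤ m * (B t - c) := by
      have := neg_abs_le m
      have : 0 ≤ B t - c := by linarith
      gcongr
    have h6 : -|m| * (-c * Real.exp (t / c)) ≤ -|m| * (B t - c) := by
      have := abs_nonneg m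
      nlinarith
    calc -|m| * -c * (t * Real.exp (t / c)) = t * (-|m| * (-c * Real.exp (t / c))) := by ring
      _ ≤ t * (ρ (B t) - 1) := by
        apply mul_le_mul_of_nonneg_left _ ht
        linarith
  · filter_upwards [eventually_ge_atTop 0] with t ht
    exact mul_nonpos_of_nonneg_of_nonpos ht (by linarith [h.rho_lt_one (h.mem ht)])

lemma image_Ioi : B '' Ioi 0 = Ioo c 0 := by
  ext u
  constructor
  · rintro ⟨t, ht, rfl⟩
    refine ⟨h.lt_sol (le_of_lt ht), ?_⟩
    have := h.strictAntiOn self_mem_Ici (Ioi_subset_Ici_self ht) ht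
    rwa [h.zero] at this
  · rintro ⟨hu1, hu2⟩
    obtain ⟨T, hT, hT0⟩ := ((h.tendsto_sol.eventually_lt_const hu1).and
      (eventually_gt_atTop 0)).exists
    obtain ⟨a, ha, hau⟩ := intermediate_value_Icc' hT0.le
      (h.continuousOn_sol.mono fun x hx => hx.1) ⟨hT.le, by rw [h.zero]; exact hu2.le⟩
    refine ⟨a, ?_, hau⟩
    rcases ha.1.eq_or_lt with h1 | h1
    · rw [← h1, h.zero] at hau; linarith
    · exact h1

/-- The change of variables `u = B s`. -/
lemma lintegral_Ioo (k : ℝ → ℝ≥0∞) :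
    ∫⁻ u in Ioo c 0, k u = ∫⁻ s in Ioi 0, ENNReal.ofReal (1 - ρ (B s)) * k (B s) := by
  rw [← h.image_Ioi, lintegral_image_eq_lintegral_abs_deriv_mul measurableSet_Ioi
    (fun t ht => (h.hasDerivAt ht).hasDerivWithinAt)
    (h.strictAntiOn.injOn.mono Ioi_subset_Ici_self)]
  refine setLIntegral_congr_fun measurableSet_Ioi fun t ht => ?_
  rw [abs_of_neg (by linarith [h.rho_lt_one (h.mem (le_of_lt ht))]), neg_sub]

/-- Since `∫₀ᵀ ρ (B s) ds = B T + T`, the excess equals `B T - T (ρ (B T) - 1)`. -/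
lemma tendsto_excess_rho :
    Tendsto (excess fun s => ρ (B s)) atTop (𝓝 c) := by
  have h1 := h.tendsto_sol.sub h.tendsto_mul_rho
  rw [sub_zero] at h1
  refine h1.congr' ?_
  filter_upwards [eventually_gt_atTop 0] with t ht
  have h2 := h.eq_integral t ht.le
  rw [intervalIntegral.integral_sub
    (intervalIntegrable_of_continuousOn_Ici h.continuousOn_rho le_rfl ht.le)
    intervalIntegrable_const, intervalIntegral.integral_const] at h2
  simp only [sub_zero, smul_eq_mul, mul_one] at h2
  simp only [excess]
  rw [h2]; ring

end IsRiccati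

end Riccati

/-! ### The limit of the excess at infinity -/

section ExcessLimit

lemma excess_le_of_monotoneOn {K : ℝ → ℝ} (hK : ContinuousOn K (Ici 0)) {s₀ S T : ℝ} (hs : 0 ≤ s₀)
    (hm : MonotoneOn K (Ici s₀)) (hS : s₀ ≤ S) (hT : S ≤ T) :
    excess K T ≤ (∫ s in (0 : ℝ)..S, K s) - S * K T := by
  have h0 : 0 ≤ S := hs.trans hS
  have h2 := intervalIntegral.integral_add_adjacent_intervals
    (intervalIntegrable_of_continuousOn_Ici hK le_rfl h0)
    (intervalIntegrable_of_continuousOn_Ici hK h0 (h0.trans hT))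
  have h1 : ∫ s in S..T, K s ≤ ∫ s in S..T, K T := by
    refine intervalIntegral.integral_mono_on hT
      (intervalIntegrable_of_continuousOn_Ici hK h0 (h0.trans hT)) intervalIntegrable_const ?_
    exact fun x hx => hm (hS.trans hx.1) (hS.trans hT) hx.2
  rw [intervalIntegral.integral_const, smul_eq_mul] at h1
  simp only [excess]
  linarith

lemma coe_toReal_sub {a b : ℝ≥0∞} (ha : a ≠ ⊤) (hb : b ≠ ⊤) :
    ((a.toReal - b.toReal : ℝ) : EReal) = (a : EReal) - (b : EReal) := by
  rw [EReal.coe_sub, EReal.coe_ennreal_toReal ha, EReal.coe_ennreal_toReal hb]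

/-- The excess of a function that eventually increases to zero converges to its improper
integral. -/
lemma tendsto_excess_of_monotoneOn {K : ℝ → ℝ} (hK : ContinuousOn K (Ici 0)) {s₀ : ℝ} (hs : 0 ≤ s₀)
    (hm : MonotoneOn K (Ici s₀)) (hlim : Tendsto K atTop (𝓝 0)) :
    (∫⁻ s in Ioi 0, ENNReal.ofReal (K s)) ≠ ⊤ ∧
    Tendsto (fun T => (excess K T : EReal)) atTop
      (𝓝 (((∫⁻ s in Ioi 0, ENNReal.ofReal (K s) : ℝ≥0∞) : EReal)
        - ((∫⁻ s in Ioi 0, ENNReal.ofReal (-K s) : ℝ≥0∞) : EReal))) := by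
  have hnonpos : ∀ s, s₀ ≤ s → K s ≤ 0 := by
    intro s hs'
    refine ge_of_tendsto hlim ?_
    filter_upwards [eventually_ge_atTop s] with t ht
    exact hm hs' (hs'.trans ht) ht
  have hint : ∀ T, 0 ≤ T → IntegrableOn K (Ioc 0 T) := fun T hT =>
    (intervalIntegrable_iff_integrableOn_Ioc_of_le hT).1
      (intervalIntegrable_of_continuousOn_Ici hK le_rfl hT)
  have hmeas : AEMeasurable K (volume.restrict (Ioi 0)) :=
    (hK.mono Ioi_subset_Ici_self).aemeasurable measurableSet_Ioi
  have hfin : ∀ T, 0 ≤ T → (∫⁻ s in Ioc 0 T, ENNReal.ofReal (K s)) ≠ ⊤ := fun T hT =>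
    (hint T hT).lintegral_lt_top.ne
  have hfin' : ∀ T, 0 ≤ T → (∫⁻ s in Ioc 0 T, ENNReal.ofReal (-K s)) ≠ ⊤ := fun T hT =>
    (hint T hT).neg.lintegral_lt_top.ne
  have hP : (∫⁻ s in Ioi 0, ENNReal.ofReal (K s)) ≠ ⊤ := by
    rw [← Ioc_union_Ioi_eq_Ioi hs, lintegral_union measurableSet_Ioi (Ioc_disjoint_Ioi le_rfl)]
    have : ∫⁻ s in Ioi s₀, ENNReal.ofReal (K s) = 0 := by
      rw [setLIntegral_congr_fun (g := fun _ => 0) measurableSet_Ioi, lintegral_zero]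
      intro s hs'
      exact ENNReal.ofReal_of_nonpos (hnonpos s (le_of_lt hs'))
    rw [this, add_zero]
    exact hfin s₀ hs
  refine ⟨hP, ?_⟩
  have cover : AECover (volume.restrict (Ioi (0 : ℝ))) atTop (fun T : ℝ => Iic T) :=
    aecover_Iic tendsto_id
  have hrestr : ∀ T : ℝ, (volume.restrict (Ioi (0 : ℝ))).restrict (Iic T)
      = volume.restrict (Ioc 0 T) := by
    intro T
    rw [Measure.restrict_restrict measurableSet_Iic, inter_comm, Ioi_inter_Iic]
  have l1 := cover.lintegral_tendsto_of_countably_generated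
    (f := fun s => ENNReal.ofReal (K s)) hmeas.ennreal_ofReal
  have l2 := cover.lintegral_tendsto_of_countably_generated
    (f := fun s => ENNReal.ofReal (-K s)) hmeas.neg.ennreal_ofReal
  simp only [hrestr] at l1 l2
  set P := ∫⁻ s in Ioi 0, ENNReal.ofReal (K s)
  set Q := ∫⁻ s in Ioi 0, ENNReal.ofReal (-K s)
  have hJ : Tendsto (fun T => ((∫ s in (0 : ℝ)..T, K s : ℝ) : EReal)) atTop
      (𝓝 ((P : EReal) - (Q : EReal))) := by
    have e1 := (continuous_coe_ennreal_ereal.tendsto P).comp l1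
    have e2 := (continuous_neg.tendsto _).comp ((continuous_coe_ennreal_ereal.tendsto Q).comp l2)
    have e3 := (EReal.continuousAt_add (p := ((P : EReal), -(Q : EReal)))
      (Or.inl (by simpa using hP)) (Or.inl (by simp))).tendsto.comp (e1.prodMk_nhds e2)
    rw [sub_eq_add_neg]
    refine e3.congr' ?_
    filter_upwards [eventually_ge_atTop 0] with T hT
    simp only [Function.comp_apply]
    rw [← sub_eq_add_neg, ← coe_toReal_sub (hfin T hT) (hfin' T hT),
      intervalIntegral.integral_of_le hT,
      integral_eq_lintegral_pos_part_sub_lintegral_neg_part (hint T hT)]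
  -- For large `T` one has `K T ≤ 0`, so the excess is at least `∫₀ᵀ K`. For the upper bound, `S` is
  -- frozen while `T → ∞`, which removes the term `S * K T`. The argument covers the limit `-∞`.
  rw [tendsto_order] at hJ ⊢
  constructor
  · intro a ha
    filter_upwards [hJ.1 a ha, eventually_ge_atTop s₀] with T h1 h2
    refine h1.trans_le (EReal.coe_le_coe_iff.2 ?_)
    have := mul_nonneg (hs.trans h2) (neg_nonneg.2 (hnonpos T h2))
    simp only [excess]
    linarith
  · intro a ha
    obtain ⟨S, hS, hS0⟩ := ((hJ.2 a ha).and (eventually_ge_atTop s₀)).exists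
    have h1 : Tendsto (fun T => (((∫ s in (0 : ℝ)..S, K s) - S * K T : ℝ) : EReal)) atTop
        (𝓝 ((∫ s in (0 : ℝ)..S, K s : ℝ) : EReal)) := by
      refine (continuous_coe_real_ereal.tendsto _).comp ?_
      simpa using tendsto_const_nhds.sub (hlim.const_mul S)
    filter_upwards [h1.eventually_lt_const hS, eventually_ge_atTop S] with T h2 h3
    exact lt_of_le_of_lt (EReal.coe_le_coe_iff.2 (excess_le_of_monotoneOn hK hs hm hS0 h3)) h2

lemma excess_add_const {K : ℝ → ℝ} (hK : ContinuousOn K (Ici 0)) (a : ℝ) {T : ℝ} (hT : 0 ≤ T) :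
    excess (fun s => K s + a) T = excess K T := by
  simp only [excess]
  rw [intervalIntegral.integral_add (intervalIntegrable_of_continuousOn_Ici hK le_rfl hT)
    intervalIntegrable_const, intervalIntegral.integral_const]
  simp only [smul_eq_mul]; ring

/-- Near the left end point a convex function is monotone or antitone. -/
lemma exists_monotoneOn_or_antitoneOn {c : ℝ} {f : ℝ → ℝ} (hc : c < 0)
    (hf : ConvexOn ℝ (Ioc c 0) f) :
    ∃ e ∈ Ioc c 0, MonotoneOn f (Ioc c e) ∨ AntitoneOn f (Ioc c e) := by
  by_cases h : ∃ u ∈ Ioc c 0, ∃ v ∈ Ioc c 0, u < v ∧ f v < f u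
  · obtain ⟨u, hu, v, hv, huv, hlt⟩ := h
    refine ⟨u, hu, Or.inr fun p hp q hq hpq => ?_⟩
    have hq' : q ∈ Ioc c 0 := ⟨hq.1, hq.2.trans hu.2⟩
    have hp' : p ∈ Ioc c 0 := ⟨hp.1, hp.2.trans hu.2⟩
    have h1 := convexOn_between hf hq' hv hq.2 huv.le
    have h3 : f u ≤ f q := by
      by_contra hcon
      rw [not_le] at hcon
      nlinarith [hq.2]
    have h2 := convexOn_between hf hp' hv hpq (hq.2.trans huv.le)
    by_contra hcon
    rw [not_le] at hcon
    nlinarith [hq.2]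
  · push Not at h
    refine ⟨0, ⟨hc, le_rfl⟩, Or.inl fun u hu v hv huv => ?_⟩
    rcases huv.eq_or_lt with h1 | h1
    · rw [h1]
    · exact h u hu v hv h1

variable {c : ℝ} {ρ B f : ℝ → ℝ}

/-- The excess ignores additive constants, so `f (B s)` may be replaced by `K s = f (B s) - a`,
which tends to zero. A convex `f` is monotone near `c`, hence `K` or `-K` eventually increases to
zero and the excess tends to the improper integral of `K`; the substitution `u = B s` moves it to
`(c, 0)`. -/
lemma IsRiccati.tendsto_excess_of_real (h : IsRiccati c ρ B) (hf : ConvexOn ℝ (Ioc c 0) f)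
    (hfc : ContinuousOn f (Ioc c 0)) {a : ℝ} (hlim : Tendsto f (𝓝[>] c) (𝓝 a)) :
    Tendsto (fun T => (excess (fun s => f (B s)) T : EReal)) atTop
      (𝓝 (-eintegral (volume.restrict (Ioo c 0))
        (fun u => ((f u : EReal) - (a : EReal)) / ((ρ u : EReal) - 1)))) := by
  set K : ℝ → ℝ := fun s => f (B s) + -a with hKdef
  have hfB : ContinuousOn (fun s => f (B s)) (Ici 0) :=
    hfc.comp h.continuousOn_sol fun t ht => h.mem ht
  have hK : ContinuousOn K (Ici 0) := hfB.add continuousOn_const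
  have hBlim : Tendsto B atTop (𝓝[>] c) :=
    tendsto_nhdsWithin_iff.2 ⟨h.tendsto_sol, by
      filter_upwards [eventually_ge_atTop 0] with t ht using h.lt_sol ht⟩
  have hKlim : Tendsto K atTop (𝓝 0) := by
    simpa [hKdef, Function.comp_def] using (hlim.comp hBlim).add_const (-a)
  have hI : eintegral (volume.restrict (Ioo c 0))
        (fun u => ((f u : EReal) - (a : EReal)) / ((ρ u : EReal) - 1))
      = ((∫⁻ s in Ioi 0, ENNReal.ofReal (-K s) : ℝ≥0∞) : EReal)
        - ((∫⁻ s in Ioi 0, ENNReal.ofReal (K s) : ℝ≥0∞) : EReal) := by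
    have e : ∀ u, ((f u : EReal) - (a : EReal)) / ((ρ u : EReal) - 1)
        = (((f u - a) / (ρ u - 1) : ℝ) : EReal) := by
      intro u
      rw [EReal.coe_div, EReal.coe_sub, EReal.coe_sub, EReal.coe_one]
    unfold eintegral
    simp only [e, ← EReal.coe_neg, EReal.real_coe_toENNReal]
    rw [h.lintegral_Ioo, h.lintegral_Ioo]
    congr 2
    · refine setLIntegral_congr_fun measurableSet_Ioi fun s hs => ?_
      have := h.rho_lt_one (h.mem (le_of_lt hs))
      rw [← ENNReal.ofReal_mul (by linarith)]
      congr 1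
      have h2 : ρ (B s) - 1 ≠ 0 := by linarith
      simp only [hKdef]
      field_simp
      ring
    · refine setLIntegral_congr_fun measurableSet_Ioi fun s hs => ?_
      have := h.rho_lt_one (h.mem (le_of_lt hs))
      rw [← ENNReal.ofReal_mul (by linarith)]
      congr 1
      have h2 : ρ (B s) - 1 ≠ 0 := by linarith
      simp only [hKdef]
      field_simp
      ring
  rw [hI]
  have hcongr : ∀ᶠ T in atTop, (excess K T : EReal) = (excess (fun s => f (B s)) T : EReal) := by
    filter_upwards [eventually_ge_atTop 0] with T hT
    rw [hKdef, excess_add_const hfB _ hT]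
  obtain ⟨e, he, hmono⟩ := exists_monotoneOn_or_antitoneOn h.neg hf
  obtain ⟨s₀, hs₀, hs₀0⟩ := ((h.tendsto_sol.eventually_lt_const he.1).and
    (eventually_ge_atTop 0)).exists
  have hBe : ∀ s ∈ Ici s₀, B s ∈ Ioc c e := fun s hs => ⟨h.lt_sol (hs₀0.trans hs),
    (h.strictAntiOn.antitoneOn hs₀0 (hs₀0.trans hs) hs).trans hs₀.le⟩
  rcases hmono with hm | hm
  · have hm' : MonotoneOn (fun s => -K s) (Ici s₀) := by
      intro x hx y hy hxy
      have := hm (hBe y hy) (hBe x hx) (h.strictAntiOn.antitoneOn (hs₀0.trans hx)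
        (hs₀0.trans hy) hxy)
      simp only [hKdef]; linarith
    have := tendsto_excess_of_monotoneOn (K := fun s => -K s) hK.neg hs₀0 hm'
      (by simpa using hKlim.neg)
    simp only [neg_neg] at this
    refine ((continuous_neg.tendsto _).comp this.2).congr' ?_
    filter_upwards [hcongr] with T hT
    simp only [Function.comp_apply]
    rw [excess_neg, EReal.coe_neg, neg_neg, hT]
  · have hm' : MonotoneOn K (Ici s₀) := by
      intro x hx y hy hxy
      have := hm (hBe y hy) (hBe x hx) (h.strictAntiOn.antitoneOn (hs₀0.trans hx)
        (hs₀0.trans hy) hxy)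
      simp only [hKdef]; linarith
    have := tendsto_excess_of_monotoneOn hK hs₀0 hm' hKlim
    -- Negating a difference of extended reals needs one finite term; here it is the integral of the
    -- positive part of `K`.
    rw [EReal.neg_sub (Or.inr (by simp)) (Or.inr (by simpa using this.1)), add_comm,
      ← sub_eq_add_neg]
    exact this.2.congr' hcongr

/-- With `F(c) = ∞` the integrand is `-∞` over a negative number, that is `+∞`, everywhere on `(c,
0)`. On the other side `f (B T) → ∞`, so that the term `-s₀ * f (B T)` drives the excess to `-∞`. -/
lemma IsRiccati.tendsto_excess_of_top (h : IsRiccati c ρ B) (hf : ConvexOn ℝ (Ioc c 0) f)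
    (hfc : ContinuousOn f (Ioc c 0)) (hlim : Tendsto f (𝓝[>] c) atTop) :
    Tendsto (fun T => (excess (fun s => f (B s)) T : EReal)) atTop
      (𝓝 (-eintegral (volume.restrict (Ioo c 0))
        (fun u => ((f u : EReal) - ⊤) / ((ρ u : EReal) - 1)))) := by
  have hfB : ContinuousOn (fun s => f (B s)) (Ici 0) :=
    hfc.comp h.continuousOn_sol fun t ht => h.mem ht
  have hBlim : Tendsto B atTop (𝓝[>] c) :=
    tendsto_nhdsWithin_iff.2 ⟨h.tendsto_sol, by
      filter_upwards [eventually_ge_atTop 0] with t ht using h.lt_sol ht⟩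
  have hI : eintegral (volume.restrict (Ioo c 0))
        (fun u => ((f u : EReal) - ⊤) / ((ρ u : EReal) - 1)) = ⊤ := by
    have e : ∀ u ∈ Ioo c 0, ((f u : EReal) - ⊤) / ((ρ u : EReal) - 1) = ⊤ := by
      intro u hu
      have hlt := h.rho_lt_one ⟨hu.1, hu.2.le⟩
      have h1 : ((ρ u : EReal) - 1) = ((ρ u - 1 : ℝ) : EReal) := by
        rw [EReal.coe_sub, EReal.coe_one]
      rw [EReal.sub_top, h1, EReal.bot_div_of_neg_ne_bot (by
        exact_mod_cast (by linarith : ρ u - 1 < 0)) (EReal.coe_ne_bot _)]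
    unfold eintegral
    rw [setLIntegral_congr_fun (g := fun _ => ⊤) measurableSet_Ioo (fun u hu => by
      simp only [e u hu, EReal.toENNReal_top]),
      setLIntegral_congr_fun (g := fun _ => 0) (f := fun u =>
        (-(((f u : EReal) - ⊤) / ((ρ u : EReal) - 1))).toENNReal) measurableSet_Ioo
        (fun u hu => by simp only [e u hu]; simp)]
    have hv : (volume (Ioo c 0)) ≠ 0 := by
      rw [Real.volume_Ioo]; simpa using h.neg
    rw [lintegral_zero, setLIntegral_const, ENNReal.top_mul hv]
    simp
  rw [hI, EReal.neg_top, EReal.tendsto_nhds_bot_iff_real]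
  obtain ⟨e, he, hmono⟩ := exists_monotoneOn_or_antitoneOn h.neg hf
  obtain ⟨s₀, hs₀, hs₀0⟩ := ((h.tendsto_sol.eventually_lt_const he.1).and
    (eventually_gt_atTop 0)).exists
  have hBe : ∀ s ∈ Ici s₀, B s ∈ Ioc c e := fun s hs => ⟨h.lt_sol (hs₀0.le.trans hs),
    (h.strictAntiOn.antitoneOn hs₀0.le (hs₀0.le.trans hs) hs).trans hs₀.le⟩
  rcases hmono with hm | hm
  · exfalso
    obtain ⟨u, hu1, hu2⟩ := ((hlim.eventually_gt_atTop (f e)).and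
      (Ioo_mem_nhdsGT he.1)).exists
    exact absurd (hm ⟨hu2.1, hu2.2.le⟩ ⟨he.1, le_rfl⟩ hu2.2.le) (not_le.2 hu1)
  · have hm' : MonotoneOn (fun s => f (B s)) (Ici s₀) := by
      intro x hx y hy hxy
      exact hm (hBe y hy) (hBe x hx) (h.strictAntiOn.antitoneOn (hs₀0.le.trans hx)
        (hs₀0.le.trans hy) hxy)
    intro x
    have h1 : Tendsto (fun T => (∫ s in (0 : ℝ)..s₀, f (B s)) - s₀ * f (B T)) atTop atBot :=
      tendsto_atBot_add_const_left _ _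
        (tendsto_neg_atTop_atBot.comp ((hlim.comp hBlim).const_mul_atTop hs₀0))
    filter_upwards [h1.eventually_lt_atBot x, eventually_ge_atTop s₀] with T h2 h3
    refine EReal.coe_lt_coe_iff.2 (lt_of_le_of_lt ?_ h2)
    exact excess_le_of_monotoneOn hfB hs₀0.le hm' le_rfl h3

lemma IsRiccati.tendsto_excess (h : IsRiccati c ρ B) (hf : ConvexOn ℝ (Ioc c 0) f)
    (hfc : ContinuousOn f (Ioc c 0)) {Fc : EReal} (hbot : Fc ≠ ⊥)
    (hlim : Tendsto (fun u => (f u : EReal)) (𝓝[>] c) (𝓝 Fc)) (r : ℝ) :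
    Tendsto (fun T => (excess (fun s => f (B s) + r * ρ (B s)) T : EReal)) atTop
      (𝓝 (-eintegral (volume.restrict (Ioo c 0))
        (fun u => ((f u : EReal) - Fc) / ((ρ u : EReal) - 1)) + ((r * c : ℝ) : EReal))) := by
  have hfB : ContinuousOn (fun s => f (B s)) (Ici 0) :=
    hfc.comp h.continuousOn_sol fun t ht => h.mem ht
  have key : Tendsto (fun T => (excess (fun s => f (B s)) T : EReal)) atTop
      (𝓝 (-eintegral (volume.restrict (Ioo c 0))
        (fun u => ((f u : EReal) - Fc) / ((ρ u : EReal) - 1)))) := by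
    induction Fc with
    | bot => exact absurd rfl hbot
    | coe a => exact h.tendsto_excess_of_real hf hfc (EReal.tendsto_coe.1 hlim)
    | top => exact h.tendsto_excess_of_top hf hfc (EReal.tendsto_coe_nhds_top_iff.1 hlim)
  have h2 : Tendsto (fun T => ((r * excess (fun s => ρ (B s)) T : ℝ) : EReal)) atTop
      (𝓝 ((r * c : ℝ) : EReal)) :=
    (continuous_coe_real_ereal.tendsto _).comp (h.tendsto_excess_rho.const_mul r)
  have h3 := (EReal.continuousAt_add (p := (_, ((r * c : ℝ) : EReal)))
    (Or.inr (EReal.coe_ne_bot _)) (Or.inr (EReal.coe_ne_top _))).tendsto.comp (key.prodMk_nhds h2)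
  refine h3.congr' ?_
  filter_upwards [eventually_ge_atTop 0] with T hT
  simp only [Function.comp_apply]
  rw [← EReal.coe_add]
  congr 1
  simp only [excess]
  rw [intervalIntegral.integral_add (intervalIntegrable_of_continuousOn_Ici hfB le_rfl hT)
    (intervalIntegrable_of_continuousOn_Ici (h.continuousOn_rho.const_mul r) le_rfl hT),
    intervalIntegral.integral_const_mul]
  ring

end ExcessLimit

lemma IsNormal.congr {y z : ℝ → ℝ} (h : IsNormal y) (hyz : ∀ T, 0 < T → z T = y T) : IsNormal z :=
  StrictMonoOn.congr h fun T hT => (hyz T hT).symm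

lemma IsInverse.congr {y z : ℝ → ℝ} (h : IsInverse y) (hyz : ∀ T, 0 < T → z T = y T) :
    IsInverse z :=
  StrictAntiOn.congr h fun T hT => (hyz T hT).symm

lemma IsHumped.congr {y z : ℝ → ℝ} (h : IsHumped y) (hyz : ∀ T, 0 < T → z T = y T) :
    IsHumped z := by
  have e : ∀ T, 0 < T → z =ᶠ[𝓝 T] y := fun T hT => by
    filter_upwards [Ioi_mem_nhds hT] with s hs using hyz s hs
  obtain ⟨⟨a, ⟨ha, hmax⟩, huniq⟩, hmin⟩ := h
  refine ⟨⟨a, ⟨ha, ?_⟩, ?_⟩, ?_⟩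
  · exact (e a ha).isLocalMax_iff.2 hmax
  · rintro b ⟨hb, hbm⟩
    exact huniq b ⟨hb, (e b hb).isLocalMax_iff.1 hbm⟩
  · intro b hb hbm
    exact hmin b hb ((e b hb).isLocalMin_iff.1 hbm)

lemma eintegral_congr_restrict {S : Set ℝ} (hS : MeasurableSet S) {g h : ℝ → EReal}
    (hgh : ∀ u ∈ S, g u = h u) :
    eintegral (volume.restrict S) g = eintegral (volume.restrict S) h := by
  have h1 : ∫⁻ u in S, (g u).toENNReal = ∫⁻ u in S, (h u).toENNReal :=
    setLIntegral_congr_fun hS fun u hu => by simp only [hgh u hu]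
  have h2 : ∫⁻ u in S, (-g u).toENNReal = ∫⁻ u in S, (-h u).toENNReal :=
    setLIntegral_congr_fun hS fun u hu => by simp only [hgh u hu]
  rw [eintegral, eintegral, h1, h2]

/-! ### Left derivatives at zero -/

section Slopes

variable {c : ℝ} {f : ℝ → ℝ} {F : ℝ → EReal}

lemma slope_zero_mono (hf : ConvexOn ℝ (Ioc c 0) f) (hf0 : f 0 = 0) {u v : ℝ} (hu : c < u)
    (huv : u ≤ v) (hv : v < 0) : f u / u ≤ f v / v := by
  have h := convexOn_between hf (u := u) (v := v) (w := 0) ⟨hu, by linarith⟩ ⟨by linarith, le_rfl⟩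
    huv hv.le
  rw [hf0] at h
  rw [div_le_iff_of_neg (by linarith), div_mul_eq_mul_div, div_le_iff_of_neg hv]
  linarith

lemma leftDerivZero_eq (hc : c < 0) (hf0 : f 0 = 0) (hF : ∀ u ∈ Ioc c 0, F u = f u) :
    leftDerivZero F = limsup (fun u => ((f u / u : ℝ) : EReal)) (𝓝[<] 0) := by
  refine limsup_congr ?_
  filter_upwards [Ioo_mem_nhdsLT hc] with u hu
  rw [hF u ⟨hu.1, hu.2.le⟩, hF 0 ⟨hc, le_rfl⟩, hf0, EReal.coe_zero, sub_zero, EReal.coe_div]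

lemma slope_le_leftDerivZero (hc : c < 0) (hf : ConvexOn ℝ (Ioc c 0) f) (hf0 : f 0 = 0)
    (hF : ∀ u ∈ Ioc c 0, F u = f u) {u : ℝ} (hu : u ∈ Ioo c 0) :
    ((f u / u : ℝ) : EReal) ≤ leftDerivZero F := by
  rw [leftDerivZero_eq hc hf0 hF]
  have h : ∀ᶠ v in 𝓝[<] (0 : ℝ), ((f u / u : ℝ) : EReal) ≤ ((f v / v : ℝ) : EReal) := by
    filter_upwards [Ioo_mem_nhdsLT hu.2] with v hv
    exact EReal.coe_le_coe_iff.2 (slope_zero_mono hf hf0 hu.1 hv.1.le hv.2)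
  calc ((f u / u : ℝ) : EReal) = limsup (fun _ => ((f u / u : ℝ) : EReal)) (𝓝[<] (0 : ℝ)) :=
        (limsup_const _).symm
    _ ≤ _ := limsup_le_limsup h

lemma exists_lt_slope (hc : c < 0) (hf0 : f 0 = 0)
    (hF : ∀ u ∈ Ioc c 0, F u = f u) {a : ℝ} (ha : (a : EReal) < leftDerivZero F) :
    ∃ u ∈ Ioo c 0, a < f u / u := by
  by_contra hcon
  push Not at hcon
  refine absurd ha (not_lt.2 ?_)
  rw [leftDerivZero_eq hc hf0 hF]
  refine limsup_le_of_le (by isBoundedDefault) ?_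
  filter_upwards [Ioo_mem_nhdsLT hc] with u hu
  exact EReal.coe_le_coe_iff.2 (hcon u hu)

end Slopes

/-! ### The boundaries between the shapes -/

section Shapes

variable {D : StateSpace} {Ω : Type*} [MeasurableSpace Ω]

/-- `-I + x c` is the limit of the excess and `I / c` the boundary; multiplication by `c < 0`
reverses the order. Infinite `I` are included. -/
lemma zero_le_limit_iff {c x : ℝ} (hc : c < 0) (I : EReal) :
    (x : EReal) ≤ ((1 / c : ℝ) : EReal) * I ↔ 0 ≤ -I + ((x * c : ℝ) : EReal) := by
  have h1 : 1 / c < 0 := one_div_neg.2 hc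
  induction I with
  | bot => rw [EReal.coe_mul_bot_of_neg h1, EReal.neg_bot, EReal.top_add_coe]; simp
  | top => rw [EReal.coe_mul_top_of_neg h1, EReal.neg_top, EReal.bot_add]; simp
  | coe a =>
    rw [← EReal.coe_mul, ← EReal.coe_neg, ← EReal.coe_add, EReal.coe_le_coe_iff, ← EReal.coe_zero,
      EReal.coe_le_coe_iff]
    rw [one_div_mul_eq_div, le_div_iff_of_neg hc]
    constructor <;> intro h <;> linarith

/-- Write `f u + x ρ u = u (f u / u + x ρ u / u)` with `u < 0`. The slopes increase to the left
derivatives at zero, so for `x ≥ 0` the bracket is positive somewhere exactly when `F'(0) + x R'(0)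
> 0`. A negative `x` is admitted only for linear `ρ`, whose slope is constant and needs no
monotonicity. -/
lemma bInv_cases {c x : ℝ} {f ρ : ℝ → ℝ} {F R : ℝ → EReal} (hc : c < 0)
    (hf : ConvexOn ℝ (Ioc c 0) f) (hf0 : f 0 = 0) (hF : ∀ u ∈ Ioc c 0, F u = f u)
    (hρ : ConvexOn ℝ (Ioc c 0) ρ) (hρ0 : ρ 0 = 0) (hR : ∀ u ∈ Ioc c 0, R u = ρ u)
    (hρc : ∀ u ∈ Ioc c 0, ρ u ≤ u / c)
    (hx : 0 ≤ x ∨ ∀ u ∈ Ioc c 0, ρ u = u / c) (hneg : leftDerivZero R < 0) :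
    (-leftDerivZero F / leftDerivZero R ≤ (x : EReal) → ∀ u ∈ Ioo c 0, 0 ≤ f u + x * ρ u) ∧
    ((x : EReal) < -leftDerivZero F / leftDerivZero R → ∃ u ∈ Ioo c 0, f u + x * ρ u < 0) := by
  have sR : ∀ u ∈ Ioo c 0, ((ρ u / u : ℝ) : EReal) ≤ leftDerivZero R := fun u hu =>
    slope_le_leftDerivZero hc hρ hρ0 hR hu
  have sF : ∀ u ∈ Ioo c 0, ((f u / u : ℝ) : EReal) ≤ leftDerivZero F := fun u hu =>
    slope_le_leftDerivZero hc hf hf0 hF hu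
  have eR : ∀ a : ℝ, (a : EReal) < leftDerivZero R → ∃ u ∈ Ioo c 0, a < ρ u / u := fun a ha =>
    exists_lt_slope hc hρ0 hR ha
  have eF : ∀ a : ℝ, (a : EReal) < leftDerivZero F → ∃ u ∈ Ioo c 0, a < f u / u := fun a ha =>
    exists_lt_slope hc hf0 hF ha
  have hmid : c / 2 ∈ Ioo c 0 := ⟨by linarith, by linarith⟩
  generalize leftDerivZero R = LR at *
  generalize leftDerivZero F = LF at *
  have sgn : ∀ u ∈ Ioo c 0, f u + x * ρ u = u * (f u / u + x * (ρ u / u)) := by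
    intro u hu
    have := hu.2.ne
    field_simp
  have lowR : ∀ u ∈ Ioo c 0, 1 / c ≤ ρ u / u := by
    intro u hu
    rw [le_div_iff_of_neg hu.2]
    have := hρc u ⟨hu.1, hu.2.le⟩
    calc ρ u ≤ u / c := this
      _ = _ := by ring
  induction LR with
  | bot => exact absurd (sR _ hmid) (by simp)
  | top => exact absurd hneg (by simp)
  | coe l =>
    have hl : l < 0 := by exact_mod_cast hneg
    have sR' : ∀ u ∈ Ioo c 0, ρ u / u ≤ l := fun u hu => EReal.coe_le_coe_iff.1 (sR u hu)
    have xR : ∀ u ∈ Ioo c 0, x * (ρ u / u) ≤ x * l := by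
      intro u hu
      rcases hx with hx | hx
      · exact mul_le_mul_of_nonneg_left (sR' u hu) hx
      · have e : ∀ v ∈ Ioo c 0, ρ v / v = 1 / c := fun v hv => by
          rw [hx v ⟨hv.1, hv.2.le⟩]
          have := hv.2.ne
          field_simp
        rcases (sR' u hu).eq_or_lt with h | h
        · rw [h]
        · obtain ⟨v, hv, hlt⟩ := eR _ (EReal.coe_lt_coe_iff.2 h)
          rw [e u hu, e v hv] at hlt
          exact absurd hlt (lt_irrefl _)
    induction LF with
    | bot => exact absurd (sF _ hmid) (by simp)
    | top =>
      rw [EReal.neg_top, EReal.bot_div_of_neg_ne_bot hneg (EReal.coe_ne_bot _)]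
      refine ⟨fun h => absurd h (by simp), fun _ => ?_⟩
      -- The slopes of `ρ` lie between `1 / c` and `l`, so `x` times such a slope is bounded by this
      -- number, which the slope of `f` exceeds when `F'(0) = ∞`.
      obtain ⟨u, hu, hlt⟩ := eF (|x| * (|1 / c| + |l|)) (EReal.coe_lt_top _)
      refine ⟨u, hu, ?_⟩
      rw [sgn u hu]
      refine mul_neg_of_neg_of_pos hu.2 ?_
      have h1 : |ρ u / u| ≤ |1 / c| + |l| := by
        rw [abs_le]
        have := neg_abs_le (1 / c)
        have := le_abs_self l
        have := abs_nonneg l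
        have := abs_nonneg (1 / c)
        constructor <;> linarith [lowR u hu, sR' u hu]
      have h2 : |x * (ρ u / u)| ≤ |x| * (|1 / c| + |l|) := by
        rw [abs_mul]; gcongr
      linarith [neg_abs_le (x * (ρ u / u))]
    | coe p =>
      have sF' : ∀ u ∈ Ioo c 0, f u / u ≤ p := fun u hu => EReal.coe_le_coe_iff.1 (sF u hu)
      rw [← EReal.coe_neg, ← EReal.coe_div, EReal.coe_le_coe_iff, EReal.coe_lt_coe_iff,
        div_le_iff_of_neg hl, lt_div_iff_of_neg hl]
      constructor
      · intro h u hu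
        rw [sgn u hu]
        refine mul_nonneg_of_nonpos_of_nonpos hu.2.le ?_
        linarith [sF' u hu, xR u hu]
      · intro h
        rcases hx with hx | hx
        -- Slopes within `ε` of both derivatives lose at most `ε (1 + x)`, which is half of the
        -- positive gap `p + x l`. Monotone slopes let the larger of the two points serve for both.
        · set ε := (p + x * l) / (2 * (1 + x)) with hε
          have hε0 : 0 < ε := by
            apply div_pos <;> linarith
          obtain ⟨u, hu, hu2⟩ := eF (p - ε) (EReal.coe_lt_coe_iff.2 (by linarith))
          obtain ⟨v, hv, hv2⟩ := eR (l - ε) (EReal.coe_lt_coe_iff.2 (by linarith))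
          have hw : max u v ∈ Ioo c 0 := ⟨hu.1.trans_le (le_max_left _ _), max_lt hu.2 hv.2⟩
          refine ⟨max u v, hw, ?_⟩
          rw [sgn _ hw]
          refine mul_neg_of_neg_of_pos hw.2 ?_
          have h1 := slope_zero_mono hf hf0 hu.1 (le_max_left u v) hw.2
          have h2 := slope_zero_mono hρ hρ0 hv.1 (le_max_right u v) hw.2
          have h3 : x * (l - ε) ≤ x * (ρ (max u v) / max u v) := by
            gcongr; linarith
          have h4 : ε * (1 + x) = (p + x * l) / 2 := by
            rw [hε]; field_simp
          nlinarith
        · have e : ∀ v ∈ Ioo c 0, ρ v / v = 1 / c := fun v hv => by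
            rw [hx v ⟨hv.1, hv.2.le⟩]
            have := hv.2.ne
            field_simp
          have el : l = 1 / c := by
            have h1 := sR' _ hmid
            rw [e _ hmid] at h1
            refine le_antisymm (le_of_not_gt fun hlt => ?_) h1
            obtain ⟨v, hv, hv2⟩ := eR _ (EReal.coe_lt_coe_iff.2 hlt)
            rw [e v hv] at hv2
            exact lt_irrefl _ hv2
          obtain ⟨u, hu, hu2⟩ := eF (-(x * l)) (EReal.coe_lt_coe_iff.2 (by linarith))
          refine ⟨u, hu, ?_⟩
          rw [sgn _ hu]
          refine mul_neg_of_neg_of_pos hu.2 ?_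
          rw [e u hu, ← el]
          linarith

/-- The shapes of the yield curve, given the affine form of bond prices. -/
theorem shapes_of_isRiccati (X : AffineProcess D Ω) (x : D.carrier) {c : ℝ} {f ρ B : ℝ → ℝ}
    (h : IsRiccati c ρ B) (hf : ConvexOn ℝ (Ioc c 0) f) (hfc : ContinuousOn f (Ioc c 0))
    (hf0 : f 0 = 0) (hF : ∀ u ∈ Ioc c 0, X.realF u = f u) (hR : ∀ u ∈ Ioc c 0, X.realR u = ρ u)
    (hlim : Tendsto (fun u => (f u : EReal)) (𝓝[>] c) (𝓝 (X.realF c))) (hbot : X.realF c ≠ ⊥)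
    (hstrict : StrictMonoOn (fun u => f u + x * ρ u) (Ioc c 0) ∨
      StrictConvexOn ℝ (Ioc c 0) (fun u => f u + x * ρ u))
    (hx : 0 ≤ (x : ℝ) ∨ ∀ u ∈ Ioc c 0, ρ u = u / c)
    (hdrift : 0 ≤ leftDerivZero X.realR → ∃ u ∈ Ioo c 0, f u + x * ρ u < 0)
    (hyield : ∀ T, 0 < T → X.yield T x
      = x - (∫ s in (0 : ℝ)..T, (f (B s) + x * ρ (B s))) / T) :
    (IsNormal (fun T => X.yield T x) ∨ IsInverse (fun T => X.yield T x) ∨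
        IsHumped (fun T => X.yield T x)) ∧
      (((x : ℝ) : EReal) ≤ X.bYNorm c → IsNormal (fun T => X.yield T x)) ∧
      (X.bYNorm c < ((x : ℝ) : EReal) → ((x : ℝ) : EReal) < X.bInv →
        IsHumped (fun T => X.yield T x)) ∧
      (X.bInv ≤ ((x : ℝ) : EReal) → IsInverse (fun T => X.yield T x)) := by
  have hc := h.neg
  set G : ℝ → ℝ := fun u => f u + x * ρ u with hG
  have hρcont : ContinuousOn ρ (Ioc c 0) := h.continuousOn.mono fun u hu => hu.2
  have hρconv : ConvexOn ℝ (Ioc c 0) ρ := h.convexOn.subset (fun u hu => hu.2) (convex_Ioc c 0)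
  have hGc : ContinuousOn G (Ioc c 0) := hfc.add (hρcont.const_mul _)
  have hv : IsValley (fun s => G (B s)) :=
    isValley_comp hGc hstrict h.continuousOn_sol h.zero h.strictAntiOn (fun t ht => h.lt_sol ht)
      h.tendsto_sol
  have hg : ContinuousOn (fun s => G (B s)) (Ici 0) :=
    hGc.comp h.continuousOn_sol fun t ht => h.mem ht
  have hl := h.tendsto_excess hf hfc hbot hlim x
  have hI : X.bYNorm c = ((1 / c : ℝ) : EReal) * eintegral (volume.restrict (Ioo c 0))
        (fun u => ((f u : EReal) - X.realF c) / ((ρ u : EReal) - 1)) := by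
    unfold AffineProcess.bYNorm
    rw [eintegral_congr_restrict measurableSet_Ioo]
    intro u hu
    rw [hF u ⟨hu.1, hu.2.le⟩, hR u ⟨hu.1, hu.2.le⟩]
  have hG0 : G (B 0) = 0 := by simp [hG, h.zero, hf0, h.map_zero]
  have hNormal : ((x : ℝ) : EReal) ≤ X.bYNorm c → IsNormal (fun T => X.yield T x) := by
    intro hle
    rw [hI, zero_le_limit_iff hc] at hle
    exact (hv.isNormal hg x hl hle).congr hyield
  have hInv : X.bInv ≤ ((x : ℝ) : EReal) → IsInverse (fun T => X.yield T x) := by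
    intro hle
    unfold AffineProcess.bInv at hle
    split_ifs at hle with hneg
    · have := (bInv_cases hc hf hf0 hF hρconv h.map_zero hR
        (fun u hu => h.rho_le ⟨hu.1.le, hu.2⟩) hx hneg).1 hle
      refine (hv.isInverse hg x fun t ht => ?_).congr hyield
      rw [hG0]
      have hmem : B t ∈ B '' Ioi 0 := mem_image_of_mem _ ht
      rw [h.image_Ioi] at hmem
      exact this _ hmem
    · exact absurd hle (by simp)
  have hHump : X.bYNorm c < ((x : ℝ) : EReal) → ((x : ℝ) : EReal) < X.bInv →
        IsHumped (fun T => X.yield T x) := by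
    intro h1 h2
    rw [← not_le, hI, zero_le_limit_iff hc, not_le] at h1
    have hex : ∃ u ∈ Ioo c 0, f u + x * ρ u < 0 := by
      unfold AffineProcess.bInv at h2
      split_ifs at h2 with hneg
      · exact (bInv_cases hc hf hf0 hF hρconv h.map_zero hR
          (fun u hu => h.rho_le ⟨hu.1.le, hu.2⟩) hx hneg).2 h2
      · exact hdrift (not_lt.1 hneg)
    obtain ⟨u, hu, hu0⟩ := hex
    rw [← h.image_Ioi] at hu
    obtain ⟨t, ht, rfl⟩ := hu
    exact (hv.isHumped hg x hl h1 ⟨t, ht, by rw [hG0]; exact hu0⟩).congr hyield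
  refine ⟨?_, hNormal, hHump, hInv⟩
  by_cases h1 : ((x : ℝ) : EReal) ≤ X.bYNorm c
  · exact Or.inl (hNormal h1)
  · by_cases h2 : ((x : ℝ) : EReal) < X.bInv
    · exact Or.inr (Or.inr (hHump (not_le.1 h1) h2))
    · exact Or.inr (Or.inl (hInv (not_lt.1 h2)))

end Shapes

/-! ### Càdlàg paths and their integrals -/

section Paths

/-- Right continuity and the left limit bound the path near each time; compactness does the rest. -/
lemma exists_bound_of_cadlag {p : ℝ≥0 → ℝ}
    (hp : ∀ t : ℝ≥0, ContinuousWithinAt p (Ici t) t ∧ ∃ l : ℝ, Tendsto p (𝓝[<] t) (𝓝 l))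
    (T : ℝ≥0) : ∃ C, ∀ s ≤ T, |p s| ≤ C := by
  have : ∃ C, ∀ s ∈ Icc 0 T, |p s| ≤ C := by
    refine isCompact_Icc.induction_on (p := fun S => ∃ C, ∀ s ∈ S, |p s| ≤ C) ⟨0, by simp⟩ ?_ ?_ ?_
    · rintro S S' hS ⟨C, hC⟩
      exact ⟨C, fun s hs => hC s (hS hs)⟩
    · rintro S S' ⟨C, hC⟩ ⟨C', hC'⟩
      refine ⟨max C C', fun s hs => ?_⟩
      rcases hs with hs | hs
      · exact (hC s hs).trans (le_max_left _ _)
      · exact (hC' s hs).trans (le_max_right _ _)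
    · intro t _
      obtain ⟨h1, l, h2⟩ := hp t
      have e1 : ∀ᶠ s in 𝓝[≥] t, |p s| ≤ |p t| + |l| + 1 := by
        filter_upwards [h1.abs.eventually_lt_const (lt_add_one |p t|)] with s hs
        have := abs_nonneg l
        linarith
      have e2 : ∀ᶠ s in 𝓝[<] t, |p s| ≤ |p t| + |l| + 1 := by
        filter_upwards [h2.abs.eventually_lt_const (lt_add_one |l|)] with s hs
        have := abs_nonneg (p t)
        linarith
      have e3 : ∀ᶠ s in 𝓝 t, |p s| ≤ |p t| + |l| + 1 := by
        rw [← nhdsLT_sup_nhdsGE]; exact eventually_sup.2 ⟨e2, e1⟩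
      exact ⟨_, mem_nhdsWithin_of_mem_nhds e3, _, fun s hs => hs⟩
  obtain ⟨C, hC⟩ := this
  exact ⟨C, fun s hs => hC s ⟨zero_le, hs⟩⟩

/-- Right Riemann sums of a càdlàg path converge to its integral. -/
lemma tendsto_riemann_sum_of_cadlag {p : ℝ≥0 → ℝ}
    (hp : ∀ t : ℝ≥0, ContinuousWithinAt p (Ici t) t ∧ ∃ l : ℝ, Tendsto p (𝓝[<] t) (𝓝 l))
    {s T : ℝ} (hs : 0 ≤ s) (hsT : s ≤ T) (hT : 0 < T) :
    Tendsto (fun n : ℕ => ∑ k ∈ Finset.range ⌊s / (T / n)⌋₊,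
      (T / n) * p (((k + 1 : ℕ) : ℝ≥0) * (T / n).toNNReal)) atTop
      (𝓝 (∫ u in (0 : ℝ)..s, p u.toNNReal)) := by
  obtain ⟨C, hC⟩ := exists_bound_of_cadlag hp T.toNNReal
  have hC0 : 0 ≤ C := (abs_nonneg _).trans (hC 0 zero_le)
  -- Summands beyond `s` are set to zero, so that the sums and the integral over `[0, s]` become
  -- ones over the whole grid of `[0, T]`.
  let gs : ℕ → ℕ → ℝ := fun n k =>
    if k < ⌊s / (T / n)⌋₊ then p (((k + 1 : ℕ) : ℝ≥0) * (T / n).toNNReal) else 0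
  let g : ℝ → ℝ := fun u => if u < s then p u.toNNReal else 0
  have hpos : ∀ n : ℕ, 0 < n → 0 < T / n := fun n hn => by positivity
  have hbd : ∀ᶠ n in atTop, ∀ k < n, ‖gs n k‖ ≤ C := by
    filter_upwards [eventually_gt_atTop 0] with n hn k hk
    simp only [gs]
    split_ifs
    · rw [Real.norm_eq_abs]
      apply hC
      rw [← NNReal.coe_le_coe, NNReal.coe_mul, Real.coe_toNNReal _ (hpos n hn).le,
        Real.coe_toNNReal _ hT.le, NNReal.coe_natCast]
      have : ((k + 1 : ℕ) : ℝ) ≤ n := by exact_mod_cast hk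
      calc ((k + 1 : ℕ) : ℝ) * (T / n) ≤ n * (T / n) := by
            have := (hpos n hn).le
            gcongr
        _ = T := by field_simp
    · simpa using hC0
  have hlim : ∀ u ∈ Ioo 0 T, Tendsto (fun n : ℕ => gs n ⌊u / (T / n)⌋₊) atTop (𝓝 (g u)) := by
    intro u hu
    rcases lt_or_ge u s with h | h
    · simp only [g, if_pos h]
      have e1 : ∀ᶠ n : ℕ in atTop, ⌊u / (T / n)⌋₊ < ⌊s / (T / n)⌋₊ := by
        have := tendsto_const_div_atTop_nhds_zero_nat T
        filter_upwards [this.eventually_lt_const (sub_pos.2 h), eventually_gt_atTop 0] with n hn hn0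
        rw [← Nat.add_one_le_iff]
        rw [← Nat.floor_add_one (div_nonneg hu.1.le (hpos n hn0).le)]
        refine Nat.floor_mono ?_
        rw [le_div_iff₀ (hpos n hn0), add_mul, div_mul_cancel₀ _ (hpos n hn0).ne']
        linarith
      -- The right end point of the cell containing `u` approaches `u` from the right, where the
      -- path is continuous.
      have e2 : Tendsto (fun n : ℕ => ((⌊u / (T / n)⌋₊ + 1 : ℕ) : ℝ≥0) * (T / n).toNNReal) atTop
          (𝓝[≥] u.toNNReal) := by
        rw [tendsto_nhdsWithin_iff]
        constructor
        · have h1 := (tendsto_floor_mul hT hu.1.le).add (tendsto_const_div_atTop_nhds_zero_nat T)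
          rw [add_zero] at h1
          have h2 := (continuous_real_toNNReal.tendsto _).comp h1
          refine h2.congr' ?_
          filter_upwards [eventually_gt_atTop 0] with n hn0
          rw [← NNReal.coe_inj]
          have := (hpos n hn0).le
          simp only [Function.comp_apply]
          rw [Real.coe_toNNReal _ (by positivity), NNReal.coe_mul, Real.coe_toNNReal _ this]
          push_cast
          ring
        · filter_upwards [eventually_gt_atTop 0] with n hn0
          rw [mem_Ici, ← NNReal.coe_le_coe, NNReal.coe_mul, Real.coe_toNNReal _ (hpos n hn0).le,
            Real.coe_toNNReal _ hu.1.le]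
          have := Nat.lt_floor_add_one (u / (T / n))
          rw [div_lt_iff₀ (hpos n hn0)] at this
          push_cast
          exact this.le
      have e3 := ((hp u.toNNReal).1.tendsto).comp e2
      refine e3.congr' ?_
      filter_upwards [e1] with n hn
      simp only [gs, if_pos hn, Function.comp_apply]
    · simp only [g, if_neg (not_lt.2 h)]
      refine tendsto_const_nhds.congr' ?_
      filter_upwards [eventually_gt_atTop 0] with n hn0
      have : ¬ ⌊u / (T / n)⌋₊ < ⌊s / (T / n)⌋₊ := by
        rw [not_lt]
        refine Nat.floor_mono ?_
        have := (hpos n hn0).le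
        gcongr
      simp only [gs, if_neg this]
  obtain ⟨hgi, hsum⟩ := tendsto_step_sum gs g hT hbd hlim
  have hg1 : ∫ u in (0 : ℝ)..T, g u = ∫ u in (0 : ℝ)..s, p u.toNNReal := by
    rw [← intervalIntegral.integral_add_adjacent_intervals (b := s)
      (hgi.mono_set (by rw [uIcc_of_le hs, uIcc_of_le hT.le]; exact Icc_subset_Icc_right hsT))
      (hgi.mono_set (by rw [uIcc_of_le hsT, uIcc_of_le hT.le]; exact Icc_subset_Icc_left hs))]
    have h1 : ∫ u in s..T, g u = 0 := by
      rw [intervalIntegral.integral_congr (g := fun _ => (0 : ℝ)), intervalIntegral.integral_zero]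
      intro u hu
      rw [uIcc_of_le hsT] at hu
      simp only [g, if_neg (not_lt.2 hu.1)]
    rw [h1, add_zero]
    refine intervalIntegral.integral_congr_ae ?_
    filter_upwards [Measure.ae_ne volume s] with u hu hm
    rw [uIoc_of_le hs] at hm
    simp only [g, if_pos (lt_of_le_of_ne hm.2 hu)]
  rw [← hg1]
  refine hsum.congr' ?_
  filter_upwards [eventually_gt_atTop 0] with n hn0
  have hle : ⌊s / (T / n)⌋₊ ≤ n := by
    have : s / (T / n) ≤ n := by
      rw [div_le_iff₀ (hpos n hn0)]
      calc s ≤ T := hsT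
        _ = n * (T / n) := by field_simp
    exact_mod_cast (Nat.floor_le (div_nonneg hs (hpos n hn0).le)).trans this
  rw [← Finset.sum_subset (Finset.range_mono hle)]
  · refine Finset.sum_congr rfl fun k hk => ?_
    simp only [gs, if_pos (Finset.mem_range.1 hk), smul_eq_mul]
  · intro k _ hk
    simp only [gs, if_neg (fun h => hk (Finset.mem_range.2 h)), smul_zero]

end Paths

/-! ### The Markov property and discretely monitored integrals -/

namespace StateSpace

variable {D : StateSpace}

lemma zero_mem_carrier : (0 : ℝ) ∈ D.carrier := by cases D <;> simp [carrier]

lemma add_mem_carrier {x y : ℝ} (hx : x ∈ D.carrier) (hy : y ∈ D.carrier) : x + y ∈ D.carrier := by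
  cases D
  · exact add_nonneg (mem_Ici.1 hx) (mem_Ici.1 hy)
  · trivial

lemma mul_mem_carrier {a x : ℝ} (ha : 0 ≤ a) (hx : x ∈ D.carrier) : a * x ∈ D.carrier := by
  cases D
  · exact mul_nonneg ha (mem_Ici.1 hx)
  · trivial

lemma sum_mem_carrier {n : ℕ} {x : ℕ → ℝ} (hx : ∀ k, x k ∈ D.carrier) :
    ∑ k ∈ Finset.range n, x k ∈ D.carrier := by
  induction n with
  | zero => simpa using zero_mem_carrier
  | succ n ih => rw [Finset.sum_range_succ]; exact add_mem_carrier ih (hx n)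

lemma norm_exp_le_one {w : ℂ} (hw : w ∈ D.frequencies) {x : ℝ} (hx : x ∈ D.carrier) :
    ‖Complex.exp (w * x)‖ ≤ 1 := by
  rw [Complex.norm_exp, Real.exp_le_one_iff, Complex.re_mul_ofReal]
  cases D
  · exact mul_nonpos_of_nonpos_of_nonneg hw hx
  · rw [show w.re = 0 from hw, zero_mul]

end StateSpace

namespace AffineProcess

variable {D : StateSpace} {Ω : Type*} [MeasurableSpace Ω] (X : AffineProcess D Ω)

instance : IsMarkovKernel X.P := X.conservative

lemma past_le (s : ℝ≥0) : past X.r s ≤ ‹MeasurableSpace Ω› :=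
  iSup_le fun u => (X.measurable_r u).comap_le

lemma measurable_past {s u : ℝ≥0} (hu : u ≤ s) : Measurable[past X.r s] (X.r u) :=
  Measurable.of_comap_le (le_iSup (fun u : Iic s => MeasurableSpace.comap (X.r u) inferInstance)
    ⟨u, hu⟩)

lemma measurable_coe_r (t : ℝ≥0) : Measurable fun ω => (X.r t ω : ℝ) :=
  measurable_subtype_coe.comp (X.measurable_r t)

/-- The Markov property, integrated against a bounded function of the past. -/
lemma integral_mul_eq (x : D.carrier) (s t : ℝ≥0) {Z : Ω → ℂ} (hZ : Measurable[past X.r s] Z)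
    {C : ℝ} (hZb : ∀ ω, ‖Z ω‖ ≤ C) {f : D.carrier → ℂ} (hf : Measurable f) {C' : ℝ}
    (hfb : ∀ y, ‖f y‖ ≤ C') :
    ∫ ω, Z ω * f (X.r (s + t) ω) ∂(X.P x)
      = ∫ ω, Z ω * ∫ ω', f (X.r t ω') ∂(X.P (X.r s ω)) ∂(X.P x) := by
  have hZm : Measurable Z := hZ.mono (X.past_le s) le_rfl
  have hfm : Measurable fun ω => f (X.r (s + t) ω) := hf.comp (X.measurable_r _)
  have hg : Integrable (fun ω => f (X.r (s + t) ω)) (X.P x) :=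
    Integrable.of_bound hfm.aestronglyMeasurable C' (Eventually.of_forall fun ω => hfb _)
  have hfg : Integrable (fun ω => Z ω * f (X.r (s + t) ω)) (X.P x) :=
    Integrable.of_bound (hZm.mul hfm).aestronglyMeasurable (C * C')
      (Eventually.of_forall fun ω => by
        rw [norm_mul]
        exact mul_le_mul (hZb ω) (hfb _) (norm_nonneg _) ((norm_nonneg _).trans (hZb ω)))
  have hZs : StronglyMeasurable[past X.r s] Z := hZ.stronglyMeasurable
  have h1 := condExp_bilin_of_stronglyMeasurable_left (m := past X.r s) (μ := X.P x)
    (ContinuousLinearMap.mul ℝ ℂ) (f := Z) (g := fun ω => f (X.r (s + t) ω))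
    hZs hfg hg
  rw [← integral_condExp (X.past_le s)]
  refine integral_congr_ae ?_
  filter_upwards [h1, X.markov x s t f hf ⟨C', hfb⟩] with ω h2 h3
  have h2' := h2
  simp only [ContinuousLinearMap.mul_apply'] at h2'
  rw [h2', h3]

/-- The one-step recursion for the exponent of a discretely monitored integral. -/
lemma integral_exp_sum {V : Set ℂ} (hV : V ⊆ D.frequencies) {φ ψ : ℂ → ℂ} {δ : ℝ≥0} {w : ℂ}
    (hw : w ∈ D.frequencies)
    (haff : ∀ v ∈ V, ∀ y : D.carrier, ∫ ω, Complex.exp (v * ((X.r δ ω : ℝ) : ℂ)) ∂(X.P y)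
      = Complex.exp (φ v + ((y : ℝ) : ℂ) * ψ v))
    (hψ : ∀ v ∈ V, ψ v ∈ V) (hVw : ∀ v ∈ V, v + w ∈ V) (x : D.carrier) (j : ℕ) :
    ∀ v ∈ V, ∫ ω, Complex.exp (w * ((∑ k ∈ Finset.range j,
          (X.r (((k + 1 : ℕ) : ℝ≥0) * δ) ω : ℝ) : ℝ) : ℂ)
        + v * ((X.r ((j : ℝ≥0) * δ) ω : ℝ) : ℂ)) ∂(X.P x)
      = Complex.exp (∑ k ∈ Finset.range j, φ ((fun v => ψ (v + w))^[k] v + w)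
        + ((x : ℝ) : ℂ) * (fun v => ψ (v + w))^[j] v) := by
  induction j with
  | zero =>
    intro v hv
    simp only [Finset.range_zero, Finset.sum_empty, Complex.ofReal_zero, mul_zero, zero_add,
      Nat.cast_zero, zero_mul, Function.iterate_zero, id]
    have : (fun ω => Complex.exp (v * ((X.r 0 ω : ℝ) : ℂ))) =ᵐ[X.P x]
        fun _ => Complex.exp (((x : ℝ) : ℂ) * v) := by
      filter_upwards [X.start x] with ω hω
      rw [hω, mul_comm]
    rw [integral_congr_ae this]
    simp
  -- Conditioning at time `j δ` merges the last summand with the terminal frequency `v` into `v +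
  -- w`; the affine formula replaces it by `ψ (v + w)`. The induction therefore runs over all
  -- terminal frequencies in `V`.
  | succ j ih =>
    intro v hv
    have hvw := hVw v hv
    set Z : Ω → ℂ := fun ω => Complex.exp (w * ((∑ k ∈ Finset.range j,
          (X.r (((k + 1 : ℕ) : ℝ≥0) * δ) ω : ℝ) : ℝ) : ℂ)) with hZ
    have hZm : Measurable[past X.r ((j : ℝ≥0) * δ)] Z := by
      have h1 : Measurable[past X.r ((j : ℝ≥0) * δ)] fun ω => (∑ k ∈ Finset.range j,
          (X.r (((k + 1 : ℕ) : ℝ≥0) * δ) ω : ℝ) : ℝ) := by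
        refine Finset.measurable_sum _ fun k hk => measurable_subtype_coe.comp
          (X.measurable_past ?_)
        have : k + 1 ≤ j := Finset.mem_range.1 hk
        gcongr
      have h2 : Measurable fun y : ℝ => Complex.exp (w * (y : ℂ)) := by fun_prop
      exact h2.comp h1
    have hZb : ∀ ω, ‖Z ω‖ ≤ 1 := fun ω =>
      StateSpace.norm_exp_le_one hw (StateSpace.sum_mem_carrier fun k => (X.r _ ω).2)
    have h1 := X.integral_mul_eq x ((j : ℝ≥0) * δ) δ hZm hZb
      (f := fun y => Complex.exp ((v + w) * ((y : ℝ) : ℂ))) (by fun_prop) (C' := 1)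
      (fun y => StateSpace.norm_exp_le_one (hV hvw) y.2)
    have e1 : ∀ ω, Complex.exp (w * ((∑ k ∈ Finset.range (j + 1),
          (X.r (((k + 1 : ℕ) : ℝ≥0) * δ) ω : ℝ) : ℝ) : ℂ)
        + v * ((X.r (((j + 1 : ℕ) : ℝ≥0) * δ) ω : ℝ) : ℂ))
        = Z ω * Complex.exp ((v + w) * ((X.r ((j : ℝ≥0) * δ + δ) ω : ℝ) : ℂ)) := by
      intro ω
      have : (((j + 1 : ℕ) : ℝ≥0) * δ) = (j : ℝ≥0) * δ + δ := by push_cast; ring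
      rw [Finset.sum_range_succ, this, hZ]
      simp only
      rw [← Complex.exp_add]
      congr 1
      push_cast; ring
    simp_rw [e1]
    rw [h1]
    have e2 : ∀ ω, Z ω * ∫ ω', Complex.exp ((v + w) * ((X.r δ ω' : ℝ) : ℂ)) ∂(X.P (X.r (j * δ) ω))
        = Complex.exp (φ (v + w)) * Complex.exp (w * ((∑ k ∈ Finset.range j,
          (X.r (((k + 1 : ℕ) : ℝ≥0) * δ) ω : ℝ) : ℝ) : ℂ)
          + ψ (v + w) * ((X.r ((j : ℝ≥0) * δ) ω : ℝ) : ℂ)) := by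
      intro ω
      rw [haff _ hvw, hZ]
      simp only
      rw [← Complex.exp_add, ← Complex.exp_add]
      congr 1
      ring
    simp_rw [e2]
    rw [integral_const_mul, ih _ (hψ _ hvw), ← Complex.exp_add, Finset.sum_range_succ']
    simp only [Function.iterate_succ_apply, Function.iterate_zero, id]
    congr 1
    ring

lemma ae_tendsto_riemann_sum (x : D.carrier) {s T : ℝ} (hs : 0 ≤ s) (hsT : s ≤ T) (hT : 0 < T) :
    ∀ᵐ ω ∂(X.P x), Tendsto (fun n : ℕ => (T / n) * ∑ k ∈ Finset.range ⌊s / (T / n)⌋₊,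
      (X.r (((k + 1 : ℕ) : ℝ≥0) * (T / n).toNNReal) ω : ℝ)) atTop
      (𝓝 (∫ u in (0 : ℝ)..s, (X.r u.toNNReal ω : ℝ))) := by
  filter_upwards [X.cadlag x] with ω hω
  have := tendsto_riemann_sum_of_cadlag hω hs hsT hT
  simpa only [Finset.mul_sum] using this

/-- The integral is an almost sure limit of measurable Riemann sums. The horizon `s + 1` only keeps
the mesh positive when `s = 0`. -/
lemma aemeasurable_integral (x : D.carrier) {s : ℝ} (hs : 0 ≤ s) :
    AEMeasurable (fun ω => ∫ u in (0 : ℝ)..s, (X.r u.toNNReal ω : ℝ)) (X.P x) := by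
  refine aemeasurable_of_tendsto_metrizable_ae atTop (fun n => ?_)
    (X.ae_tendsto_riemann_sum x hs (le_add_of_nonneg_right zero_le_one) (T := s + 1)
      (by linarith))
  exact (Measurable.const_mul (Finset.measurable_sum _ fun k _ => X.measurable_coe_r _)
      _).aemeasurable

/-- The transform of the integral is the limit of the transforms of its Riemann sums. -/
lemma tendsto_integral_exp_riemann (x : D.carrier) {w : ℂ} (hw : w ∈ D.frequencies)
    {s T : ℝ} (hs : 0 ≤ s) (hsT : s ≤ T) (hT : 0 < T) :
    Tendsto (fun n : ℕ => ∫ ω, Complex.exp (w * (T / n : ℝ) * ((∑ k ∈ Finset.range ⌊s / (T / n)⌋₊,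
      (X.r (((k + 1 : ℕ) : ℝ≥0) * (T / n).toNNReal) ω : ℝ) : ℝ) : ℂ)) ∂(X.P x)) atTop
      (𝓝 (∫ ω, Complex.exp (w * ((∫ u in (0 : ℝ)..s, (X.r u.toNNReal ω : ℝ) : ℝ) : ℂ))
        ∂(X.P x))) := by
  refine tendsto_integral_of_dominated_convergence (fun _ => 1) (fun n => ?_)
    (integrable_const _) (fun n => Eventually.of_forall fun ω => ?_) ?_
  · have h1 : Measurable fun ω => (∑ k ∈ Finset.range ⌊s / (T / n)⌋₊,
      (X.r (((k + 1 : ℕ) : ℝ≥0) * (T / n).toNNReal) ω : ℝ) : ℝ) :=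
      Finset.measurable_sum _ fun k _ => X.measurable_coe_r _
    have h2 : Measurable fun y : ℝ => Complex.exp (w * (T / n : ℝ) * (y : ℂ)) := by fun_prop
    exact (h2.comp h1).aestronglyMeasurable
  · rw [mul_assoc, ← Complex.ofReal_mul]
    exact StateSpace.norm_exp_le_one hw (StateSpace.mul_mem_carrier (by positivity)
      (StateSpace.sum_mem_carrier fun k => (X.r _ ω).2))
  · filter_upwards [X.ae_tendsto_riemann_sum x hs hsT hT] with ω hω
    have h2 : Continuous fun y : ℝ => Complex.exp (w * (y : ℂ)) := by fun_prop
    refine ((h2.tendsto _).comp hω).congr fun n => ?_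
    simp only [Function.comp_apply]
    rw [Complex.ofReal_mul, mul_assoc]

end AffineProcess

/-! ### Exponentially positive functions -/

section ExpPositive

/-- `G` is nonnegative on exponential sums that are nonnegative and vanish at the origin
(as are limits of `(𝔼 exp (u Y) - 1) / t`). -/
def IsExpPositive (G : ℝ → ℝ) : Prop :=
  ∀ (n : ℕ) (a u : Fin n → ℝ), (∀ i, u i ≤ 0) → ∑ i, a i = 0 →
    (∀ y : ℝ, 0 ≤ ∑ i, a i * Real.exp (u i * y)) → 0 ≤ ∑ i, a i * G (u i)

lemma exp_convex_combination (a b s t : ℝ) (hs : 0 ≤ s) (ht : 0 ≤ t) (hst : s + t = 1) :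
    Real.exp (s * a + t * b) ≤ s * Real.exp a + t * Real.exp b := by
  simpa using convexOn_exp.2 (mem_univ a) (mem_univ b) hs ht hst

/-- The symmetric second difference. -/
def secondDiff (G : ℝ → ℝ) (d u : ℝ) : ℝ := G (u + d) - 2 * G u + G (u - d)

/-- Doubling the step carries vanishing second differences from small steps to all steps. -/
lemma secondDiff_two_mul (G : ℝ → ℝ) (d u : ℝ) :
    secondDiff G (2 * d) u = secondDiff G d (u + d) + 2 * secondDiff G d u
        + secondDiff G d (u - d) := by
  simp only [secondDiff]
  rw [show u + d + d = u + 2 * d by ring, show u + d - d = u by ring, show u - d + d = u by ring,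
    show u - d - d = u - 2 * d by ring]
  ring

namespace IsExpPositive

variable {G : ℝ → ℝ} (h : IsExpPositive G)
include h

lemma convexOn : ConvexOn ℝ (Iic 0) G := by
  refine ⟨convex_Iic 0, fun p hp q hq s t hs ht hst => ?_⟩
  have hp' : p ≤ 0 := hp
  have hq' : q ≤ 0 := hq
  have h1 := h 3 ![s, t, -1] ![p, q, s * p + t * q] ?_ ?_ ?_
  · simp only [Fin.sum_univ_three, Matrix.cons_val] at h1
    simp only [smul_eq_mul]
    linarith
  · intro i
    fin_cases i
    · exact hp'
    · exact hq'
    · simp only [Fin.reduceFinMk, Matrix.cons_val]; nlinarith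
  · simp only [Fin.sum_univ_three, Matrix.cons_val]
    linarith
  · intro y
    simp only [Fin.sum_univ_three, Matrix.cons_val]
    have := exp_convex_combination (p * y) (q * y) s t hs ht hst
    rw [show (s * p + t * q) * y = s * (p * y) + t * (q * y) by ring]
    linarith

lemma secondDiff_nonneg {d u : ℝ} (hd : 0 ≤ d) (hu : u + d ≤ 0) : 0 ≤ secondDiff G d u := by
  have h1 := h.convexOn.2 (show u + d ∈ Iic 0 from hu) (show u - d ∈ Iic 0 by
    simp only [mem_Iic]; linarith) (show (0 : ℝ) ≤ 1 / 2 by norm_num)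
    (show (0 : ℝ) ≤ 1 / 2 by norm_num) (by norm_num)
  simp only [smul_eq_mul] at h1
  rw [show 1 / 2 * (u + d) + 1 / 2 * (u - d) = u by ring] at h1
  simp only [secondDiff]
  linarith

/-- Convexity of `exp` gives `exp (u y) ≤ α exp (u₀ y) + β exp (b y)` for every value of the free
parameter `A`. Multiplied by `exp (d y) - 2 + exp (-d y) ≥ 0` this is a nonnegative sum of nine
exponentials, to which positivity of `G` applies. -/
lemma secondDiff_le {d u₀ b θ : ℝ} (hd : 0 ≤ d) (h0 : u₀ + d ≤ 0) (hb : b + d ≤ 0)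
    (hθ0 : 0 ≤ θ) (hθ1 : θ ≤ 1) (A : ℝ) :
    secondDiff G d ((1 - θ) * u₀ + θ * b) ≤ (1 - θ) * Real.exp (θ * A) * secondDiff G d u₀
      + θ * Real.exp (-((1 - θ) * A)) * secondDiff G d b := by
  set u := (1 - θ) * u₀ + θ * b with hu
  set α := (1 - θ) * Real.exp (θ * A) with hα
  set β := θ * Real.exp (-((1 - θ) * A)) with hβ
  have hu0 : u + d ≤ 0 := by
    have : u + d = (1 - θ) * (u₀ + d) + θ * (b + d) := by rw [hu]; ring
    rw [this]; nlinarith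
  have h1 := h 9 ![α, -2 * α, α, β, -2 * β, β, -1, 2, -1]
    ![u₀ + d, u₀, u₀ - d, b + d, b, b - d, u + d, u, u - d] ?_ ?_ ?_
  · simp only [Fin.sum_univ_succ, Fin.sum_univ_zero, Matrix.cons_val_zero,
      Matrix.cons_val_succ] at h1
    simp only [secondDiff]
    linarith
  · intro i
    fin_cases i <;> simp only [Fin.reduceFinMk, Fin.zero_eta, Fin.mk_one, Matrix.cons_val] <;>
        linarith
  · simp only [Fin.sum_univ_succ, Fin.sum_univ_zero, Matrix.cons_val_zero, Matrix.cons_val_succ]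
    ring
  · intro y
    simp only [Fin.sum_univ_succ, Fin.sum_univ_zero, Matrix.cons_val_zero, Matrix.cons_val_succ]
    have key : Real.exp (u * y) ≤ α * Real.exp (u₀ * y) + β * Real.exp (b * y) := by
      have := exp_convex_combination (u₀ * y + θ * A) (b * y - (1 - θ) * A) (1 - θ) θ
        (by linarith) hθ0 (by ring)
      rw [show (1 - θ) * (u₀ * y + θ * A) + θ * (b * y - (1 - θ) * A) = u * y by rw [hu]; ring,
        Real.exp_add, sub_eq_add_neg (b * y), Real.exp_add] at this
      rw [hα, hβ]
      linarith
    have hs : ∀ v : ℝ, Real.exp ((v + d) * y) = Real.exp (v * y) * Real.exp (d * y) ∧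
        Real.exp ((v - d) * y) = Real.exp (v * y) * Real.exp (-(d * y)) := fun v => by
      constructor <;> rw [← Real.exp_add] <;> congr 1 <;> ring
    rw [(hs u₀).1, (hs u₀).2, (hs b).1, (hs b).2, (hs u).1, (hs u).2]
    have hW : 0 ≤ Real.exp (d * y) - 2 + Real.exp (-(d * y)) := by
      have h2 : Real.exp (d * y) * Real.exp (-(d * y)) = 1 := by
        rw [← Real.exp_add, add_neg_cancel, Real.exp_zero]
      nlinarith [sq_nonneg (Real.exp (d * y) - Real.exp (-(d * y))), Real.exp_pos (d * y),
        Real.exp_pos (-(d * y)), Real.add_one_le_exp (d * y), Real.add_one_le_exp (-(d * y))]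
    have := mul_nonneg (sub_nonneg.2 key) hW
    linarith

/-- When the term at `u₀` vanishes, the bound `secondDiff_le` retains only the factor `exp (-((1 -
θ) A))`, which tends to zero as `A → ∞`. In Lévy-Khintchine terms: one vanishing second difference
leaves neither jumps nor a Gaussian part. -/
lemma secondDiff_eq_zero {d u₀ u : ℝ} (hd : 0 ≤ d) (h0 : u₀ + d ≤ 0) (hu : u + d < 0)
    (hz : secondDiff G d u₀ = 0) : secondDiff G d u = 0 := by
  have main : ∀ b θ : ℝ, b + d ≤ 0 → 0 ≤ θ → θ < 1 → u = (1 - θ) * u₀ + θ * b →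
      secondDiff G d u = 0 := by
    intro b θ hb hθ0 hθ1 hub
    refine le_antisymm ?_ (h.secondDiff_nonneg hd hu.le)
    have h1 : Tendsto (fun A : ℝ => θ * Real.exp (-((1 - θ) * A)) * secondDiff G d b) atTop
        (𝓝 (θ * 0 * secondDiff G d b)) := by
      refine (Tendsto.const_mul _ (Real.tendsto_exp_neg_atTop_nhds_zero.comp ?_)).mul_const _
      exact tendsto_id.const_mul_atTop (by linarith)
    rw [mul_zero, zero_mul] at h1
    refine ge_of_tendsto' h1 fun A => ?_
    have := h.secondDiff_le hd h0 hb hθ0 hθ1.le A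
    rw [hz, mul_zero, zero_add] at this
    rw [hub]; exact this
  -- To the left of `u₀` the auxiliary point is the reflection of `u₀` in `u`. To the right it is
  -- `-d`, the largest admissible point; `u + d < 0` then makes `θ < 1`.
  rcases le_or_gt u u₀ with hle | hlt
  · exact main (2 * u - u₀) (1 / 2) (by linarith) (by norm_num) (by norm_num) (by ring)
  · have hpos : 0 < -d - u₀ := by linarith
    refine main (-d) ((u - u₀) / (-d - u₀)) (by linarith) (div_nonneg (by linarith) hpos.le) ?_ ?_
    · rw [div_lt_one hpos]; linarith
    · field_simp; ring

/-- Exponentially positive functions are strictly convex or linear. -/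
lemma strictConvexOn_or_linear (h0 : G 0 = 0) (hc : ContinuousOn G (Iic 0)) :
    StrictConvexOn ℝ (Iic 0) G ∨ ∃ k, ∀ u ≤ 0, G u = k * u := by
  by_cases hs : StrictConvexOn ℝ (Iic 0) G
  · exact Or.inl hs
  right
  have hconv := h.convexOn
  -- Failure of strict convexity means that the graph meets a chord at an interior point; by
  -- convexity `G` is then affine on all of `[x, y]`, so second differences at the midpoint vanish
  -- for small steps.
  obtain ⟨x, y, m, hy, hxm, hmy, hm⟩ : ∃ x y m : ℝ, y ≤ 0 ∧ x < m ∧ m < y ∧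
      (y - m) * G x + (m - x) * G y ≤ (y - x) * G m := by
    by_contra hcon
    push Not at hcon
    apply hs
    refine ⟨convex_Iic 0, fun x hx y hy hxy a b ha hb hab => ?_⟩
    simp only [smul_eq_mul]
    have hb' : b = 1 - a := by linarith
    rcases lt_or_gt_of_ne hxy with hlt | hlt
    · have := hcon x y (a * x + b * y) hy (by rw [hb']; nlinarith) (by rw [hb']; nlinarith)
      have e1 : y - (a * x + b * y) = a * (y - x) := by rw [hb']; ring
      have e2 : a * x + b * y - x = b * (y - x) := by rw [hb']; ring
      rw [e1, e2] at this
      have h3 : 0 < y - x := by linarith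
      nlinarith
    · have := hcon y x (a * x + b * y) hx (by rw [hb']; nlinarith) (by rw [hb']; nlinarith)
      have e1 : x - (a * x + b * y) = b * (x - y) := by rw [hb']; ring
      have e2 : a * x + b * y - y = a * (x - y) := by rw [hb']; ring
      rw [e1, e2] at this
      have h3 : 0 < x - y := by linarith
      nlinarith
  have hx : x ≤ 0 := by linarith
  have haff : ∀ p ∈ Icc x y, (y - x) * G p = (y - p) * G x + (p - x) * G y := by
    intro p hp
    refine le_antisymm (convexOn_between hconv hx hy hp.1 hp.2) ?_
    rcases le_or_gt p m with hpm | hpm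
    · have h1 := convexOn_between hconv (show p ∈ Iic 0 from hp.2.trans hy) hy hpm hmy.le
      have h2 : 0 < y - m := by linarith
      have h3 : 0 ≤ y - p := by linarith
      refine le_of_mul_le_mul_left ?_ h2
      nlinarith
    · have h1 := convexOn_between hconv hx (show p ∈ Iic 0 from hp.2.trans hy) hxm.le hpm.le
      have h2 : 0 < m - x := by linarith
      have h3 : 0 ≤ p - x := by linarith
      refine le_of_mul_le_mul_left ?_ h2
      nlinarith
  have hxy : 0 < y - x := by linarith
  have small : ∀ d, 0 ≤ d → d ≤ (y - x) / 2 → ∀ u, u + d < 0 → secondDiff G d u = 0 := by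
    intro d hd hd2 u hu
    refine h.secondDiff_eq_zero (u₀ := (x + y) / 2) hd (by linarith) hu ?_
    have e1 := haff ((x + y) / 2 + d) ⟨by linarith, by linarith⟩
    have e2 := haff ((x + y) / 2) ⟨by linarith, by linarith⟩
    have e3 := haff ((x + y) / 2 - d) ⟨by linarith, by linarith⟩
    have : (y - x) * secondDiff G d ((x + y) / 2) = 0 := by
      simp only [secondDiff]
      linear_combination e1 - 2 * e2 + e3
    exact (mul_eq_zero.1 this).resolve_left hxy.ne'
  have big : ∀ n : ℕ, ∀ d, 0 ≤ d → d ≤ 2 ^ n * ((y - x) / 2) → ∀ u, u + d < 0 →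
      secondDiff G d u = 0 := by
    intro n
    induction n with
    | zero => intro d hd hd2; exact small d hd (by simpa using hd2)
    | succ n ih =>
      intro d hd hd2 u hu
      have h1 := ih (d / 2) (by linarith) (by rw [pow_succ] at hd2; linarith)
      rw [show d = 2 * (d / 2) by ring, secondDiff_two_mul, h1 _ (by linarith), h1 _ (by linarith),
        h1 _ (by linarith)]
      ring
  have all : ∀ d, 0 ≤ d → ∀ u, u + d < 0 → secondDiff G d u = 0 := by
    intro d hd
    obtain ⟨n, hn⟩ := pow_unbounded_of_one_lt (d / ((y - x) / 2)) (one_lt_two (α := ℝ))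
    refine big n d hd ?_
    rw [div_lt_iff₀ (by linarith)] at hn
    exact hn.le
  have mid' : ∀ u < 0, ∀ v < 0, G ((u + v) / 2) = (G u + G v) / 2 := by
    intro u hu v hv
    rcases le_total u v with hle | hle
    · have := all ((v - u) / 2) (by linarith) ((u + v) / 2) (by linarith)
      simp only [secondDiff] at this
      rw [show (u + v) / 2 + (v - u) / 2 = v by ring, show (u + v) / 2 - (v - u) / 2 = u by ring]
        at this
      linarith
    · have := all ((u - v) / 2) (by linarith) ((u + v) / 2) (by linarith)
      simp only [secondDiff] at this
      rw [show (u + v) / 2 + (u - v) / 2 = u by ring, show (u + v) / 2 - (u - v) / 2 = v by ring]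
        at this
      linarith
  -- The second differences were controlled only for `u + d < 0`; continuity adds the end point `0`.
  have lim : ∀ u ≤ 0, Tendsto (fun ε : ℝ => G (u - ε)) (𝓝[>] 0) (𝓝 (G u)) := by
    intro u hu
    refine (hc u hu).tendsto.comp (tendsto_nhdsWithin_iff.2 ⟨?_, ?_⟩)
    · have : Tendsto (fun ε : ℝ => u - ε) (𝓝 0) (𝓝 (u - 0)) := tendsto_const_nhds.sub tendsto_id
      rw [sub_zero] at this
      exact this.mono_left nhdsWithin_le_nhds
    · filter_upwards [self_mem_nhdsWithin] with ε hε
      have : 0 < ε := hε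
      simp only [mem_Iic]; linarith
  refine ⟨_, linear_of_convexOn_of_midpoint hconv h0 fun u hu v hv => ?_⟩
  refine tendsto_nhds_unique (lim ((u + v) / 2) (by linarith)) ?_
  refine ((((lim u hu).add (lim v hv)).div_const 2)).congr' ?_
  filter_upwards [self_mem_nhdsWithin] with ε hε
  have hε : 0 < ε := hε
  rw [← mid' _ (by linarith) _ (by linarith)]
  congr 1; ring

end IsExpPositive

end ExpPositive

/-- Growth as `x → ∞` compares the slopes. On the half-line this is how facts about `R` or `ψ` are
extracted from facts about `F + x R` or `φ + x ψ`. -/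
lemma le_of_forall_affine_le {a b a' b' : ℝ} (h : ∀ x : ℝ, 0 ≤ x → a + x * b ≤ a' + x * b') :
    b ≤ b' := by
  by_contra hcon
  rw [not_le] at hcon
  have hd : 0 < b - b' := by linarith
  have h1 := h ((|a' - a| + 1) / (b - b')) (by positivity)
  have h2 : (|a' - a| + 1) / (b - b') * b - (|a' - a| + 1) / (b - b') * b' = |a' - a| + 1 := by
    field_simp
  have := le_abs_self (a' - a)
  linarith

/-! ### Half-line: properties of `F` and `R` -/

namespace AffineProcess

section HalfLine

variable {Ω : Type*} [MeasurableSpace Ω] (X : AffineProcess StateSpace.halfLine Ω)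

/-- A nonnegative real as a point of the half-line. -/
def pt (x : ℝ) (hx : 0 ≤ x) : StateSpace.halfLine.carrier := ⟨x, hx⟩

lemma r_nonneg (t : ℝ≥0) (ω : Ω) : 0 ≤ (X.r t ω : ℝ) := (X.r t ω).2

lemma ofReal_mem_frequencies {u : ℝ} (hu : u ≤ 0) :
    (u : ℂ) ∈ StateSpace.halfLine.frequencies := by
  simpa [StateSpace.frequencies] using hu

/-- The Laplace transform. -/
lemma laplace {u : ℝ} (hu : u ≤ 0) (t : ℝ≥0) (x : StateSpace.halfLine.carrier) :
    ∫ ω, Real.exp (u * X.r t ω) ∂(X.P x)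
      = Real.exp ((X.φ t u).re + x * (X.ψ t u).re) := by
  have h1 := X.affine x t u (ofReal_mem_frequencies hu)
  have h2 : ∫ ω, Complex.exp ((u : ℂ) * ((X.r t ω : ℝ) : ℂ)) ∂(X.P x)
      = ((∫ ω, Real.exp (u * X.r t ω) ∂(X.P x) : ℝ) : ℂ) := by
    rw [← integral_complex_ofReal]
    congr 1; ext ω; push_cast; rfl
  rw [h2] at h1
  have h3 := congrArg norm h1
  rw [Complex.norm_real, Complex.norm_exp, Real.norm_eq_abs,
    abs_of_nonneg (integral_nonneg fun ω => (Real.exp_pos _).le)] at h3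
  rw [h3]
  congr 1
  rw [Complex.add_re, Complex.re_ofReal_mul]

lemma laplace_complex {u : ℝ} (hu : u ≤ 0) (t : ℝ≥0) (x : StateSpace.halfLine.carrier) :
    ∫ ω, Complex.exp ((u : ℂ) * ((X.r t ω : ℝ) : ℂ)) ∂(X.P x)
      = Complex.exp (((X.φ t u).re : ℂ) + ((x : ℝ) : ℂ) * ((X.ψ t u).re : ℂ)) := by
  have h2 : ∫ ω, Complex.exp ((u : ℂ) * ((X.r t ω : ℝ) : ℂ)) ∂(X.P x)
      = ((∫ ω, Real.exp (u * X.r t ω) ∂(X.P x) : ℝ) : ℂ) := by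
    rw [← integral_complex_ofReal]
    congr 1; ext ω; push_cast; rfl
  rw [h2, X.laplace hu]
  push_cast; rfl

lemma integrable_exp {u : ℝ} (hu : u ≤ 0) (t : ℝ≥0) (x : StateSpace.halfLine.carrier) :
    Integrable (fun ω => Real.exp (u * X.r t ω)) (X.P x) := by
  refine Integrable.of_bound (C := 1) ?_ (Eventually.of_forall fun ω => ?_)
  · have := X.measurable_coe_r t
    exact (by fun_prop : Measurable fun ω => Real.exp (u * X.r t ω)).aestronglyMeasurable
  · rw [Real.norm_eq_abs, Real.abs_exp, Real.exp_le_one_iff]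
    exact mul_nonpos_of_nonpos_of_nonneg hu (X.r_nonneg t ω)

lemma integral_exp_le_one {u : ℝ} (hu : u ≤ 0) (t : ℝ≥0) (x : StateSpace.halfLine.carrier) :
    ∫ ω, Real.exp (u * X.r t ω) ∂(X.P x) ≤ 1 := by
  have h1 : ∫ ω, Real.exp (u * X.r t ω) ∂(X.P x) ≤ ∫ _, (1 : ℝ) ∂(X.P x) := by
    refine integral_mono (X.integrable_exp hu t x) (integrable_const _) fun ω => ?_
    exact Real.exp_le_one_iff.2 (mul_nonpos_of_nonpos_of_nonneg hu (X.r_nonneg t ω))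
  simpa using h1

lemma re_ψ_nonpos {u : ℝ} (hu : u ≤ 0) (t : ℝ≥0) : (X.ψ t u).re ≤ 0 := by
  refine le_of_forall_affine_le (a := (X.φ t u).re) (a' := 0) fun x hx => ?_
  have h1 := X.integral_exp_le_one hu t (pt x hx)
  rw [X.laplace hu, Real.exp_le_one_iff] at h1
  simpa [pt] using h1

lemma re_zero_eq {u : ℝ} (hu : u ≤ 0) : (X.φ 0 u).re = 0 ∧ (X.ψ 0 u).re = u := by
  have key : ∀ x, 0 ≤ x → (X.φ 0 u).re + x * (X.ψ 0 u).re = u * x := by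
    intro x hx
    have h1 := X.laplace hu 0 (pt x hx)
    have h2 : (fun ω => Real.exp (u * X.r 0 ω)) =ᵐ[X.P (pt x hx)] fun _ => Real.exp (u * x) := by
      filter_upwards [X.start (pt x hx)] with ω hω
      rw [hω]; rfl
    rw [integral_congr_ae h2] at h1
    simp only [integral_const, probReal_univ, smul_eq_mul, one_mul, NNReal.coe_zero] at h1
    exact (Real.exp_injective h1).symm
  have h0 := key 0 le_rfl
  have h1 := key 1 zero_le_one
  constructor <;> linarith

lemma hasDeriv_re_φ {u : ℝ} (hu : u ≤ 0) :
    HasDerivWithinAt (fun t : ℝ => (X.φ t u).re) (X.F u).re (Ici 0) 0 :=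
  (Complex.reCLM.hasFDerivAt.comp_hasDerivWithinAt (0 : ℝ)
    (X.hasDeriv_φ u (ofReal_mem_frequencies hu)))

lemma hasDeriv_re_ψ {u : ℝ} (hu : u ≤ 0) :
    HasDerivWithinAt (fun t : ℝ => (X.ψ t u).re) (X.R u).re (Ici 0) 0 :=
  (Complex.reCLM.hasFDerivAt.comp_hasDerivWithinAt (0 : ℝ)
    (X.hasDeriv_ψ u (ofReal_mem_frequencies hu)))

lemma tendsto_re_φ {u : ℝ} (hu : u ≤ 0) :
    Tendsto (fun t : ℝ => (X.φ t u).re / t) (𝓝[>] 0) (𝓝 (X.F u).re) := by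
  have h1 := (hasDerivWithinAt_iff_tendsto_slope' (s := Ioi (0 : ℝ)) (by simp)).1
    ((X.hasDeriv_re_φ hu).mono Ioi_subset_Ici_self)
  refine h1.congr fun t => ?_
  rw [slope_def_field, (X.re_zero_eq hu).1]
  simp

lemma tendsto_re_ψ {u : ℝ} (hu : u ≤ 0) :
    Tendsto (fun t : ℝ => ((X.ψ t u).re - u) / t) (𝓝[>] 0) (𝓝 (X.R u).re) := by
  have h1 := (hasDerivWithinAt_iff_tendsto_slope' (s := Ioi (0 : ℝ)) (by simp)).1
    ((X.hasDeriv_re_ψ hu).mono Ioi_subset_Ici_self)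
  refine h1.congr fun t => ?_
  rw [slope_def_field, (X.re_zero_eq hu).2]
  simp

/-- `F + x R` is the derivative at zero of the transform of `r_t - x`. -/
lemma tendsto_generator {u : ℝ} (hu : u ≤ 0) {x : ℝ} (hx : 0 ≤ x) :
    Tendsto (fun t : ℝ => (∫ ω, Real.exp (u * (X.r t.toNNReal ω - x)) ∂(X.P (pt x hx)) - 1) / t)
      (𝓝[>] 0) (𝓝 ((X.F u).re + x * (X.R u).re)) := by
  have h1 : HasDerivWithinAt (fun t : ℝ => Real.exp ((X.φ t u).re + x * ((X.ψ t u).re - u)))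
      (Real.exp ((X.φ 0 u).re + x * ((X.ψ 0 u).re - u)) * ((X.F u).re + x * (X.R u).re))
      (Ici 0) 0 := by
    have := ((X.hasDeriv_re_φ hu).add (((X.hasDeriv_re_ψ hu).sub_const u).const_mul x)).exp
    simpa using this
  rw [(X.re_zero_eq hu).1, (X.re_zero_eq hu).2] at h1
  simp only [sub_self, mul_zero, add_zero, Real.exp_zero, one_mul] at h1
  have h2 := (hasDerivWithinAt_iff_tendsto_slope' (s := Ioi (0 : ℝ)) (by simp)).1
    (h1.mono Ioi_subset_Ici_self)
  refine h2.congr' ?_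
  filter_upwards [self_mem_nhdsWithin] with t ht
  have ht0 : 0 ≤ t := le_of_lt ht
  have h0 : (0 : ℝ) = ((0 : ℝ≥0) : ℝ) := rfl
  rw [slope_def_field, sub_zero, (X.re_zero_eq hu).1, (X.re_zero_eq hu).2]
  have e : ∀ ω, Real.exp (u * (X.r t.toNNReal ω - x))
      = Real.exp (u * X.r t.toNNReal ω) * Real.exp (-(u * x)) := fun ω => by
    rw [← Real.exp_add]; congr 1; ring
  simp_rw [e]
  rw [integral_mul_const, X.laplace hu, ← Real.exp_add, Real.coe_toNNReal _ ht0]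
  simp only [sub_self, mul_zero, add_zero, Real.exp_zero, pt]
  congr 3; ring

/-- The sum is the limit of `E[∑ aᵢ exp (uᵢ (r_t - x))] / t`, the constants `1` cancelling because
`∑ aᵢ = 0`. As `r_t - x ≥ -x`, positivity of the exponential sum is needed on `[-x, ∞)` only. -/
lemma sum_generator_nonneg {x : ℝ} (hx : 0 ≤ x) {n : ℕ} {a u : Fin n → ℝ} (hu : ∀ i, u i ≤ 0)
    (ha : ∑ i, a i = 0) (hpos : ∀ y : ℝ, -x ≤ y → 0 ≤ ∑ i, a i * Real.exp (u i * y)) :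
    0 ≤ ∑ i, a i * ((X.F (u i)).re + x * (X.R (u i)).re) := by
  have h1 : Tendsto (fun t : ℝ => ∑ i, a i *
      ((∫ ω, Real.exp (u i * (X.r t.toNNReal ω - x)) ∂(X.P (pt x hx)) - 1) / t)) (𝓝[>] 0)
      (𝓝 (∑ i, a i * ((X.F (u i)).re + x * (X.R (u i)).re))) :=
    tendsto_finsetSum _ fun i _ => (X.tendsto_generator (hu i) hx).const_mul _
  refine ge_of_tendsto h1 ?_
  filter_upwards [self_mem_nhdsWithin] with t ht
  have ht0 : 0 < t := ht
  have e : ∑ i, a i * ((∫ ω, Real.exp (u i * (X.r t.toNNReal ω - x)) ∂(X.P (pt x hx)) - 1) / t)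
      = (∫ ω, ∑ i, a i * Real.exp (u i * (X.r t.toNNReal ω - x)) ∂(X.P (pt x hx))) / t := by
    rw [integral_finsetSum]
    · simp_rw [integral_const_mul, mul_div_assoc', mul_sub, mul_one]
      rw [← Finset.sum_div, Finset.sum_sub_distrib, ha, sub_zero]
    · intro i _
      refine Integrable.const_mul ?_ _
      have := (X.integrable_exp (hu i) t.toNNReal (pt x hx)).mul_const (Real.exp (-(u i * x)))
      refine this.congr (Eventually.of_forall fun ω => ?_)
      simp only
      rw [← Real.exp_add]; congr 1; ring
  rw [e]
  refine div_nonneg (integral_nonneg fun ω => ?_) ht0.le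
  exact hpos _ (by linarith [X.r_nonneg t.toNNReal ω])

lemma isExpPositive_F : IsExpPositive fun u => (X.F u).re := by
  intro n a u hu ha hpos
  simpa using X.sum_generator_nonneg le_rfl hu ha fun y _ => hpos y

lemma isExpPositive_R : IsExpPositive fun u => (X.R u).re := by
  intro n a u hu ha hpos
  refine le_of_forall_affine_le (a := 0) (a' := ∑ i, a i * (X.F (u i)).re) (b := 0) fun x hx => ?_
  have := X.sum_generator_nonneg hx hu ha fun y _ => hpos y
  simp only [mul_add, Finset.sum_add_distrib] at this
  have e : ∑ i, a i * (x * (X.R (u i)).re) = x * ∑ i, a i * (X.R (u i)).re := by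
    rw [Finset.mul_sum]; exact Finset.sum_congr rfl fun i _ => by ring
  rw [e] at this
  simpa using this

lemma F_zero : (X.F (0 : ℝ)).re = 0 ∧ (X.R (0 : ℝ)).re = 0 := by
  have key : ∀ x, 0 ≤ x → (X.F (0 : ℝ)).re + x * (X.R (0 : ℝ)).re = 0 := by
    intro x hx
    refine tendsto_nhds_unique (X.tendsto_generator le_rfl hx) ?_
    simp
  have h0 := key 0 le_rfl
  have h1 := key 1 zero_le_one
  constructor <;> linarith

/-- For `x = 0` only `y ≥ 0` matters, and there `exp (v y) - exp (u y)` is nonnegative. -/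
lemma monotoneOn_F : MonotoneOn (fun u : ℝ => (X.F u).re) (Iic 0) := by
  intro u hu v hv huv
  have h := X.sum_generator_nonneg le_rfl (a := ![1, -1]) (u := ![v, u]) ?_ ?_ ?_
  · simp only [zero_mul, add_zero, Fin.sum_univ_two, Matrix.cons_val] at h
    simp only
    linarith
  · intro i
    fin_cases i
    · exact hv
    · exact hu
  · simp
  · intro y hy
    simp only [Fin.sum_univ_two, Matrix.cons_val]
    have : u * y ≤ v * y := mul_le_mul_of_nonneg_right huv (by linarith)
    have := Real.exp_le_exp.2 this
    linarith

lemma continuousOn_Iic_of_convexOn {g : ℝ → ℝ} (hg : ConvexOn ℝ (Iic 0) g)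
    (h0 : ContinuousWithinAt g (Iic 0) 0) : ContinuousOn g (Iic 0) := by
  intro u hu
  rcases (mem_Iic.1 hu).eq_or_lt with h | h
  · rw [h]; exact h0
  · have := hg.continuousOn_interior
    rw [interior_Iic] at this
    exact (this.continuousAt (Iio_mem_nhds h)).continuousWithinAt

lemma continuousOn_F : ContinuousOn (fun u : ℝ => (X.F u).re) (Iic 0) := by
  refine continuousOn_Iic_of_convexOn X.isExpPositive_F.convexOn ?_
  have h1 : ContinuousWithinAt (fun u : ℝ => X.F u) (Iic 0) 0 := by
    have h2 := X.continuous_F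
    rw [← Complex.ofReal_zero] at h2
    exact ContinuousWithinAt.comp (f := fun u : ℝ => (u : ℂ)) h2
      Complex.continuous_ofReal.continuousWithinAt fun u hu => ofReal_mem_frequencies hu
  exact Complex.continuous_re.continuousAt.comp_continuousWithinAt h1

lemma continuousOn_R : ContinuousOn (fun u : ℝ => (X.R u).re) (Iic 0) := by
  refine continuousOn_Iic_of_convexOn X.isExpPositive_R.convexOn ?_
  have h1 : ContinuousWithinAt (fun u : ℝ => X.R u) (Iic 0) 0 := by
    have h2 := X.continuous_R
    rw [← Complex.ofReal_zero] at h2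
    exact ContinuousWithinAt.comp (f := fun u : ℝ => (u : ℂ)) h2
      Complex.continuous_ofReal.continuousWithinAt fun u hu => ofReal_mem_frequencies hu
  exact Complex.continuous_re.continuousAt.comp_continuousWithinAt h1

/-- Log-convexity of the Laplace transform. -/
lemma convexOn_log_laplace (t : ℝ≥0) {x : ℝ} (hx : 0 ≤ x) :
    ConvexOn ℝ (Iic 0) fun u : ℝ => (X.φ t u).re + x * (X.ψ t u).re := by
  refine ⟨convex_Iic 0, fun p hp q hq s l hs hl hsl => ?_⟩
  set Φ : ℝ → ℝ := fun u => (X.φ t u).re + x * (X.ψ t u).re with hΦ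
  have hL : ∀ u ≤ 0, ∫ ω, Real.exp (u * X.r t ω) ∂(X.P (pt x hx)) = Real.exp (Φ u) :=
    fun u hu => X.laplace hu t (pt x hx)
  have hm : s * p + l * q ≤ 0 := by
    have : p ≤ 0 := hp
    have : q ≤ 0 := hq
    nlinarith
  simp only [smul_eq_mul]
  have h1 : ∫ ω, Real.exp ((s * p + l * q) * X.r t ω) * Real.exp (-(s * Φ p + l * Φ q))
        ∂(X.P (pt x hx))
      ≤ ∫ ω, (s * (Real.exp (p * X.r t ω) * Real.exp (-Φ p))
          + l * (Real.exp (q * X.r t ω) * Real.exp (-Φ q))) ∂(X.P (pt x hx)) := by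
    refine integral_mono ((X.integrable_exp hm t _).mul_const _)
      ((((X.integrable_exp hp t _).mul_const _).const_mul s).add
        (((X.integrable_exp hq t _).mul_const _).const_mul l)) fun ω => ?_
    simp only
    rw [← Real.exp_add, ← Real.exp_add, ← Real.exp_add]
    refine le_trans (le_of_eq ?_) (exp_convex_combination _ _ s l hs hl hsl)
    congr 1; ring
  rw [integral_mul_const, hL _ hm, integral_add
    (((X.integrable_exp hp t _).mul_const _).const_mul s)
    (((X.integrable_exp hq t _).mul_const _).const_mul l), integral_const_mul, integral_const_mul,
    integral_mul_const, integral_mul_const, hL p hp, hL q hq, ← Real.exp_add, ← Real.exp_add,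
    ← Real.exp_add, add_neg_cancel, add_neg_cancel, Real.exp_zero, mul_one, mul_one, hsl,
    Real.exp_le_one_iff] at h1
  linarith

end HalfLine

end AffineProcess

/-! ### Half-line: bond prices and yield curves -/

namespace AffineProcess

section HalfLineBond

variable {Ω : Type*} [MeasurableSpace Ω] (X : AffineProcess StateSpace.halfLine Ω)

/-- The linear exponent of the discretely monitored bond price. -/
noncomputable def discreteB (δ : ℝ≥0) (k : ℕ) : ℝ :=
  (fun v : ℝ => (X.ψ δ ((v - δ : ℝ) : ℂ)).re)^[k] 0

/-- The constant exponent of the discretely monitored bond price. -/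
noncomputable def discreteA (δ : ℝ≥0) (k : ℕ) : ℝ :=
  ∑ j ∈ Finset.range k, (X.φ δ ((X.discreteB δ j - δ : ℝ) : ℂ)).re

lemma discreteB_succ (δ : ℝ≥0) (k : ℕ) :
    X.discreteB δ (k + 1) = (X.ψ δ ((X.discreteB δ k - δ : ℝ) : ℂ)).re := by
  rw [discreteB, Function.iterate_succ_apply']; rfl

lemma discreteB_nonpos (δ : ℝ≥0) (k : ℕ) : X.discreteB δ k ≤ 0 := by
  induction k with
  | zero => simp [discreteB]
  | succ k ih =>
    rw [discreteB_succ]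
    exact X.re_ψ_nonpos (by have := δ.2; linarith [NNReal.coe_nonneg δ]) δ

lemma discreteB_sub_nonpos (δ : ℝ≥0) (k : ℕ) : X.discreteB δ k - δ ≤ 0 := by
  linarith [X.discreteB_nonpos δ k, NNReal.coe_nonneg δ]

/-- The iteration never leaves the nonpositive reals, where the transform is positive and determined
by the real parts of `φ` and `ψ`; no branch of the logarithm is involved. -/
lemma discrete_bond_complex (δ : ℝ≥0) (k : ℕ) (x : StateSpace.halfLine.carrier) :
    ∫ ω, Complex.exp (-(δ : ℂ) * ((∑ j ∈ Finset.range k,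
        (X.r (((j + 1 : ℕ) : ℝ≥0) * δ) ω : ℝ) : ℝ) : ℂ)) ∂(X.P x)
      = Complex.exp ((X.discreteA δ k + x * X.discreteB δ k : ℝ) : ℂ) := by
  have hmem : ∀ u : ℝ, u ≤ 0 → (u : ℂ) ∈ {v : ℂ | ∃ u : ℝ, u ≤ 0 ∧ v = u} :=
      fun u hu => ⟨u, hu, rfl⟩
  have hw : -(δ : ℂ) = ((-δ : ℝ) : ℂ) := by push_cast; rfl
  have key := X.integral_exp_sum (V := {v : ℂ | ∃ u : ℝ, u ≤ 0 ∧ v = u})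
    (φ := fun v => ((X.φ δ v).re : ℂ)) (ψ := fun v => ((X.ψ δ v).re : ℂ)) (δ := δ)
    (w := -(δ : ℂ)) ?_ ?_ ?_ ?_ ?_ x k 0 ⟨0, le_rfl, by simp⟩
  · have hit : ∀ j, (fun v : ℂ => (((X.ψ δ (v + -(δ : ℂ))).re : ℝ) : ℂ))^[j] 0
        = (X.discreteB δ j : ℂ) := by
      intro j
      induction j with
      | zero => simp [discreteB]
      | succ j ih =>
        rw [Function.iterate_succ_apply', ih, discreteB_succ]
        congr 4
        push_cast; ring
    simp only [hit, zero_mul, add_zero] at key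
    rw [key]
    congr 1
    push_cast [discreteA]
    congr 1
  · rintro v ⟨u, hu, rfl⟩
    exact ofReal_mem_frequencies hu
  · rw [hw]; exact ofReal_mem_frequencies (by simp)
  · rintro v ⟨u, hu, rfl⟩ y
    exact X.laplace_complex hu δ y
  · rintro v ⟨u, hu, rfl⟩
    exact hmem _ (X.re_ψ_nonpos hu δ)
  · rintro v ⟨u, hu, rfl⟩
    rw [hw, ← Complex.ofReal_add]
    exact hmem _ (by linarith [NNReal.coe_nonneg δ])

lemma discrete_bond (δ : ℝ≥0) (k : ℕ) (x : StateSpace.halfLine.carrier) :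
    ∫ ω, Real.exp (-(δ * ∑ j ∈ Finset.range k, (X.r (((j + 1 : ℕ) : ℝ≥0) * δ) ω : ℝ))) ∂(X.P x)
      = Real.exp (X.discreteA δ k + x * X.discreteB δ k) := by
  have h := X.discrete_bond_complex δ k x
  rw [← Complex.ofReal_exp] at h
  rw [← Complex.ofReal_inj, ← h, ← integral_complex_ofReal]
  congr 1; ext ω
  push_cast
  congr 1; ring

/-- Another nonnegative summand lowers the price from every starting point, and slopes in `x` are
compared. Consequently all iterates are bounded below by the last one. -/
lemma discreteB_succ_le (δ : ℝ≥0) (k : ℕ) : X.discreteB δ (k + 1) ≤ X.discreteB δ k := by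
  refine le_of_forall_affine_le (a := X.discreteA δ (k + 1)) (a' := X.discreteA δ k) fun x hx => ?_
  have hsum : ∀ j ω, 0 ≤ ∑ j ∈ Finset.range j, (X.r (((j + 1 : ℕ) : ℝ≥0) * δ) ω : ℝ) :=
    fun j ω => Finset.sum_nonneg fun i _ => X.r_nonneg _ _
  have hint : ∀ j, Integrable (fun ω => Real.exp (-(δ * ∑ j ∈ Finset.range j,
      (X.r (((j + 1 : ℕ) : ℝ≥0) * δ) ω : ℝ)))) (X.P (pt x hx)) := by
    intro j
    refine Integrable.of_bound (C := 1) ?_ (Eventually.of_forall fun ω => ?_)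
    · have h1 : Measurable fun ω => ∑ j ∈ Finset.range j, (X.r (((j + 1 : ℕ) : ℝ≥0) * δ) ω : ℝ) :=
        Finset.measurable_sum _ fun i _ => X.measurable_coe_r _
      exact (by fun_prop : Measurable fun ω => Real.exp (-(δ * ∑ j ∈ Finset.range j,
        (X.r (((j + 1 : ℕ) : ℝ≥0) * δ) ω : ℝ)))).aestronglyMeasurable
    · rw [Real.norm_eq_abs, Real.abs_exp, Real.exp_le_one_iff]
      have := mul_nonneg (NNReal.coe_nonneg δ) (hsum j ω)
      linarith
  have h1 := integral_mono (hint (k + 1)) (hint k) fun ω => by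
    simp only
    rw [Real.exp_le_exp, Finset.sum_range_succ, mul_add]
    have := mul_nonneg (NNReal.coe_nonneg δ) (X.r_nonneg (((k + 1 : ℕ) : ℝ≥0) * δ) ω)
    linarith
  rw [X.discrete_bond, X.discrete_bond, Real.exp_le_exp] at h1
  exact h1

lemma discreteB_antitone (δ : ℝ≥0) : Antitone (X.discreteB δ) :=
  antitone_nat_of_succ_le (X.discreteB_succ_le δ)

lemma bondPrice_pos (s : ℝ) (hs : 0 ≤ s) (x : StateSpace.halfLine.carrier) :
    0 < X.bondPrice s x := by
  have hm := X.aemeasurable_integral x hs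
  have hi : Integrable (fun ω => Real.exp (-∫ u in (0 : ℝ)..s, (X.r u.toNNReal ω : ℝ)))
      (X.P x) := by
    refine Integrable.of_bound (C := 1) ?_ (Eventually.of_forall fun ω => ?_)
    · exact (by fun_prop : AEMeasurable (fun ω =>
        Real.exp (-∫ u in (0 : ℝ)..s, (X.r u.toNNReal ω : ℝ))) (X.P x)).aestronglyMeasurable
    · rw [Real.norm_eq_abs, Real.abs_exp, Real.exp_le_one_iff, neg_nonpos]
      exact intervalIntegral.integral_nonneg hs fun u _ => X.r_nonneg _ _
  exact integral_exp_pos hi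

lemma tendsto_discrete_bond {s T : ℝ} (hs : 0 ≤ s) (hsT : s ≤ T) (hT : 0 < T)
    (x : StateSpace.halfLine.carrier) :
    Tendsto (fun n : ℕ => X.discreteA (T / n).toNNReal ⌊s / (T / n)⌋₊
      + x * X.discreteB (T / n).toNNReal ⌊s / (T / n)⌋₊) atTop (𝓝
          (Real.log (X.bondPrice s x))) := by
  have h1 := X.tendsto_integral_exp_riemann x (w := ((-1 : ℝ) : ℂ))
    (ofReal_mem_frequencies (by norm_num)) hs hsT hT
  have h2 := (Complex.continuous_re.tendsto _).comp h1
  have e1 : (∫ ω, Complex.exp (((-1 : ℝ) : ℂ) * ((∫ u in (0 : ℝ)..s, (X.r u.toNNReal ω : ℝ) : ℝ) :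
      ℂ))
        ∂(X.P x)).re = X.bondPrice s x := by
    rw [bondPrice, ← Complex.ofReal_re (∫ ω, _ ∂(X.P x)), ← integral_complex_ofReal]
    congr 2; ext ω
    push_cast
    congr 1; ring
  rw [e1] at h2
  have h3 : Tendsto (fun n : ℕ => Real.exp (X.discreteA (T / n).toNNReal ⌊s / (T / n)⌋₊
      + x * X.discreteB (T / n).toNNReal ⌊s / (T / n)⌋₊)) atTop (𝓝 (X.bondPrice s x)) := by
    refine h2.congr fun n => ?_
    have hδ : ((T / n).toNNReal : ℝ) = T / n := Real.coe_toNNReal _ (by positivity)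
    simp only [Function.comp_apply]
    rw [← X.discrete_bond, hδ, ← Complex.ofReal_re (∫ ω, Real.exp _ ∂(X.P x)),
      ← integral_complex_ofReal]
    congr 2; ext ω
    push_cast
    congr 1; ring
  have h4 := (Real.continuousAt_log (X.bondPrice_pos s hs x).ne').tendsto.comp h3
  refine h4.congr fun n => ?_
  simp [Real.log_exp]

/-- The constant exponent of the bond price. -/
noncomputable def bondA (s : ℝ) : ℝ := Real.log (X.bondPrice s (pt 0 le_rfl))

/-- The linear exponent of the bond price. -/
noncomputable def bondB (s : ℝ) : ℝ := Real.log (X.bondPrice s (pt 1 zero_le_one)) - X.bondA s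

lemma tendsto_discreteA {s T : ℝ} (hs : 0 ≤ s) (hsT : s ≤ T) (hT : 0 < T) :
    Tendsto (fun n : ℕ => X.discreteA (T / n).toNNReal ⌊s / (T / n)⌋₊) atTop (𝓝 (X.bondA s)) := by
  have := X.tendsto_discrete_bond hs hsT hT (pt 0 le_rfl)
  simpa [pt, bondA] using this

lemma tendsto_discreteB {s T : ℝ} (hs : 0 ≤ s) (hsT : s ≤ T) (hT : 0 < T) :
    Tendsto (fun n : ℕ => X.discreteB (T / n).toNNReal ⌊s / (T / n)⌋₊) atTop (𝓝 (X.bondB s)) := by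
  have := (X.tendsto_discrete_bond hs hsT hT (pt 1 zero_le_one)).sub (X.tendsto_discreteA hs hsT hT)
  simpa [pt, bondB] using this

lemma log_bondPrice {s : ℝ} (hs : 0 ≤ s) (x : StateSpace.halfLine.carrier) :
    Real.log (X.bondPrice s x) = X.bondA s + x * X.bondB s := by
  have hs1 : s ≤ s + 1 := by linarith
  have hs2 : 0 < s + 1 := by linarith
  exact tendsto_nhds_unique (X.tendsto_discrete_bond hs hs1 hs2 x)
    ((X.tendsto_discreteA hs hs1 hs2).add ((X.tendsto_discreteB hs hs1 hs2).const_mul _))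

lemma bondB_nonpos {s : ℝ} (hs : 0 ≤ s) : X.bondB s ≤ 0 :=
  le_of_tendsto' (X.tendsto_discreteB hs (T := s + 1) (by linarith) (by linarith))
    fun n => X.discreteB_nonpos _ _

/-- The integral equations for the exponents of the bond price. -/
lemma bond_integral_eq {T : ℝ} (hT : 0 < T) :
    (IntervalIntegrable (fun s => (X.R (X.bondB s : ℝ)).re - 1) volume 0 T ∧
      X.bondB T = ∫ s in (0 : ℝ)..T, ((X.R (X.bondB s : ℝ)).re - 1)) ∧
    (IntervalIntegrable (fun s => (X.F (X.bondB s : ℝ)).re) volume 0 T ∧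
      X.bondA T = ∫ s in (0 : ℝ)..T, (X.F (X.bondB s : ℝ)).re) := by
  let δ : ℕ → ℝ≥0 := fun n => (T / n).toNNReal
  have hδ : ∀ n, (δ n : ℝ) = T / n := fun n => Real.coe_toNNReal _ (by positivity)
  have hδpos : ∀ n : ℕ, 0 < n → 0 < (δ n : ℝ) := fun n hn => by rw [hδ]; positivity
  have hδ0 : Tendsto (fun n => (δ n : ℝ)) atTop (𝓝 0) :=
    (tendsto_const_div_atTop_nhds_zero_nat T).congr fun n => (hδ n).symm
  have hδ0' : Tendsto (fun n => (δ n : ℝ)) atTop (𝓝[>] 0) :=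
    tendsto_nhdsWithin_iff.2 ⟨hδ0, by
      filter_upwards [eventually_gt_atTop 0] with n hn using hδpos n hn⟩
  -- Log-convexity concerns `φ + x ψ` for `x ≥ 0`. Hence the values `x = 0` and `x = 1` are treated,
  -- and the quotient for `ψ` is recovered as `f₁ - f₀`.
  let f₀ : ℕ → ℝ → ℝ := fun n u => (X.φ (δ n) (u : ℂ)).re / δ n
  let f₁ : ℕ → ℝ → ℝ := fun n u => (X.φ (δ n) (u : ℂ)).re / δ n + ((X.ψ (δ n) (u : ℂ)).re - u) / δ n
  have hc₀ : ∀ᶠ n in atTop, ConvexOn ℝ (Iic 0) (f₀ n) := by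
    filter_upwards [eventually_gt_atTop 0] with n hn
    have h1 := (X.convexOn_log_laplace (δ n) le_rfl).smul (inv_nonneg.2 (hδpos n hn).le)
    refine h1.congr fun u _ => ?_
    simp only [f₀, smul_eq_mul, zero_mul, add_zero]; ring
  have hc₁ : ∀ᶠ n in atTop, ConvexOn ℝ (Iic 0) (f₁ n) := by
    filter_upwards [eventually_gt_atTop 0] with n hn
    have h1 := (X.convexOn_log_laplace (δ n) zero_le_one).add
      (concaveOn_id (convex_Iic (0 : ℝ))).neg
    have h1 := h1.smul (inv_nonneg.2 (hδpos n hn).le)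
    refine h1.congr fun u _ => ?_
    simp only [f₁, smul_eq_mul, one_mul, Pi.add_apply, Pi.neg_apply, id]; ring
  have hl₀ : ∀ u ≤ 0, Tendsto (fun n => f₀ n u) atTop (𝓝 (X.F (u : ℂ)).re) := fun u hu =>
    (X.tendsto_re_φ hu).comp hδ0'
  have hl₁ : ∀ u ≤ 0, Tendsto (fun n => f₁ n u) atTop (𝓝 ((X.F (u : ℂ)).re + (X.R (u : ℂ)).re)) :=
    fun u hu => ((X.tendsto_re_φ hu).comp hδ0').add ((X.tendsto_re_ψ hu).comp hδ0')
  let v : ℕ → ℕ → ℝ := fun n k => X.discreteB (δ n) k - δ n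
  have hv0 : ∀ n k, v n k ≤ 0 := fun n k => X.discreteB_sub_nonpos _ _
  have hfl : ∀ n : ℕ, 0 < n → ⌊T / (T / n)⌋₊ = n := by
    intro n hn
    have : T / (T / n) = n := by field_simp
    rw [this, Nat.floor_natCast]
  have hvlim : ∀ s ∈ Ioo 0 T, Tendsto (fun n : ℕ => v n ⌊s / (T / n)⌋₊) atTop (𝓝 (X.bondB s)) := by
    intro s hs
    have := (X.tendsto_discreteB hs.1.le hs.2.le hT).sub hδ0
    rwa [sub_zero] at this
  have hBT : Tendsto (fun n : ℕ => X.discreteB (δ n) n) atTop (𝓝 (X.bondB T)) := by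
    refine (X.tendsto_discreteB hT.le le_rfl hT).congr' ?_
    filter_upwards [eventually_gt_atTop 0] with n hn
    rw [hfl n hn]
  have hAT : Tendsto (fun n : ℕ => X.discreteA (δ n) n) atTop (𝓝 (X.bondA T)) := by
    refine (X.tendsto_discreteA hT.le le_rfl hT).congr' ?_
    filter_upwards [eventually_gt_atTop 0] with n hn
    rw [hfl n hn]
  have hK : 0 ≤ 2 - X.bondB T := by linarith [X.bondB_nonpos hT.le]
  -- Monotonicity in `k` leaves only the last iterate to be bounded; it is within `1` of its limit
  -- `bondB T`, and the mesh costs at most another `1`.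
  have hvK : ∀ᶠ n in atTop, ∀ k < n, v n k ∈ Icc (-(2 - X.bondB T)) 0 := by
    filter_upwards [hBT.eventually_const_lt (show X.bondB T - 1 < X.bondB T by linarith),
      hδ0.eventually_lt_const one_pos] with n h1 h2 k hk
    refine ⟨?_, hv0 n k⟩
    have := X.discreteB_antitone (δ n) hk.le
    simp only [v]
    linarith
  obtain ⟨C₀, hC₀⟩ := convexOn_bounded_of_tendsto hc₀ hl₀ hK
  obtain ⟨C₁, hC₁⟩ := convexOn_bounded_of_tendsto hc₁ hl₁ hK
  have hFc := X.continuousOn_F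
  have hRc := X.continuousOn_R
  have hconv₀ : ∀ s ∈ Ioo 0 T, Tendsto (fun n : ℕ => f₀ n (v n ⌊s / (T / n)⌋₊)) atTop
      (𝓝 (X.F (X.bondB s : ℝ)).re) := fun s hs =>
    convexOn_tendsto_of_tendsto (f := fun u : ℝ => (X.F (u : ℂ)).re) hc₀ hl₀ hFc
      (Eventually.of_forall fun n => hv0 _ _) (X.bondB_nonpos hs.1.le) (hvlim s hs)
  have hconv₁ : ∀ s ∈ Ioo 0 T, Tendsto (fun n : ℕ => f₁ n (v n ⌊s / (T / n)⌋₊)) atTop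
      (𝓝 ((X.F (X.bondB s : ℝ)).re + (X.R (X.bondB s : ℝ)).re)) := fun s hs =>
    convexOn_tendsto_of_tendsto (f := fun u : ℝ => (X.F (u : ℂ)).re + (X.R (u : ℂ)).re) hc₁ hl₁
      (hFc.add hRc) (Eventually.of_forall fun n => hv0 _ _) (X.bondB_nonpos hs.1.le) (hvlim s hs)
  constructor
  · have hlim : ∀ s ∈ Ioo 0 T, Tendsto (fun n : ℕ => f₁ n (v n ⌊s / (T / n)⌋₊)
        - f₀ n (v n ⌊s / (T / n)⌋₊) - 1) atTop (𝓝 ((X.R (X.bondB s : ℝ)).re - 1)) := by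
      intro s hs
      have := ((hconv₁ s hs).sub (hconv₀ s hs)).sub_const 1
      rwa [add_sub_cancel_left] at this
    obtain ⟨hi, hsum⟩ := tendsto_step_sum (fun n k => f₁ n (v n k) - f₀ n (v n k) - 1)
      (fun s => (X.R (X.bondB s : ℝ)).re - 1) (C := C₁ + C₀ + 1) hT (by
        filter_upwards [hvK, hC₀, hC₁] with n h1 h2 h3 k hk
        have h4 := h2 _ (h1 k hk)
        have h5 := h3 _ (h1 k hk)
        rw [abs_le] at h4 h5
        rw [Real.norm_eq_abs, abs_le]
        constructor <;> linarith [h4.1, h4.2, h5.1, h5.2]) hlim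
    refine ⟨hi, tendsto_nhds_unique hBT (hsum.congr' ?_)⟩
    filter_upwards [eventually_gt_atTop 0] with n hn
    -- At `v = B_k - δ` the quotient `(ψ v - v) / δ - 1` equals `(B_{k+1} - B_k) / δ`, so the sum
    -- telescopes.
    have h1 : ∀ k, (T / n) • (f₁ n (v n k) - f₀ n (v n k) - 1)
        = X.discreteB (δ n) (k + 1) - X.discreteB (δ n) k := by
      intro k
      have hne := (hδpos n hn).ne'
      rw [discreteB_succ, ← hδ n]
      simp only [f₁, f₀, v, smul_eq_mul]
      field_simp
      ring
    simp_rw [h1]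
    rw [Finset.sum_range_sub]
    simp [discreteB]
  · obtain ⟨hi, hsum⟩ := tendsto_step_sum (fun n k => f₀ n (v n k))
      (fun s => (X.F (X.bondB s : ℝ)).re) (C := C₀) hT (by
        filter_upwards [hvK, hC₀] with n h1 h2 k hk
        exact h2 _ (h1 k hk)) hconv₀
    refine ⟨hi, tendsto_nhds_unique hAT (hsum.congr' ?_)⟩
    filter_upwards [eventually_gt_atTop 0] with n hn
    rw [discreteA]
    refine Finset.sum_congr rfl fun k _ => ?_
    have hne := (hδpos n hn).ne'
    rw [← hδ n]
    simp only [f₀, v, smul_eq_mul]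
    field_simp

lemma bond_zero : X.bondA 0 = 0 ∧ X.bondB 0 = 0 := by
  have h : ∀ x, X.bondPrice 0 x = 1 := fun x => by simp [bondPrice]
  constructor <;> simp [bondA, bondB, h]

lemma isRiccati_halfLine {c : ℝ} (hc : c < 0) (hR : (X.R (c : ℝ)).re = 1) :
    IsRiccati c (fun u => (X.R (u : ℝ)).re) X.bondB where
  neg := hc
  convexOn := X.isExpPositive_R.convexOn
  continuousOn := X.continuousOn_R
  map_zero := X.F_zero.2
  map_c := hR
  nonpos := fun _ ht => X.bondB_nonpos ht
  intervalIntegrable := fun _ hT => (X.bond_integral_eq hT).1.1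
  eq_integral := fun T hT => by
    rcases hT.eq_or_lt with h | h
    · rw [← h, X.bond_zero.2]; simp
    · exact (X.bond_integral_eq h).1.2

/-- `F` is monotone. Strict convexity forbids flat pieces, and a nonzero linear function is monotone
only with positive slope. -/
lemma strictMonoOn_F (hF : ∃ u : ℝ, u ≤ 0 ∧ (X.F (u : ℝ)).re ≠ 0) :
    StrictMonoOn (fun u : ℝ => (X.F (u : ℝ)).re) (Iic 0) := by
  rcases X.isExpPositive_F.strictConvexOn_or_linear X.F_zero.1 X.continuousOn_F with h | ⟨k, hk⟩
  · intro u hu v hv huv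
    refine lt_of_le_of_ne (X.monotoneOn_F hu hv huv.le) fun heq => ?_
    simp only at heq
    have h1 := h.2 hu hv huv.ne (show (0 : ℝ) < 1 / 2 by norm_num)
      (show (0 : ℝ) < 1 / 2 by norm_num) (by norm_num)
    simp only [smul_eq_mul] at h1
    rw [← heq] at h1
    have h2 := X.monotoneOn_F hu (show 1 / 2 * u + 1 / 2 * v ∈ Iic 0 by
      have : u ≤ 0 := hu
      have : v ≤ 0 := hv
      simp only [mem_Iic]; linarith) (by linarith)
    simp only at h2
    linarith
  · obtain ⟨u, hu, hne⟩ := hF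
    have h1 := X.monotoneOn_F hu (show (0 : ℝ) ∈ Iic 0 by simp) hu
    simp only [X.F_zero.1] at h1
    have hk0 : 0 < k := by
      rw [hk u hu] at h1 hne
      by_contra hcon
      rw [not_lt] at hcon
      exact hne (le_antisymm h1 (mul_nonneg_of_nonpos_of_nonpos hcon hu))
    intro p hp q hq hpq
    simp only [hk p hp, hk q hq]
    exact mul_lt_mul_of_pos_left hpq hk0

theorem shapes_halfLine {c : ℝ} (hc : c < 0) (hR : X.realR c = 1)
    (hF : ∃ u : ℝ, u ≤ 0 ∧ X.realF u ≠ 0)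
    (hlin : ¬ IsLinearFun X.realF ∨ ¬ IsLinearFun X.realR) (x : StateSpace.halfLine.carrier) :
    (IsNormal (fun T => X.yield T x) ∨ IsInverse (fun T => X.yield T x) ∨
        IsHumped (fun T => X.yield T x)) ∧
      (((x : ℝ) : EReal) ≤ X.bYNorm c → IsNormal (fun T => X.yield T x)) ∧
      (X.bYNorm c < ((x : ℝ) : EReal) → ((x : ℝ) : EReal) < X.bInv →
        IsHumped (fun T => X.yield T x)) ∧
      (X.bInv ≤ ((x : ℝ) : EReal) → IsInverse (fun T => X.yield T x)) := by
  have eF : ∀ u : ℝ, X.realF u = (((X.F (u : ℂ)).re : ℝ) : EReal) := fun _ => rfl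
  have eR : ∀ u : ℝ, X.realR u = (((X.R (u : ℂ)).re : ℝ) : EReal) := fun _ => rfl
  have hR' : (X.R (c : ℝ)).re = 1 := by
    rw [eR] at hR; exact_mod_cast hR
  have hF' : ∃ u : ℝ, u ≤ 0 ∧ (X.F (u : ℝ)).re ≠ 0 := by
    obtain ⟨u, hu, hne⟩ := hF
    refine ⟨u, hu, fun h0 => hne ?_⟩
    rw [eF, h0]; rfl
  have h := X.isRiccati_halfLine hc hR'
  have hsub : Ioc c 0 ⊆ Iic 0 := fun u hu => hu.2
  have hx0 : 0 ≤ (x : ℝ) := x.2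
  have hfmono := X.strictMonoOn_F hF'
  have hfconv : ConvexOn ℝ (Ioc c 0) fun u : ℝ => (X.F (u : ℝ)).re :=
    X.isExpPositive_F.convexOn.subset hsub (convex_Ioc c 0)
  have hρconv : ConvexOn ℝ (Ioc c 0) fun u : ℝ => (X.R (u : ℝ)).re :=
    X.isExpPositive_R.convexOn.subset hsub (convex_Ioc c 0)
  refine shapes_of_isRiccati X x h (f := fun u : ℝ => (X.F (u : ℝ)).re) hfconv
    (X.continuousOn_F.mono hsub) X.F_zero.1 (fun u _ => eF u) (fun u _ => eR u) ?_ ?_ ?_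
    (Or.inl hx0) ?_ ?_
  · rw [eF]
    refine (continuous_coe_real_ereal.tendsto _).comp ?_
    exact (X.continuousOn_F.continuousAt (Iic_mem_nhds hc)).tendsto.mono_left nhdsWithin_le_nhds
  · rw [eF]; exact EReal.coe_ne_bot _
  -- At `x = 0` the function `G = F` may be linear, but it is strictly increasing. For `x > 0` it
  -- suffices that one of `F`, `R` is strictly convex.
  · rcases hx0.eq_or_lt with h0 | h0
    · left
      simp only [← h0, zero_mul, add_zero]
      exact hfmono.mono hsub
    · right
      rcases X.isExpPositive_F.strictConvexOn_or_linear X.F_zero.1 X.continuousOn_F with h1 | ⟨k,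
          hk⟩
      · exact (h1.subset hsub (convex_Ioc c 0)).add_convexOn (hρconv.smul hx0)
      · rcases X.isExpPositive_R.strictConvexOn_or_linear X.F_zero.2 X.continuousOn_R
          with h2 | ⟨l, hl⟩
        · refine hfconv.add_strictConvexOn ?_
          have h3 := h2.subset hsub (convex_Ioc c 0)
          refine ⟨h3.1, fun p hp q hq hpq a b ha hb hab => ?_⟩
          have h4 := h3.2 hp hq hpq ha hb hab
          simp only [smul_eq_mul] at h4 ⊢
          calc _ < (x : ℝ) * _ := mul_lt_mul_of_pos_left h4 h0
            _ = _ := by ring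
        · exfalso
          rcases hlin with h3 | h3
          · exact h3 ⟨k, fun u hu => by rw [eF, hk u hu]⟩
          · exact h3 ⟨l, fun u hu => by rw [eR, hl u hu]⟩
  -- `F` has a positive slope `κ` from `c / 2` to `0`, and slopes nearer zero are at least as large.
  -- Since `R'(0) ≥ 0`, the slopes of `R` near zero exceed `-κ / (2 (1 + x))`, too little to cancel
  -- `κ` after multiplication by `x`.
  · intro hnn
    have hmid : c / 2 ∈ Ioo c 0 := ⟨by linarith, by linarith⟩
    have hneg : (X.F ((c / 2 : ℝ) : ℂ)).re < 0 := by
      have := hfmono hmid.2.le (show (0 : ℝ) ∈ Iic 0 by simp) hmid.2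
      simpa only [X.F_zero.1] using this
    set κ := (X.F ((c / 2 : ℝ) : ℂ)).re / (c / 2) with hκ
    have hκ0 : 0 < κ := div_pos_of_neg_of_neg hneg hmid.2
    obtain ⟨v, hv, hv2⟩ := exists_lt_slope hc X.F_zero.2 (fun u _ => eR u)
      (a := -(κ / (2 * (1 + x)))) (lt_of_lt_of_le (by
        rw [← EReal.coe_zero, EReal.coe_lt_coe_iff, neg_lt_zero]; positivity) hnn)
    have hw : max (c / 2) v ∈ Ioo c 0 := ⟨hmid.1.trans_le (le_max_left _ _), max_lt hmid.2 hv.2⟩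
    refine ⟨_, hw, ?_⟩
    have h1 := slope_zero_mono hfconv X.F_zero.1 hmid.1 (le_max_left _ v) hw.2
    have h2 := slope_zero_mono hρconv X.F_zero.2 hv.1 (le_max_right (c / 2) v) hw.2
    rw [← hκ] at h1
    generalize max (c / 2) v = w at *
    have e : (X.F (w : ℂ)).re + x * (X.R (w : ℂ)).re
        = w * ((X.F (w : ℂ)).re / w + x * ((X.R (w : ℂ)).re / w)) := by
      have := hw.2.ne
      field_simp
    rw [e]
    refine mul_neg_of_neg_of_pos hw.2 ?_
    have h3 : x * -(κ / (2 * (1 + x))) ≤ x * ((X.R (w : ℂ)).re / w) :=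
      mul_le_mul_of_nonneg_left (by linarith) hx0
    have h4 : (x : ℝ) * (κ / (2 * (1 + x))) ≤ κ / 2 := by
      rw [mul_div_assoc', div_le_div_iff₀ (by positivity) (by norm_num)]
      nlinarith
    linarith
  · intro T hT
    have hb := X.bond_integral_eq hT
    rw [yield, X.log_bondPrice hT.le, hb.2.2]
    have hFi := hb.2.1
    have hRi := hb.1.1
    have e : ∫ s in (0 : ℝ)..T, ((X.F (X.bondB s : ℝ)).re + x * (X.R (X.bondB s : ℝ)).re)
        = (∫ s in (0 : ℝ)..T, (X.F (X.bondB s : ℝ)).re) + x * (X.bondB T + T) := by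
      have e1 : ∀ s, (X.F (X.bondB s : ℝ)).re + x * (X.R (X.bondB s : ℝ)).re
          = (X.F (X.bondB s : ℝ)).re + (x * ((X.R (X.bondB s : ℝ)).re - 1) + x) := fun s => by ring
      simp_rw [e1]
      rw [intervalIntegral.integral_add hFi ((hRi.const_mul _).add intervalIntegrable_const),
        intervalIntegral.integral_add (hRi.const_mul _) intervalIntegrable_const,
        intervalIntegral.integral_const_mul, ← hb.1.2]
      simp; ring
    rw [e]
    field_simp
    ring

end HalfLineBond

end AffineProcess

/-! ### Estimates for the Lévy-Khintchine integrand -/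

lemma measurable_truncation : Measurable truncation :=
  Measurable.ite (measurableSet_le (by fun_prop) measurable_const) measurable_id measurable_const

/-- The compensated exponential `ξ ↦ e ^ (u ξ) - 1 - u h(ξ)`. -/
noncomputable def compExp (u : ℂ) (ξ : ℝ) : ℂ :=
  Complex.exp (u * (ξ : ℂ)) - 1 - u * (truncation ξ : ℂ)

/-- The compensated exponential at a real point. -/
noncomputable def realCompExp (x ξ : ℝ) : ℝ := Real.exp (x * ξ) - 1 - x * truncation ξ

lemma compExp_ofReal (x ξ : ℝ) : compExp x ξ = realCompExp x ξ := by
  simp [compExp, realCompExp]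

lemma measurable_compExp (u : ℂ) : Measurable (compExp u) := by
  have := measurable_truncation
  unfold compExp
  fun_prop

lemma measurable_realCompExp (x : ℝ) : Measurable (realCompExp x) := by
  have := measurable_truncation
  unfold realCompExp
  fun_prop

lemma differentiable_compExp (ξ : ℝ) : Differentiable ℂ fun u => compExp u ξ := by
  unfold compExp
  fun_prop

/-- The exponential of the large jumps. -/
noncomputable def expLarge (x ξ : ℝ) : ℝ := if |ξ| ≤ 1 then 0 else Real.exp (x * ξ)

lemma expLarge_nonneg (x ξ : ℝ) : 0 ≤ expLarge x ξ := by
  unfold expLarge; split_ifs <;> positivity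

lemma measurable_expLarge (x : ℝ) : Measurable (expLarge x) :=
  Measurable.ite (measurableSet_le (by fun_prop) measurable_const) measurable_const (by fun_prop)

lemma min_one_sq_of_le {ξ : ℝ} (h : |ξ| ≤ 1) : min 1 (ξ ^ 2) = ξ ^ 2 :=
  min_eq_right (by rw [← sq_abs]; exact pow_le_one₀ (abs_nonneg _) h)

lemma min_one_sq_of_gt {ξ : ℝ} (h : ¬ |ξ| ≤ 1) : min 1 (ξ ^ 2) = 1 :=
  min_eq_left (by rw [← sq_abs]; exact one_le_pow₀ (not_le.1 h).le)

lemma min_one_sq_nonneg (ξ : ℝ) : 0 ≤ min 1 (ξ ^ 2) := le_min zero_le_one (sq_nonneg _)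

/-- The negative part is integrable against every Lévy measure, so the real exponent can only
diverge to `+∞`. -/
lemma neg_min_le_realCompExp (x ξ : ℝ) : -min 1 (ξ ^ 2) ≤ realCompExp x ξ := by
  unfold realCompExp truncation
  split_ifs with h
  · have := Real.add_one_le_exp (x * ξ)
    have := min_one_sq_nonneg ξ
    linarith
  · rw [min_one_sq_of_gt h, mul_zero]
    have := Real.exp_pos (x * ξ)
    linarith

lemma expLarge_le (x ξ : ℝ) : expLarge x ξ ≤ realCompExp x ξ + min 1 (ξ ^ 2) := by
  have h1 := neg_min_le_realCompExp x ξ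
  unfold expLarge
  split_ifs with h
  · linarith
  · rw [realCompExp, truncation, if_neg h, min_one_sq_of_gt h]; linarith

lemma expLarge_le_of_mem {x₀ x : ℝ} (hx₀ : x₀ ≤ x) (hx : x ≤ 0) (ξ : ℝ) :
    expLarge x ξ ≤ min 1 (ξ ^ 2) + expLarge x₀ ξ := by
  unfold expLarge
  split_ifs with h
  · linarith [min_one_sq_nonneg ξ]
  · rw [min_one_sq_of_gt h]
    rcases le_total 0 ξ with h0 | h0
    · have : Real.exp (x * ξ) ≤ 1 := Real.exp_le_one_iff.2 (mul_nonpos_of_nonpos_of_nonneg hx h0)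
      have := Real.exp_pos (x₀ * ξ)
      linarith
    · have : Real.exp (x * ξ) ≤ Real.exp (x₀ * ξ) :=
        Real.exp_le_exp.2 (mul_le_mul_of_nonpos_right hx₀ h0)
      linarith

/-- One dominating function for a bounded piece of the strip: second-order Taylor for small jumps,
the exponential at the left edge for large ones. -/
lemma norm_compExp_le {x₀ : ℝ} {u : ℂ} (hx₀ : x₀ ≤ u.re) (hu : u.re ≤ 0) {N : ℝ} (hN : ‖u‖ ≤ N)
    (ξ : ℝ) :
    ‖compExp u ξ‖ ≤ (N ^ 2 * Real.exp N + 2) * min 1 (ξ ^ 2) + expLarge x₀ ξ := by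
  have hN0 : 0 ≤ N := (norm_nonneg _).trans hN
  by_cases h : |ξ| ≤ 1
  · have h1 := Complex.norm_exp_sub_sum_le_norm_mul_exp (u * ξ) 2
    have h2 : ‖u * (ξ : ℂ)‖ ≤ N * |ξ| := by
      rw [norm_mul, Complex.norm_real, Real.norm_eq_abs]
      exact mul_le_mul_of_nonneg_right hN (abs_nonneg _)
    have h3 : compExp u ξ = Complex.exp (u * ξ) - ∑ m ∈ Finset.range 2, (u * ξ) ^ m /
        (m.factorial : ℂ) := by
      simp [compExp, truncation, if_pos h, Finset.sum_range_succ]; ring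
    rw [h3, min_one_sq_of_le h]
    have h4 : ‖u * (ξ : ℂ)‖ ^ 2 * Real.exp ‖u * (ξ : ℂ)‖ ≤ (N * |ξ|) ^ 2 * Real.exp N := by
      have : N * |ξ| ≤ N := mul_le_of_le_one_right hN0 h
      gcongr
      exact h2.trans this
    rw [mul_pow, sq_abs] at h4
    have h5 := expLarge_nonneg x₀ ξ
    nlinarith [sq_nonneg ξ]
  · have h1 := expLarge_le_of_mem hx₀ hu ξ
    have h2 : compExp u ξ = Complex.exp (u * ξ) - 1 := by simp [compExp, truncation, if_neg h]
    rw [h2]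
    refine (norm_sub_le _ _).trans ?_
    rw [norm_one, Complex.norm_exp]
    have h3 : (u * (ξ : ℂ)).re = u.re * ξ := by simp
    rw [h3]
    have h4 : expLarge u.re ξ = Real.exp (u.re * ξ) := if_neg h
    rw [h4, min_one_sq_of_gt h] at h1
    rw [min_one_sq_of_gt h]
    have : 0 ≤ N ^ 2 * Real.exp N := by positivity
    linarith

/-! ### Finiteness and regularity of Lévy-Khintchine exponents -/

namespace LevyTriplet

variable (T : LevyTriplet)

/-- The large jumps have an exponential moment of order `x`. -/
def HasMoment (x : ℝ) : Prop := Integrable (expLarge x) T.m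

variable {T}

lemma integrable_min : Integrable (fun ξ => min 1 (ξ ^ 2)) T.m := by
  refine ⟨by fun_prop, ?_⟩
  rw [hasFiniteIntegral_iff_ofReal (Eventually.of_forall fun ξ => min_one_sq_nonneg ξ)]
  exact T.m_integrable

lemma HasMoment.mono {x₀ x : ℝ} (h : T.HasMoment x₀) (hx₀ : x₀ ≤ x) (hx : x ≤ 0) :
    T.HasMoment x := by
  refine Integrable.mono' (integrable_min.add h) (measurable_expLarge x).aestronglyMeasurable
    (Eventually.of_forall fun ξ => ?_)
  rw [Real.norm_of_nonneg (expLarge_nonneg _ _)]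
  exact expLarge_le_of_mem hx₀ hx ξ

lemma hasMoment_zero : T.HasMoment 0 := by
  refine Integrable.mono' integrable_min (measurable_expLarge 0).aestronglyMeasurable
    (Eventually.of_forall fun ξ => ?_)
  rw [Real.norm_of_nonneg (expLarge_nonneg _ _)]
  unfold expLarge
  split_ifs with h
  · exact min_one_sq_nonneg ξ
  · simp [min_one_sq_of_gt h]

lemma HasMoment.integrable_compExp {x₀ : ℝ} (h : T.HasMoment x₀) {u : ℂ} (hx₀ : x₀ ≤ u.re)
    (hu : u.re ≤ 0) : Integrable (compExp u) T.m :=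
  Integrable.mono' ((integrable_min.const_mul _).add h)
    (measurable_compExp u).aestronglyMeasurable
    (Eventually.of_forall fun ξ => norm_compExp_le hx₀ hu le_rfl ξ)

lemma HasMoment.integrable_realCompExp {x : ℝ} (h : T.HasMoment x) (hx : x ≤ 0) :
    Integrable (realCompExp x) T.m := by
  have h1 := (h.integrable_compExp (u := x) (by simp) (by simpa using hx)).re
  refine h1.congr (Eventually.of_forall fun ξ => ?_)
  simp [compExp_ofReal]

lemma hasMoment_of_integrable {x : ℝ} (h : Integrable (realCompExp x) T.m) : T.HasMoment x := by
  refine Integrable.mono' (h.add integrable_min) (measurable_expLarge x).aestronglyMeasurable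
    (Eventually.of_forall fun ξ => ?_)
  rw [Real.norm_of_nonneg (expLarge_nonneg _ _)]
  exact expLarge_le x ξ

lemma exponent_def (u : ℂ) :
    T.exponent u = (T.a : ℂ) / 2 * u ^ 2 + (T.b : ℂ) * u + ∫ ξ, compExp u ξ ∂T.m := rfl

/-- The Lévy-Khintchine exponent at a real point, as a real number. -/
noncomputable def realValue (T : LevyTriplet) (x : ℝ) : ℝ :=
  T.a / 2 * x ^ 2 + T.b * x + ∫ ξ, realCompExp x ξ ∂T.m

lemma exponent_ofReal (x : ℝ) : T.exponent x = T.realValue x := by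
  have : ∫ ξ, compExp x ξ ∂T.m = ((∫ ξ, realCompExp x ξ ∂T.m : ℝ) : ℂ) := by
    rw [← integral_complex_ofReal]
    simp_rw [compExp_ofReal]
  rw [exponent_def, this, realValue]
  push_cast
  ring

lemma realValue_zero : T.realValue 0 = 0 := by
  simp [realValue, realCompExp]

lemma lintegral_neg_lt_top (x : ℝ) : ∫⁻ ξ, ENNReal.ofReal (-realCompExp x ξ) ∂T.m < ∞ :=
  (lintegral_mono fun ξ => ENNReal.ofReal_le_ofReal
    (by linarith [neg_min_le_realCompExp x ξ])).trans_lt T.m_integrable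

lemma realExponent_def (x : ℝ) : T.realExponent x
    = ((T.a / 2 * x ^ 2 + T.b * x : ℝ) : EReal)
      + (((∫⁻ ξ, ENNReal.ofReal (realCompExp x ξ) ∂T.m : ℝ≥0∞) : EReal)
        - ((∫⁻ ξ, ENNReal.ofReal (-realCompExp x ξ) ∂T.m : ℝ≥0∞) : EReal)) := by
  have h1 : ∀ ξ, (((Real.exp (x * ξ) - 1 - x * truncation ξ : ℝ) : EReal)).toENNReal
      = ENNReal.ofReal (realCompExp x ξ) := fun ξ => EReal.toENNReal_of_ne_top (EReal.coe_ne_top _)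
  have h2 : ∀ ξ, (-((Real.exp (x * ξ) - 1 - x * truncation ξ : ℝ) : EReal)).toENNReal
      = ENNReal.ofReal (-realCompExp x ξ) := fun ξ => by
    rw [← EReal.coe_neg]; exact EReal.toENNReal_of_ne_top (EReal.coe_ne_top _)
  rw [realExponent, eintegral]
  simp_rw [h1, h2]

lemma HasMoment.realExponent_eq {x : ℝ} (h : T.HasMoment x) (hx : x ≤ 0) :
    T.realExponent x = T.realValue x := by
  have hi := h.integrable_realCompExp hx
  have h1 : ∫⁻ ξ, ENNReal.ofReal (realCompExp x ξ) ∂T.m ≠ ∞ :=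
    ((lintegral_mono fun ξ => Real.ofReal_le_enorm _).trans_lt hi.2).ne
  have h2 := (T.lintegral_neg_lt_top x).ne
  rw [realExponent_def, realValue, integral_eq_lintegral_pos_part_sub_lintegral_neg_part hi]
  rw [← EReal.coe_ennreal_toReal h1, ← EReal.coe_ennreal_toReal h2]
  norm_cast

lemma realExponent_eq_top {x : ℝ} (h : ¬ T.HasMoment x) : T.realExponent x = ⊤ := by
  have h2 := (T.lintegral_neg_lt_top x).ne
  have h1 : ∫⁻ ξ, ENNReal.ofReal (realCompExp x ξ) ∂T.m = ∞ := by
    by_contra hcon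
    refine h (hasMoment_of_integrable ⟨(measurable_realCompExp x).aestronglyMeasurable, ?_⟩)
    rw [hasFiniteIntegral_iff_enorm]
    refine lt_of_le_of_lt (b := ∫⁻ ξ, (ENNReal.ofReal (realCompExp x ξ)
      + ENNReal.ofReal (-realCompExp x ξ)) ∂T.m) (lintegral_mono fun ξ => ?_) ?_
    · rw [Real.enorm_eq_ofReal_abs]
      rcases le_total 0 (realCompExp x ξ) with h0 | h0
      · rw [abs_of_nonneg h0]; exact le_self_add
      · rw [abs_of_nonpos h0]; exact le_add_self
    · rw [lintegral_add_left (measurable_realCompExp x).ennreal_ofReal]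
      exact ENNReal.add_lt_top.2 ⟨lt_top_iff_ne_top.2 hcon, lt_top_iff_ne_top.2 h2⟩
  rw [realExponent_def, h1, ← EReal.coe_ennreal_toReal h2, EReal.coe_ennreal_top,
    EReal.top_sub_coe, EReal.coe_add_top]

lemma realExponent_ne_bot {x : ℝ} (hx : x ≤ 0) : T.realExponent x ≠ ⊥ := by
  by_cases h : T.HasMoment x
  · rw [h.realExponent_eq hx]; exact EReal.coe_ne_bot _
  · rw [realExponent_eq_top h]; exact top_ne_bot

lemma HasMoment.continuousOn_exponent {x₀ : ℝ} (h : T.HasMoment x₀) :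
    ContinuousOn T.exponent {u : ℂ | u.re ∈ Icc x₀ 0} := by
  intro u₀ _
  have : ContinuousWithinAt (fun u => ∫ ξ, compExp u ξ ∂T.m) {u : ℂ | u.re ∈ Icc x₀ 0} u₀ := by
    refine continuousWithinAt_of_dominated
      (bound := fun ξ => ((‖u₀‖ + 1) ^ 2 * Real.exp (‖u₀‖ + 1) + 2) * min 1 (ξ ^ 2) + expLarge x₀ ξ)
      (Eventually.of_forall fun u => (measurable_compExp u).aestronglyMeasurable) ?_
      ((integrable_min.const_mul _).add h)
      (Eventually.of_forall fun ξ => (differentiable_compExp ξ).continuous.continuousWithinAt)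
    have h1 : ∀ᶠ u in 𝓝[{u : ℂ | u.re ∈ Icc x₀ 0}] u₀, ‖u‖ < ‖u₀‖ + 1 :=
      mem_nhdsWithin_of_mem_nhds
        (continuous_norm.continuousAt.eventually_lt_const (lt_add_one ‖u₀‖))
    filter_upwards [h1, self_mem_nhdsWithin] with u hu hu2
    exact Eventually.of_forall fun ξ => norm_compExp_le hu2.1 hu2.2 hu.le ξ
  have h2 : Continuous fun u : ℂ => (T.a : ℂ) / 2 * u ^ 2 + (T.b : ℂ) * u := by fun_prop
  exact h2.continuousWithinAt.add this

lemma HasMoment.differentiableOn_exponent {x₀ : ℝ} (h : T.HasMoment x₀) :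
    DifferentiableOn ℂ T.exponent {u : ℂ | u.re ∈ Ioo x₀ 0} := by
  intro u₀ hu₀
  set U : Set ℂ := {u : ℂ | u.re ∈ Ioo x₀ 0} ∩ Metric.ball 0 (‖u₀‖ + 1) with hU
  have hUo : IsOpen U := (isOpen_Ioo.preimage Complex.continuous_re).inter Metric.isOpen_ball
  have hmem : u₀ ∈ U := ⟨hu₀, by simp⟩
  have h1 : DifferentiableOn ℂ (fun u => ∫ ξ, compExp u ξ ∂T.m) U := by
    refine differentiableOn_integral_of_dominated (f := fun ξ u => compExp u ξ)
      (bound := fun ξ => ((‖u₀‖ + 1) ^ 2 * Real.exp (‖u₀‖ + 1) + 2) * min 1 (ξ ^ 2) + expLarge x₀ ξ)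
      hUo (fun u _ => (measurable_compExp u).aestronglyMeasurable)
      (Eventually.of_forall fun ξ => (differentiable_compExp ξ).differentiableOn)
      (Eventually.of_forall fun ξ u hu => norm_compExp_le hu.1.1.le hu.1.2.le ?_ ξ)
      ((integrable_min.const_mul _).add h)
    exact (mem_ball_zero_iff.1 hu.2).le
  have h2 : Differentiable ℂ fun u : ℂ => (T.a : ℂ) / 2 * u ^ 2 + (T.b : ℂ) * u := by fun_prop
  exact (h2.differentiableAt.add (h1.differentiableAt (hUo.mem_nhds hmem))).differentiableWithinAt

lemma re_compExp_le (u : ℂ) (ξ : ℝ) : (compExp u ξ).re ≤ realCompExp u.re ξ := by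
  have h1 : (u * (ξ : ℂ)).re = u.re * ξ := by simp
  have h2 : (compExp u ξ).re = (Complex.exp (u * ξ)).re - 1 - u.re * truncation ξ := by
    simp [compExp]
  rw [h2, realCompExp]
  have h3 := Complex.re_le_norm (Complex.exp (u * ξ))
  rw [Complex.norm_exp, h1] at h3
  linarith

/-- An imaginary part of `u` only lowers the Gaussian term, by `a (Im u)² / 2`, and the real part of
each exponential. This bounds the continued transform on vertical strips. -/
lemma HasMoment.re_exponent_le {x₀ : ℝ} (h : T.HasMoment x₀) {u : ℂ} (hx₀ : x₀ ≤ u.re)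
    (hu : u.re ≤ 0) : (T.exponent u).re ≤ T.realValue u.re := by
  have hi := h.integrable_compExp hx₀ hu
  have hr := (h.mono hx₀ hu).integrable_realCompExp hu
  have h1 : (∫ ξ, compExp u ξ ∂T.m).re = ∫ ξ, (compExp u ξ).re ∂T.m := (integral_re hi).symm
  have h2 : ∫ ξ, (compExp u ξ).re ∂T.m ≤ ∫ ξ, realCompExp u.re ξ ∂T.m :=
    integral_mono hi.re hr fun ξ => re_compExp_le u ξ
  have h3 : ((T.a : ℂ) / 2 * u ^ 2 + (T.b : ℂ) * u).re
      = T.a / 2 * (u.re ^ 2 - u.im ^ 2) + T.b * u.re := by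
    have e : (T.a : ℂ) / 2 = ((T.a / 2 : ℝ) : ℂ) := by push_cast; rfl
    rw [e, Complex.add_re, Complex.re_ofReal_mul, Complex.re_ofReal_mul, sq, Complex.mul_re]
    ring
  rw [exponent_def, Complex.add_re, h3, h1, realValue]
  have := mul_nonneg (div_nonneg T.a_nonneg zero_le_two) (sq_nonneg u.im)
  linarith

lemma HasMoment.continuousOn_realValue {x₀ : ℝ} (h : T.HasMoment x₀) :
    ContinuousOn T.realValue (Icc x₀ 0) := by
  have h1 : ContinuousOn (fun x : ℝ => (T.exponent x).re) (Icc x₀ 0) :=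
    Complex.continuous_re.comp_continuousOn
      (h.continuousOn_exponent.comp Complex.continuous_ofReal.continuousOn fun x hx => by simpa
          using hx)
  simpa only [exponent_ofReal, Complex.ofReal_re] using h1

end LevyTriplet

/-! ### Convexity and boundary behaviour of the exponents -/

namespace LevyTriplet

variable {T : LevyTriplet}

lemma exp_convex_defect {p q s t : ℝ} (hs : 0 < s) (ht : 0 < t) (hst : s + t = 1) (ξ : ℝ) :
    0 ≤ s * Real.exp (p * ξ) + t * Real.exp (q * ξ) - Real.exp ((s * p + t * q) * ξ) := by
  have := convexOn_exp.2 (mem_univ (p * ξ)) (mem_univ (q * ξ)) hs.le ht.le hst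
  simp only [smul_eq_mul] at this
  have e : (s * p + t * q) * ξ = s * (p * ξ) + t * (q * ξ) := by ring
  rw [e]; linarith

lemma exp_convex_defect_pos {p q s t : ℝ} (hpq : p ≠ q) (hs : 0 < s) (ht : 0 < t) (hst : s + t = 1)
    {ξ : ℝ} (hξ : ξ ≠ 0) :
    0 < s * Real.exp (p * ξ) + t * Real.exp (q * ξ) - Real.exp ((s * p + t * q) * ξ) := by
  have := strictConvexOn_exp.2 (mem_univ (p * ξ)) (mem_univ (q * ξ))
    (fun h => hpq (mul_right_cancel₀ hξ h)) hs ht hst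
  simp only [smul_eq_mul] at this
  have e : (s * p + t * q) * ξ = s * (p * ξ) + t * (q * ξ) := by ring
  rw [e]; linarith

/-- The exponent is strictly convex unless it is linear. -/
lemma strictConvexOn_realValue {c : ℝ} (h : ∀ u ∈ Ioc c 0, T.HasMoment u)
    (hne : T.a ≠ 0 ∨ T.m ≠ 0) : StrictConvexOn ℝ (Ioc c 0) T.realValue := by
  refine ⟨convex_Ioc c 0, fun p hp q hq hpq s t hs ht hst => ?_⟩
  have hm := convex_Ioc c 0 hp hq hs.le ht.le hst
  simp only [smul_eq_mul] at hm ⊢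
  have ip := (h p hp).integrable_realCompExp hp.2
  have iq := (h q hq).integrable_realCompExp hq.2
  have im := (h _ hm).integrable_realCompExp hm.2
  set D : ℝ → ℝ := fun ξ =>
    s * Real.exp (p * ξ) + t * Real.exp (q * ξ) - Real.exp ((s * p + t * q) * ξ) with hD
  have hDeq : ∀ ξ, s * realCompExp p ξ + t * realCompExp q ξ - realCompExp (s * p + t * q) ξ
      = D ξ := by
    intro ξ
    simp only [realCompExp, hD]
    linear_combination -hst
  have hDi : Integrable D T.m :=
    (((ip.const_mul s).add (iq.const_mul t)).sub im).congr (Eventually.of_forall hDeq)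
  have hD0 : 0 ≤ D := fun ξ => exp_convex_defect hs ht hst ξ
  have hint : s * ∫ ξ, realCompExp p ξ ∂T.m + t * ∫ ξ, realCompExp q ξ ∂T.m
      - ∫ ξ, realCompExp (s * p + t * q) ξ ∂T.m = ∫ ξ, D ξ ∂T.m := by
    rw [← integral_congr_ae (Eventually.of_forall hDeq), integral_sub _ im, integral_add,
      integral_const_mul, integral_const_mul]
    · exact ip.const_mul s
    · exact iq.const_mul t
    · exact (ip.const_mul s).add (iq.const_mul t)
  have hI0 : 0 ≤ ∫ ξ, D ξ ∂T.m := integral_nonneg hD0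
  have hq0 : s * p ^ 2 + t * q ^ 2 - (s * p + t * q) ^ 2 = s * t * (p - q) ^ 2 := by
    have : t = 1 - s := by linarith
    subst this; ring
  have hsq : 0 < s * t * (p - q) ^ 2 := by
    have := sub_ne_zero.2 hpq
    positivity
  have ha0 := T.a_nonneg
  -- The quadratic and the jump integral contribute nonnegative convexity defects. A nonzero `a`
  -- makes the first positive; a nonzero `m` the second, because `D` is positive off the origin,
  -- which `m` does not charge.
  have hkey : 0 < T.a / 2 * (s * t * (p - q) ^ 2) + ∫ ξ, D ξ ∂T.m := by
    rcases hne with h1 | h1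
    · have : 0 < T.a := lt_of_le_of_ne ha0 h1.symm
      have : 0 < T.a / 2 * (s * t * (p - q) ^ 2) := by positivity
      linarith
    · have : 0 < ∫ ξ, D ξ ∂T.m := by
        rw [integral_pos_iff_support_of_nonneg hD0 hDi]
        have hsup : ({0} : Set ℝ)ᶜ ⊆ Function.support D := fun ξ hξ =>
          (exp_convex_defect_pos hpq hs ht hst hξ).ne'
        refine lt_of_lt_of_le ?_ (measure_mono hsup)
        rw [pos_iff_ne_zero]
        intro h2
        refine h1 (Measure.measure_univ_eq_zero.1 ?_)
        rw [← Set.union_compl_self ({0} : Set ℝ)]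
        exact measure_union_null T.m_zero h2
      have : 0 ≤ T.a / 2 * (s * t * (p - q) ^ 2) := by positivity
      linarith
  simp only [realValue]
  rw [← hint, ← hq0] at hkey
  linarith

lemma realExponent_eq_linear (ha : T.a = 0) (hm : T.m = 0) (x : ℝ) :
    T.realExponent x = ((T.b * x : ℝ) : EReal) := by
  rw [realExponent_def, ha, hm]
  simp

lemma exponent_eq_linear (ha : T.a = 0) (hm : T.m = 0) (u : ℂ) : T.exponent u = T.b * u := by
  rw [exponent_def, ha, hm]
  simp

/-- The exponent converges to its value at the left end point, which may be infinite. -/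
lemma tendsto_realValue {c : ℝ} (hc : c < 0) (h : ∀ u ∈ Ioc c 0, T.HasMoment u) :
    Tendsto (fun u => (T.realValue u : EReal)) (𝓝[>] c) (𝓝 (T.realExponent c)) := by
  by_cases hcm : T.HasMoment c
  · rw [hcm.realExponent_eq hc.le]
    refine (continuous_coe_real_ereal.tendsto _).comp ?_
    have h1 := hcm.continuousOn_realValue c ⟨le_rfl, hc.le⟩
    refine h1.tendsto.mono_left ?_
    rw [← nhdsWithin_Ioo_eq_nhdsGT hc]
    exact nhdsWithin_mono _ fun u hu => ⟨hu.1.le, hu.2.le⟩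
  · rw [realExponent_eq_top hcm, EReal.tendsto_nhds_top_iff_real]
    intro M
    by_contra hcon
    -- If the values do not tend to infinity, they are bounded along a sequence converging to `c`.
    -- Adding `min 1 ξ²` makes the integrands nonnegative, and Fatou's lemma gives the forbidden
    -- moment at `c`.
    have hfr : ∃ᶠ u in 𝓝[>] c, T.realValue u ≤ M := by
      intro h1
      apply hcon
      filter_upwards [h1] with u hu
      exact_mod_cast not_le.1 hu
    obtain ⟨v, hv, hvM⟩ := exists_seq_forall_of_frequently
      (hfr.and_eventually (Ioo_mem_nhdsGT hc))
    have hv' : Tendsto v atTop (𝓝 c) := hv.mono_right nhdsWithin_le_nhds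
    apply hcm
    set Q : ℝ → ℝ := fun ξ => min 1 (ξ ^ 2)
    have hnn : ∀ x ξ, 0 ≤ realCompExp x ξ + Q ξ := fun x ξ => by
      linarith [neg_min_le_realCompExp x ξ]
    have hpt : ∀ ξ, Tendsto (fun n => ENNReal.ofReal (realCompExp (v n) ξ + Q ξ)) atTop
        (𝓝 (ENNReal.ofReal (realCompExp c ξ + Q ξ))) := by
      intro ξ
      refine ENNReal.tendsto_ofReal ?_
      have : Continuous fun x => realCompExp x ξ + Q ξ := by unfold realCompExp; fun_prop
      exact (this.tendsto c).comp hv'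
    have hmeas : ∀ n, Measurable fun ξ => ENNReal.ofReal (realCompExp (v n) ξ + Q ξ) := fun n => by
      have := measurable_realCompExp (v n)
      fun_prop
    have hfatou := lintegral_liminf_le (μ := T.m) (u := atTop) hmeas
    simp_rw [fun ξ => (hpt ξ).liminf_eq] at hfatou
    set K := M + ∫ ξ, Q ξ ∂T.m
    have hlim : Tendsto (fun n => K - (T.a / 2 * v n ^ 2 + T.b * v n)) atTop
        (𝓝 (K - (T.a / 2 * c ^ 2 + T.b * c))) := by
      have : Continuous fun x : ℝ => K - (T.a / 2 * x ^ 2 + T.b * x) := by fun_prop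
      exact (this.tendsto c).comp hv'
    have hle : ∀ n, ∫⁻ ξ, ENNReal.ofReal (realCompExp (v n) ξ + Q ξ) ∂T.m
        ≤ ENNReal.ofReal (K - (T.a / 2 * v n ^ 2 + T.b * v n)) := by
      intro n
      have hi := (h (v n) ⟨(hvM n).2.1, (hvM n).2.2.le⟩).integrable_realCompExp (hvM n).2.2.le
      rw [← ofReal_integral_eq_lintegral_ofReal (f := fun ξ => realCompExp (v n) ξ + Q ξ)
        (hi.add integrable_min) (Eventually.of_forall (hnn _))]
      refine ENNReal.ofReal_le_ofReal ?_
      have h1 := (hvM n).1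
      have h2 := integral_add hi (T.integrable_min)
      simp only [realValue] at h1
      simp only [K, Q]
      rw [h2]
      linarith
    have hfin : ∫⁻ ξ, ENNReal.ofReal (realCompExp c ξ + Q ξ) ∂T.m < ∞ := by
      refine lt_of_le_of_lt (hfatou.trans (liminf_le_liminf (Eventually.of_forall hle))) ?_
      rw [(ENNReal.tendsto_ofReal hlim).liminf_eq]
      exact ENNReal.ofReal_lt_top
    have hint : Integrable (fun ξ => realCompExp c ξ + Q ξ) T.m := by
      refine ⟨((measurable_realCompExp c).add (by fun_prop)).aestronglyMeasurable, ?_⟩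
      rw [hasFiniteIntegral_iff_ofReal (Eventually.of_forall (hnn c))]
      exact hfin
    refine hasMoment_of_integrable ((hint.sub integrable_min).congr (Eventually.of_forall fun ξ =>
        ?_))
    simp [Q]

/-- A Lévy-Khintchine exponent with vanishing real part is that of a drift. -/
lemma eq_zero_of_re_eq_zero (h : ∀ u : ℂ, u.re = 0 → (T.exponent u).re = 0) :
    T.a = 0 ∧ T.m = 0 := by
  have hre : ∀ θ ξ : ℝ, (compExp (θ * Complex.I) ξ).re = Real.cos (θ * ξ) - 1 := by
    intro θ ξ
    have e : (θ * Complex.I * (ξ : ℂ)) = ((θ * ξ : ℝ) : ℂ) * Complex.I := by push_cast; ring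
    rw [compExp, e, Complex.sub_re, Complex.sub_re, Complex.exp_ofReal_mul_I_re]
    simp
  have hint : ∀ θ : ℝ, Integrable (fun ξ => Real.cos (θ * ξ) - 1) T.m := by
    intro θ
    have := (T.hasMoment_zero.integrable_compExp (u := θ * Complex.I) (by simp) (by simp)).re
    refine this.congr (Eventually.of_forall fun ξ => ?_)
    simpa using hre θ ξ
  have hval : ∀ θ : ℝ, (T.exponent (θ * Complex.I)).re
      = -(T.a / 2 * θ ^ 2) + ∫ ξ, (Real.cos (θ * ξ) - 1) ∂T.m := by
    intro θ
    have hi := T.hasMoment_zero.integrable_compExp (u := θ * Complex.I) (by simp) (by simp)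
    have h1 : (∫ ξ, compExp (θ * Complex.I) ξ ∂T.m).re = ∫ ξ, (Real.cos (θ * ξ) - 1) ∂T.m := by
      rw [← integral_congr_ae (Eventually.of_forall (hre θ))]
      exact (integral_re hi).symm
    have h2 : ((T.a : ℂ) / 2 * (θ * Complex.I) ^ 2 + (T.b : ℂ) * (θ * Complex.I))
        = ((-(T.a / 2 * θ ^ 2) : ℝ) : ℂ) + ((T.b * θ : ℝ) : ℂ) * Complex.I := by
      rw [mul_pow, Complex.I_sq]; push_cast; ring
    rw [exponent_def, Complex.add_re, h1, h2, Complex.add_re, Complex.ofReal_re,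
      Complex.re_ofReal_mul, Complex.I_re, mul_zero, add_zero]
  have hnp : ∀ θ : ℝ, ∫ ξ, (Real.cos (θ * ξ) - 1) ∂T.m ≤ 0 := fun θ =>
    integral_nonpos fun ξ => by simpa using Real.cos_le_one _
  have hzero : ∀ θ : ℝ, T.a / 2 * θ ^ 2 = 0 ∧ ∫ ξ, (Real.cos (θ * ξ) - 1) ∂T.m = 0 := by
    intro θ
    have h1 := h (θ * Complex.I) (by simp)
    rw [hval] at h1
    have h2 := mul_nonneg (div_nonneg T.a_nonneg zero_le_two) (sq_nonneg θ)
    have h3 := hnp θ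
    constructor <;> linarith
  refine ⟨by linarith [(hzero 1).1], ?_⟩
  -- Equality at all frequencies `1 / (n + 1)` leaves only `ξ = 0`: once `n > |ξ|` the argument lies
  -- in `(-2π, 2π)`, where the cosine equals one only at zero.
  have hae : ∀ n : ℕ, ∀ᵐ ξ ∂T.m, Real.cos (((n : ℝ) + 1)⁻¹ * ξ) = 1 := by
    intro n
    have h1 : ∫ ξ, (1 - Real.cos (((n : ℝ) + 1)⁻¹ * ξ)) ∂T.m = 0 := by
      have := (hzero ((n : ℝ) + 1)⁻¹).2
      rw [← neg_eq_zero, ← integral_neg] at this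
      simpa only [neg_sub] using this
    rw [integral_eq_zero_iff_of_nonneg (fun ξ => by simpa using Real.cos_le_one _)
      ((hint ((n : ℝ) + 1)⁻¹).neg.congr (Eventually.of_forall fun ξ => by simp))] at h1
    filter_upwards [h1] with ξ hξ
    simp only [Pi.zero_apply] at hξ
    linarith
  have h0 : ∀ᵐ ξ ∂T.m, ξ = 0 := by
    filter_upwards [ae_all_iff.2 hae] with ξ hξ
    obtain ⟨n, hn⟩ := exists_nat_gt |ξ|
    have hpos : (0 : ℝ) < (n : ℝ) + 1 := by positivity
    have h1 : |((n : ℝ) + 1)⁻¹ * ξ| < 2 * Real.pi := by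
      rw [abs_mul, abs_of_pos (inv_pos.2 hpos), inv_mul_lt_iff₀ hpos]
      nlinarith [Real.pi_gt_three, abs_nonneg ξ]
    rw [abs_lt] at h1
    have h2 := (Real.cos_eq_one_iff_of_lt_of_lt h1.1 h1.2).1 (hξ n)
    rcases mul_eq_zero.1 h2 with h3 | h3
    · exact absurd h3 (inv_pos.2 hpos).ne'
    · exact h3
  rw [← Measure.measure_univ_eq_zero, ← Set.union_compl_self ({0} : Set ℝ)]
  exact measure_union_null T.m_zero h0

end LevyTriplet

/-! ### Recovering exponents from their exponentials -/

lemma levyExtension_spec {f : ℂ → ℂ} {x : ℝ} (h : levyExtension f x ≠ ⊤) :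
    ∃ T : LevyTriplet, (∀ u : ℂ, u.re = 0 → f u = T.exponent u) ∧
      ∀ y, levyExtension f y = T.realExponent y := by
  by_cases hex : ∃ T : LevyTriplet, ∀ u : ℂ, u.re = 0 → f u = T.exponent u
  · exact ⟨Classical.choose hex, Classical.choose_spec hex, fun y => by
      rw [levyExtension, dif_pos hex]⟩
  -- Without a triplet the extension has the default value `⊤`, which is excluded. Otherwise the
  -- chosen triplet itself is used, so uniqueness plays no role.
  · exact absurd (by rw [levyExtension, dif_neg hex]) h

/-- `exp (x (b - b'))` is constant in the real variable `x`, so its derivative `b - b'` at zero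
vanishes. The constant `a` is determined only modulo `2πi`, which is why `φ` is used through `exp φ`
on the line. -/
lemma eq_of_forall_exp_eq {a b a' b' : ℂ}
    (h : ∀ x : ℝ, Complex.exp (a + x * b) = Complex.exp (a' + x * b')) :
    Complex.exp a = Complex.exp a' ∧ b = b' := by
  have h0 : Complex.exp a = Complex.exp a' := by simpa using h 0
  refine ⟨h0, ?_⟩
  have h1 : ∀ x : ℝ, Complex.exp (x * (b - b')) = 1 := by
    intro x
    have := h x
    rw [Complex.exp_add, Complex.exp_add, h0] at this
    have := mul_left_cancel₀ (Complex.exp_ne_zero _) this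
    rw [mul_sub, Complex.exp_sub, this, div_self (Complex.exp_ne_zero _)]
  have h2 : HasDerivAt (fun x : ℝ => Complex.exp (x * (b - b'))) (b - b') 0 := by
    have := ((Complex.ofRealCLM.hasDerivAt (x := 0)).mul_const (b - b')).cexp
    simpa using this
  have h3 : HasDerivAt (fun x : ℝ => Complex.exp (x * (b - b'))) 0 0 := by
    simp_rw [h1]
    exact hasDerivAt_const _ _
  exact sub_eq_zero.1 (h2.unique h3)

/-- Integration over `x` against a Gaussian weight turns the hypothesis into `exp (-z² / 2) → 1`.
Using all frequencies at once removes the ambiguity modulo `2π`. -/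
lemma tendsto_zero_of_tendsto_exp {α : Type*} {l : Filter α} [l.IsCountablyGenerated] {z : α → ℝ}
    (h : ∀ x : ℝ, Tendsto (fun a => Complex.exp (x * Complex.I * z a)) l (𝓝 1)) :
    Tendsto z l (𝓝 0) := by
  set w : ℝ → ℝ := fun y => Real.exp (-(y ^ 2) / (2 * 1)) with hw
  have hwi : Integrable w := by
    have := integrable_exp_neg_mul_sq (b := 1 / 2) (by norm_num)
    refine this.congr (Eventually.of_forall fun y => ?_)
    simp only [hw]; congr 1; ring
  set K : ℝ := ∫ y, w y with hK
  have hK0 : 0 < K := integral_exp_pos hwi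
  have h1 : Tendsto (fun a => ∫ y : ℝ, Complex.exp (y * Complex.I * z a) * (w y : ℝ)) l
      (𝓝 (∫ y : ℝ, 1 * ((w y : ℝ) : ℂ))) := by
    refine tendsto_integral_filter_of_dominated_convergence w
      (Eventually.of_forall fun a => ?_) (Eventually.of_forall fun a => Eventually.of_forall fun y
          => ?_)
      hwi (Eventually.of_forall fun y => (h y).mul_const _)
    · refine Continuous.aestronglyMeasurable ?_
      simp only [hw]
      fun_prop
    · have e : (y : ℂ) * Complex.I * z a = ((y * z a : ℝ) : ℂ) * Complex.I := by push_cast; ring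
      rw [norm_mul, e, Complex.norm_exp_ofReal_mul_I, one_mul, Complex.norm_real,
        Real.norm_of_nonneg (Real.exp_pos _).le]
  simp_rw [hw, fun a => integral_fourier_gaussian one_pos (z a), one_mul] at h1
  rw [integral_complex_ofReal] at h1
  have h2 := (Complex.continuous_re.tendsto _).comp h1
  simp only [Function.comp_def, Complex.re_ofReal_mul, Complex.ofReal_re] at h2
  have e1 : (∫ y : ℝ, Real.exp (-(y ^ 2) / (2 * 1))) = K := rfl
  rw [e1] at h2
  have h3 : Tendsto (fun a => Real.exp (-((z a) ^ 2 / 2))) l (𝓝 1) := by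
    have := h2.const_mul K⁻¹
    rw [inv_mul_cancel₀ hK0.ne'] at this
    refine this.congr fun a => ?_
    rw [inv_mul_cancel_left₀ hK0.ne']
  have h4 := (Real.continuousAt_log one_ne_zero).tendsto.comp h3
  simp only [Function.comp_def, Real.log_exp, Real.log_one] at h4
  have h5 : Tendsto (fun a => |z a|) l (𝓝 0) := by
    have h6 : Tendsto (fun a => Real.sqrt (-2 * -((z a) ^ 2 / 2))) l (𝓝 (Real.sqrt (-2 * 0))) :=
      (Real.continuous_sqrt.tendsto _).comp (h4.const_mul (-2))
    simp only [mul_zero, Real.sqrt_zero] at h6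
    refine h6.congr fun a => ?_
    rw [← Real.sqrt_sq_eq_abs]
    congr 1; ring
  exact (tendsto_zero_iff_abs_tendsto_zero _).2 h5

/-- With the flow property it transports right derivatives at time zero to every time. -/
lemma hasDerivWithinAt_of_shift {f g : ℝ → ℂ} {g' : ℂ} {t : ℝ} (h : HasDerivWithinAt g g' (Ici 0) 0)
    (hfg : ∀ s, t ≤ s → f s = g (s - t)) : HasDerivWithinAt f g' (Ici t) t := by
  have h1 : HasDerivWithinAt (fun s : ℝ => s - t) 1 (Ici t) t :=
    ((hasDerivAt_id t).sub_const t).hasDerivWithinAt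
  have h2 : HasDerivWithinAt (g ∘ fun s : ℝ => s - t) ((1 : ℝ) • g') (Ici t) t :=
    HasDerivWithinAt.scomp (t' := Ici 0) t (by rw [sub_self]; exact h) h1 fun s hs => sub_nonneg.2
        hs
  rw [one_smul] at h2
  exact h2.congr (fun s hs => hfg s hs) (hfg t le_rfl)

/-! ### Real line: linearity of `R` and the flow of exponents -/

namespace AffineProcess

section Line

variable {Ω : Type*} [MeasurableSpace Ω] (X : AffineProcess StateSpace.line Ω)

/-- A real number as a point of the state space. -/
def linePt (x : ℝ) : StateSpace.line.carrier := ⟨x, mem_univ x⟩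

lemma line_affine {u : ℂ} (hu : u.re = 0) (t : ℝ≥0) (x : ℝ) :
    ∫ ω, Complex.exp (u * ((X.r t ω : ℝ) : ℂ)) ∂(X.P (linePt x))
      = Complex.exp (X.φ t u + x * X.ψ t u) := X.affine (linePt x) t u hu

/-- The characteristic function has modulus at most one from every real starting point, and an
affine function of `x ∈ ℝ` that is bounded above is constant. -/
lemma re_ψ_eq_zero {u : ℂ} (hu : u.re = 0) (t : ℝ≥0) : (X.ψ t u).re = 0 := by
  have h : ∀ x : ℝ, (X.φ t u).re + x * (X.ψ t u).re ≤ 0 := by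
    intro x
    have h1 : ‖∫ ω, Complex.exp (u * ((X.r t ω : ℝ) : ℂ)) ∂(X.P (linePt x))‖ ≤ 1 := by
      refine (norm_integral_le_of_norm_le_const (C := 1) (Eventually.of_forall fun ω => ?_)).trans
          ?_
      · exact StateSpace.norm_exp_le_one (D := StateSpace.line) hu (X.r t ω).2
      · simp
    rw [X.line_affine hu, Complex.norm_exp, Real.exp_le_one_iff] at h1
    simpa using h1
  by_contra hne
  have := h ((1 - (X.φ t u).re) / (X.ψ t u).re)
  rw [div_mul_cancel₀ _ hne] at this
  linarith

lemma line_initial {u : ℂ} (hu : u.re = 0) : Complex.exp (X.φ 0 u) = 1 ∧ X.ψ 0 u = u := by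
  have h : ∀ x : ℝ, Complex.exp (X.φ 0 u + x * X.ψ 0 u) = Complex.exp (0 + x * u) := by
    intro x
    have h1 := X.line_affine hu 0 x
    rw [NNReal.coe_zero] at h1
    rw [← h1]
    have h2 : ∀ᵐ ω ∂(X.P (linePt x)), Complex.exp (u * ((X.r 0 ω : ℝ) : ℂ))
        = Complex.exp (0 + x * u) := by
      filter_upwards [X.start (linePt x)] with ω hω
      rw [hω, zero_add, mul_comm]; rfl
    rw [integral_congr_ae h2]
    simp
  simpa using eq_of_forall_exp_eq h

lemma re_R_eq_zero {u : ℂ} (hu : u.re = 0) : (X.R u).re = 0 := by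
  have h1 : HasDerivWithinAt (fun t : ℝ => (X.ψ t u).re) (X.R u).re (Ici 0) 0 :=
    Complex.reCLM.hasFDerivAt.comp_hasDerivWithinAt (0 : ℝ) (X.hasDeriv_ψ u hu)
  have h2 : HasDerivWithinAt (fun t : ℝ => (X.ψ t u).re) 0 (Ici 0) 0 :=
    (hasDerivWithinAt_const (0 : ℝ) (Ici 0) (0 : ℝ)).congr
      (fun t ht => X.re_ψ_eq_zero hu ⟨t, ht⟩) (X.re_ψ_eq_zero hu 0)
  exact (uniqueDiffOn_Ici (0 : ℝ) 0 self_mem_Ici).eq_deriv _ h1 h2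

/-- On the real line `R` is linear. -/
lemma exists_R_eq {x : ℝ} (h : X.realR x ≠ ⊤) :
    ∃ β : ℝ, (∀ u : ℂ, u.re = 0 → X.R u = β * u) ∧ ∀ y : ℝ, X.realR y = ((β * y : ℝ) : EReal) := by
  obtain ⟨T, hT, hT2⟩ := levyExtension_spec h
  obtain ⟨ha, hm⟩ := T.eq_zero_of_re_eq_zero fun u hu => by rw [← hT u hu, X.re_R_eq_zero hu]
  exact ⟨T.b, fun u hu => by rw [hT u hu, T.exponent_eq_linear ha hm],
    fun y => by rw [← T.realExponent_eq_linear ha hm]; exact hT2 y⟩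

/-- The Chapman-Kolmogorov equation, read off as an identity of exponentials affine in the starting
point. -/
lemma line_flow {u : ℂ} (hu : u.re = 0) (s t : ℝ≥0) :
    Complex.exp (X.φ (s + t : ℝ≥0) u) = Complex.exp (X.φ t u) * Complex.exp (X.φ s (X.ψ t u)) ∧
      X.ψ (s + t : ℝ≥0) u = X.ψ s (X.ψ t u) := by
  have hv := X.re_ψ_eq_zero hu t
  rw [← Complex.exp_add]
  refine eq_of_forall_exp_eq fun x => ?_
  have h1 := X.integral_mul_eq (linePt x) s t (Z := fun _ => 1) measurable_const (C := 1)
    (by simp) (f := fun y => Complex.exp (u * ((y : ℝ) : ℂ))) (by fun_prop) (C' := 1)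
    (fun y => StateSpace.norm_exp_le_one (D := StateSpace.line) hu y.2)
  simp only [one_mul] at h1
  rw [X.line_affine hu] at h1
  rw [h1]
  have h2 : ∀ y : StateSpace.line.carrier, ∫ ω', Complex.exp (u * ((X.r t ω' : ℝ) : ℂ)) ∂(X.P y)
      = Complex.exp (X.φ t u) * Complex.exp (X.ψ t u * ((y : ℝ) : ℂ)) := by
    intro y
    rw [X.affine y t u hu, Complex.exp_add, mul_comm ((y : ℝ) : ℂ)]
  simp_rw [h2]
  rw [integral_const_mul, X.line_affine hv, ← Complex.exp_add, add_assoc]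

lemma continuous_charFun {u : ℂ} (hu : u.re = 0) (x : ℝ) :
    Continuous fun t : ℝ≥0 => Complex.exp (X.φ t u + x * X.ψ t u) := by
  have hu' : ∀ y : ℝ, u * (y : ℂ) = ((u.im * y : ℝ) : ℂ) * Complex.I := by
    intro y
    apply Complex.ext <;> simp [hu]
  have hf : ∀ f : ℝ → ℝ, Continuous f → (∀ y, |f y| ≤ 1) →
      Continuous fun t : ℝ≥0 => ∫ ω, f (u.im * X.r t ω) ∂(X.P (linePt x)) := by
    intro f hfc hfb
    refine continuous_iff_continuousAt.2 fun t => ?_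
    exact X.stochasticallyContinuous (linePt x) t
      (BoundedContinuousFunction.ofNormedAddCommGroup (fun y => f (u.im * (y : ℝ)))
        (by fun_prop) 1 fun y => hfb _)
  have h1 := hf Real.cos Real.continuous_cos Real.abs_cos_le_one
  have h2 := hf Real.sin Real.continuous_sin Real.abs_sin_le_one
  have h3 : Continuous fun t : ℝ≥0 => ((∫ ω, Real.cos (u.im * X.r t ω) ∂(X.P (linePt x)) : ℝ) : ℂ)
      + ((∫ ω, Real.sin (u.im * X.r t ω) ∂(X.P (linePt x)) : ℝ) : ℂ) * Complex.I := by fun_prop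
  refine h3.congr fun t => ?_
  rw [← X.line_affine hu, ← integral_complex_ofReal, ← integral_complex_ofReal,
    ← integral_mul_const, ← integral_add]
  · congr 1; ext ω
    rw [hu', Complex.exp_mul_I, Complex.ofReal_cos, Complex.ofReal_sin]
  · have hm := X.measurable_coe_r t
    refine Integrable.of_bound (C := 1) (by fun_prop : Measurable fun ω =>
      ((Real.cos (u.im * X.r t ω) : ℝ) : ℂ)).aestronglyMeasurable (Eventually.of_forall fun ω => ?_)
    rw [Complex.norm_real]
    exact Real.abs_cos_le_one _
  · have hm := X.measurable_coe_r t
    refine Integrable.of_bound (C := 1) (by fun_prop : Measurable fun ω =>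
      ((Real.sin (u.im * X.r t ω) : ℝ) : ℂ) * Complex.I).aestronglyMeasurable
      (Eventually.of_forall fun ω => ?_)
    rw [norm_mul, Complex.norm_real, Complex.norm_I, mul_one]
    exact Real.abs_sin_le_one _

/-- The quotient of the characteristic functions started at `x` and at `0` is `exp (x ψ)`;
continuity of all these exponentials gives that of `ψ`. -/
lemma continuous_ψ {u : ℂ} (hu : u.re = 0) : Continuous fun t : ℝ≥0 => X.ψ t u := by
  have hψ : ∀ t : ℝ≥0, X.ψ t u = ((X.ψ t u).im : ℂ) * Complex.I := fun t => by
    apply Complex.ext <;> simp [X.re_ψ_eq_zero hu t]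
  have him : Continuous fun t : ℝ≥0 => (X.ψ t u).im := by
    refine continuous_iff_continuousAt.2 fun t₀ => ?_
    have hz : Tendsto (fun t : ℝ≥0 => (X.ψ t u).im - (X.ψ t₀ u).im) (𝓝 t₀) (𝓝 0) := by
      refine tendsto_zero_of_tendsto_exp fun x => ?_
      have h1 : Continuous fun t : ℝ≥0 => Complex.exp (x * X.ψ t u) := by
        have := (X.continuous_charFun hu x).div (X.continuous_charFun hu 0)
          fun t => Complex.exp_ne_zero _
        refine this.congr fun t => ?_
        simp only [Pi.div_apply, Complex.ofReal_zero, zero_mul, add_zero]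
        rw [Complex.exp_add, mul_div_cancel_left₀ _ (Complex.exp_ne_zero _)]
      have h2 : Tendsto (fun t : ℝ≥0 => Complex.exp (x * X.ψ t u) / Complex.exp (x * X.ψ t₀ u))
          (𝓝 t₀) (𝓝 1) := by
        have := (h1.tendsto t₀).div_const (Complex.exp (x * X.ψ t₀ u))
        rwa [div_self (Complex.exp_ne_zero _)] at this
      refine h2.congr fun t => ?_
      rw [← Complex.exp_sub]
      congr 1
      conv_lhs => rw [hψ t, hψ t₀]
      push_cast; ring
    have := hz.add_const (X.ψ t₀ u).im
    simpa [ContinuousAt] using this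
  have : Continuous fun t : ℝ≥0 => ((X.ψ t u).im : ℂ) * Complex.I := by fun_prop
  exact this.congr fun t => (hψ t).symm

/-- By the flow property the right derivative of `ψ` at any time is `β ψ`, so `exp (-β s) ψ` is
continuous with zero right derivative, hence constant. -/
lemma ψ_eq {β : ℝ} (hβ : ∀ u : ℂ, u.re = 0 → X.R u = β * u) {u : ℂ} (hu : u.re = 0) (t : ℝ≥0) :
    X.ψ t u = Complex.exp (β * (t : ℝ)) * u := by
  let g : ℝ → ℂ := fun s => Complex.exp (-(β * s : ℝ)) * X.ψ (s.toNNReal : ℝ) u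
  have hg : ContinuousOn g (Icc 0 t) := by
    have h1 : Continuous fun s : ℝ => X.ψ (s.toNNReal : ℝ) u :=
      (X.continuous_ψ hu).comp continuous_real_toNNReal
    have h2 : Continuous fun s : ℝ => Complex.exp (-(β * s : ℝ)) := by fun_prop
    exact (h2.mul h1).continuousOn
  have hd : ∀ s ∈ Ico 0 (t : ℝ), HasDerivWithinAt g 0 (Ici s) s := by
    intro s hs
    have hv := X.re_ψ_eq_zero hu s.toNNReal
    have h1 := hasDerivWithinAt_of_shift (f := fun s : ℝ => X.ψ (s.toNNReal : ℝ) u) (t := s)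
      (X.hasDeriv_ψ _ hv) fun r hr => by
        have h2 := (X.line_flow hu (r - s).toNNReal s.toNNReal).2
        rw [← Real.toNNReal_add (sub_nonneg.2 hr) hs.1, sub_add_cancel,
          Real.coe_toNNReal (r - s) (sub_nonneg.2 hr)] at h2
        exact h2
    rw [hβ _ hv] at h1
    have h2 : HasDerivAt (fun s : ℝ => Complex.exp (-(β * s : ℝ)))
        (Complex.exp (-(β * s : ℝ)) * -β) s := by
      have h3 : HasDerivAt (fun s : ℝ => -((β * s : ℝ) : ℂ)) (-β) s := by
        have := ((hasDerivAt_id s).const_mul β).ofReal_comp.neg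
        rw [mul_one] at this
        exact this
      exact h3.cexp
    have h4 := h2.hasDerivWithinAt.mul h1
    refine h4.congr_deriv ?_
    ring
  have h := constant_of_has_deriv_right_zero hg hd t ⟨t.2, le_rfl⟩
  simp only [g, Real.toNNReal_coe, Real.toNNReal_zero, NNReal.coe_zero, (X.line_initial hu).2,
    mul_zero, Complex.ofReal_zero, neg_zero, Complex.exp_zero, one_mul] at h
  conv_rhs => rw [← h, ← mul_assoc, ← Complex.exp_add]
  simp

lemma exp_φ_eq {β : ℝ} (hβ : ∀ u : ℂ, u.re = 0 → X.R u = β * u)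
    (hF : Continuous fun θ : ℝ => X.F (θ * Complex.I)) (θ : ℝ) (t : ℝ≥0) :
        Complex.exp (X.φ t (θ * Complex.I))
    = Complex.exp (∫ s in (0 : ℝ)..t, X.F ((Real.exp (β * s) * θ : ℝ) * Complex.I)) := by
  have hu : (θ * Complex.I).re = 0 := by simp
  set k : ℝ → ℂ := fun s => X.F ((Real.exp (β * s) * θ : ℝ) * Complex.I) with hk
  have hkc : Continuous k := hF.comp (by fun_prop : Continuous fun s : ℝ => Real.exp (β * s) * θ)
  have hkd : ∀ s, HasDerivAt (fun s => ∫ r in (0 : ℝ)..s, k r) (k s) s := fun s =>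
    hkc.integral_hasStrictDerivAt 0 s |>.hasDerivAt
  let p : ℝ → ℂ := fun s => Complex.exp (X.φ (s.toNNReal : ℝ) (θ * Complex.I))
  let g : ℝ → ℂ := fun s => p s * Complex.exp (-∫ r in (0 : ℝ)..s, k r)
  have hpc : Continuous p := by
    have := X.continuous_charFun hu 0
    simp only [Complex.ofReal_zero, zero_mul, add_zero] at this
    exact this.comp continuous_real_toNNReal
  have hg : ContinuousOn g (Icc 0 t) := by
    have h2 : Continuous fun s => ∫ r in (0 : ℝ)..s, k r :=
      continuous_iff_continuousAt.2 fun s => (hkd s).continuousAt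
    exact (hpc.mul (Complex.continuous_exp.comp h2.neg)).continuousOn
  have hd : ∀ s ∈ Ico 0 (t : ℝ), HasDerivWithinAt g 0 (Ici s) s := by
    intro s hs
    have hv := X.re_ψ_eq_zero hu s.toNNReal
    have h0 := (X.hasDeriv_φ _ hv).cexp.const_mul (p s)
    rw [(X.line_initial hv).1, one_mul] at h0
    have h1 := hasDerivWithinAt_of_shift (f := p) (t := s) h0 fun r hr => by
        have h2 := (X.line_flow hu (r - s).toNNReal s.toNNReal).1
        rw [← Real.toNNReal_add (sub_nonneg.2 hr) hs.1, sub_add_cancel,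
          Real.coe_toNNReal (r - s) (sub_nonneg.2 hr)] at h2
        exact h2
    have hks : X.F (X.ψ (s.toNNReal : ℝ) (θ * Complex.I)) = k s := by
      rw [X.ψ_eq hβ hu, Real.coe_toNNReal _ hs.1, hk]
      congr 1
      push_cast; ring
    rw [hks] at h1
    have h4 := h1.mul (hkd s).neg.cexp.hasDerivWithinAt
    refine h4.congr_deriv ?_
    ring
  have h := constant_of_has_deriv_right_zero hg hd t ⟨t.2, le_rfl⟩
  simp only [g, p, Real.toNNReal_coe, Real.toNNReal_zero, NNReal.coe_zero, (X.line_initial hu).1,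
    intervalIntegral.integral_same, neg_zero, Complex.exp_zero, mul_one] at h
  rw [Complex.exp_neg, mul_inv_eq_one₀ (Complex.exp_ne_zero _)] at h
  exact h

end Line

end AffineProcess

/-! ### Real line: the characteristic function of the time integral -/

/-- The frequencies that appear in the iteration of the one-step exponents. -/
noncomputable def stepFreq (β θ δ : ℝ) (k : ℕ) : ℝ :=
  θ * (δ * ∑ j ∈ Finset.range (k + 1), Real.exp (β * δ) ^ j)

lemma stepFreq_succ (β θ δ : ℝ) (k : ℕ) :
    stepFreq β θ δ (k + 1) = Real.exp (β * δ) * stepFreq β θ δ k + θ * δ := by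
  rw [stepFreq, geom_sum_succ, stepFreq]; ring

lemma abs_stepFreq_le {β θ δ : ℝ} (hβ : β ≤ 0) (hδ : 0 ≤ δ) (k : ℕ) :
    |stepFreq β θ δ k| ≤ |θ| * (δ * (k + 1)) := by
  rw [stepFreq, abs_mul]
  have h1 : ∑ j ∈ Finset.range (k + 1), Real.exp (β * δ) ^ j ≤ ∑ j ∈ Finset.range (k + 1),
      (1 : ℝ) :=
    Finset.sum_le_sum fun j _ => pow_le_one₀ (Real.exp_pos _).le
      (Real.exp_le_one_iff.2 (mul_nonpos_of_nonpos_of_nonneg hβ hδ))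
  have h2 : 0 ≤ ∑ j ∈ Finset.range (k + 1), Real.exp (β * δ) ^ j := by positivity
  rw [abs_of_nonneg (mul_nonneg hδ h2)]
  simp only [Finset.sum_const, Finset.card_range, nsmul_eq_mul, mul_one, Nat.cast_add,
    Nat.cast_one] at h1
  gcongr

lemma tendsto_stepFreq {β : ℝ} (hβ : β < 0) (θ : ℝ) {s T : ℝ} (hT : 0 < T) (hs : 0 ≤ s) :
    Tendsto (fun n : ℕ => stepFreq β θ (T / n) ⌊s / (T / n)⌋₊) atTop
      (𝓝 (θ * ((Real.exp (β * s) - 1) / β))) := by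
  have hδ0 : Tendsto (fun n : ℕ => T / (n : ℝ)) atTop (𝓝 0) :=
      tendsto_const_div_atTop_nhds_zero_nat T
  have hδ : Tendsto (fun n : ℕ => T / (n : ℝ)) atTop (𝓝[≠] 0) := tendsto_nhdsWithin_iff.2
    ⟨hδ0, by
      filter_upwards [eventually_gt_atTop 0] with n hn
      have : (0 : ℝ) < n := by exact_mod_cast hn
      exact (div_pos hT this).ne'⟩
  have h1 : HasDerivAt (fun δ : ℝ => Real.exp (β * δ)) β 0 := by
    have := ((hasDerivAt_id (0 : ℝ)).const_mul β).exp
    simpa using this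
  have h2 := ((hasDerivAt_iff_tendsto_slope.1 h1).comp hδ).inv₀ hβ.ne
  have h3 := ((tendsto_floor_mul hT hs).add hδ0).const_mul β
  rw [add_zero] at h3
  have h4 := (Real.continuous_exp.tendsto _).comp h3
  have h5 := ((h4.sub_const 1).mul h2).const_mul θ
  rw [div_eq_mul_inv]
  refine h5.congr' ?_
  filter_upwards [eventually_gt_atTop 0] with n hn
  have hn' : (0 : ℝ) < n := by exact_mod_cast hn
  have hpos : 0 < T / (n : ℝ) := div_pos hT hn'
  have hq : Real.exp (β * (T / n)) ≠ 1 := by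
    rw [Ne, Real.exp_eq_one_iff]
    exact mul_ne_zero hβ.ne hpos.ne'
  rw [stepFreq, geom_sum_eq hq, ← Real.exp_nat_mul]
  simp only [Function.comp_apply, slope_def_field, mul_zero, Real.exp_zero, sub_zero, inv_div]
  have e : ((⌊s / (T / n)⌋₊ + 1 : ℕ) : ℝ) * (β * (T / n))
      = β * (⌊s / (T / n)⌋₊ * (T / n) + T / n) := by push_cast; ring
  rw [e]
  ring

namespace AffineProcess

section LineIntegral

variable {Ω : Type*} [MeasurableSpace Ω] (X : AffineProcess StateSpace.line Ω)

/-- The average of `F` along the flow over a time interval of length `δ`. -/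
noncomputable def flowAverage (β δ θ : ℝ) : ℂ :=
  ∫ s in (0 : ℝ)..1, X.F ((Real.exp (β * (δ * s)) * θ : ℝ) * Complex.I)

/-- Averaging over the fixed interval `[0, 1]` keeps the rescaled one-step exponent jointly
continuous down to `δ = 0`, as the passage to the limit in the Riemann sums requires. -/
lemma continuous_flowAverage (β : ℝ) (hF : Continuous fun θ : ℝ => X.F (θ * Complex.I)) :
    Continuous fun p : ℝ × ℝ => X.flowAverage β p.1 p.2 := by
  refine intervalIntegral.continuous_parametric_intervalIntegral_of_continuous'
    (f := fun (p : ℝ × ℝ) s => X.F ((Real.exp (β * (p.1 * s)) * p.2 : ℝ) * Complex.I)) ?_ 0 1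
  exact hF.comp (by fun_prop : Continuous fun q : (ℝ × ℝ) × ℝ => Real.exp (β * (q.1.1 * q.2)) *
      q.1.2)

lemma flowAverage_zero (β θ : ℝ) : X.flowAverage β 0 θ = X.F (θ * Complex.I) := by
  simp [flowAverage]

lemma mul_flowAverage (β δ θ : ℝ) : (δ : ℂ) * X.flowAverage β δ θ
    = ∫ s in (0 : ℝ)..δ, X.F ((Real.exp (β * s) * θ : ℝ) * Complex.I) := by
  have := intervalIntegral.smul_integral_comp_mul_left (a := 0) (b := 1)
    (fun s => X.F ((Real.exp (β * s) * θ : ℝ) * Complex.I)) δ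
  rw [mul_zero, mul_one, Complex.real_smul] at this
  exact this

lemma charFun_riemann_sum {β : ℝ} (hβ : ∀ u : ℂ, u.re = 0 → X.R u = β * u)
    (hF : Continuous fun θ : ℝ => X.F (θ * Complex.I)) (θ : ℝ) (δ : ℝ≥0) (n : ℕ)
    (x : StateSpace.line.carrier) :
    ∫ ω, Complex.exp (θ * Complex.I * (δ : ℝ) * ((∑ k ∈ Finset.range n,
        (X.r (((k + 1 : ℕ) : ℝ≥0) * δ) ω : ℝ) : ℝ) : ℂ)) ∂(X.P x)
      = Complex.exp (∑ k ∈ Finset.range n, (δ : ℝ) • X.flowAverage β δ (stepFreq β θ δ k)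
        + x * ((stepFreq β θ δ n - θ * δ : ℝ) * Complex.I)) := by
  have himag : ∀ {v : ℂ}, v.re = 0 → v = v.im * Complex.I := fun {v} hv => by
    apply Complex.ext <;> simp [hv]
  set w : ℂ := θ * Complex.I * (δ : ℝ) with hw
  have hwre : w.re = 0 := by simp [hw]
  have key := X.integral_exp_sum (V := {v : ℂ | v.re = 0})
    (φ := fun v => (δ : ℝ) • X.flowAverage β δ v.im) (ψ := fun v => Complex.exp (β * (δ : ℝ)) * v)
    (δ := δ) (w := w) (fun v hv => hv) hwre ?_ ?_ ?_ x n 0 (by simp)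
  -- `stepFreq` at `k` has `k + 1` summands: it is the iterate after adding `w`, where the one-step
  -- exponent is evaluated. The terminal frequency therefore lacks `θ * δ`.
  · have hit : ∀ k, (fun v : ℂ => Complex.exp (β * (δ : ℝ)) * (v + w))^[k] 0
        = (stepFreq β θ δ k - θ * δ : ℝ) * Complex.I := by
      intro k
      induction k with
      | zero => simp [stepFreq]
      | succ k ih =>
        rw [Function.iterate_succ_apply', ih, stepFreq_succ, hw]
        push_cast; ring
    have hadd : ∀ k, ((stepFreq β θ δ k - θ * δ : ℝ) * Complex.I + w)
        = stepFreq β θ δ k * Complex.I := by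
      intro k
      rw [hw]; push_cast; ring
    simp only [hit, hadd, zero_mul, add_zero] at key
    rw [key]
    simp
  · intro v hv y
    rw [X.affine y δ v hv, X.ψ_eq hβ hv, Complex.exp_add, Complex.exp_add]
    congr 1
    conv_lhs => rw [himag hv]
    rw [X.exp_φ_eq hβ hF, ← mul_flowAverage, Complex.real_smul]
  · intro v hv
    have e : Complex.exp (β * (δ : ℝ)) = ((Real.exp (β * δ) : ℝ) : ℂ) := by push_cast; rfl
    simp only [mem_ofPred_eq] at hv ⊢
    rw [e, Complex.re_ofReal_mul, hv, mul_zero]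
  · intro v hv
    simp only [mem_ofPred_eq] at hv ⊢
    rw [Complex.add_re, hv, hwre, add_zero]

/-- The characteristic function of the time integral of the short rate. -/
lemma charFun_integral {β : ℝ} (hβ0 : β < 0) (hβ : ∀ u : ℂ, u.re = 0 → X.R u = β * u)
    (hF : Continuous fun θ : ℝ => X.F (θ * Complex.I)) {T : ℝ} (hT : 0 < T) (θ : ℝ)
    (x : StateSpace.line.carrier) :
    ∫ ω, Complex.exp (θ * Complex.I * ((∫ s in (0 : ℝ)..T, (X.r s.toNNReal ω : ℝ) : ℝ) : ℂ))
        ∂(X.P x)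
      = Complex.exp ((∫ s in (0 : ℝ)..T, X.F ((θ * ((Real.exp (β * s) - 1) / β) : ℝ) * Complex.I))
        + x * ((θ * ((Real.exp (β * T) - 1) / β) : ℝ) * Complex.I)) := by
  have h1 := X.tendsto_integral_exp_riemann x (w := θ * Complex.I)
    (show (θ * Complex.I).re = 0 by simp) hT.le le_rfl hT
  have hfl : ∀ n : ℕ, 0 < n → ⌊T / (T / n)⌋₊ = n := by
    intro n hn
    have : T / (T / n) = n := by field_simp
    rw [this, Nat.floor_natCast]
  have hδ : ∀ n : ℕ, ((T / n).toNNReal : ℝ) = T / n := fun n => Real.coe_toNNReal _ (by positivity)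
  have hδ0 : Tendsto (fun n : ℕ => T / (n : ℝ)) atTop (𝓝 0) :=
      tendsto_const_div_atTop_nhds_zero_nat T
  have hcont := X.continuous_flowAverage β hF
  -- For `k < n` the frequencies are at most `|θ| δ (k + 1) ≤ |θ| T`, so all arguments stay in a
  -- compact rectangle.
  obtain ⟨C, hC⟩ := (isCompact_Icc (a := (0 : ℝ)) (b := T)).prod
    (isCompact_Icc (a := -(|θ| * T)) (b := |θ| * T)) |>.exists_bound_of_continuousOn
        hcont.continuousOn
  obtain ⟨-, h2⟩ := tendsto_step_sum
    (fun n k => X.flowAverage β (T / n) (stepFreq β θ (T / n) k))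
    (fun s => X.F ((θ * ((Real.exp (β * s) - 1) / β) : ℝ) * Complex.I)) (C := C) hT
    (by
      filter_upwards [eventually_gt_atTop 0] with n hn k hk
      have hn' : (1 : ℝ) ≤ n := by exact_mod_cast hn
      refine hC (T / n, stepFreq β θ (T / n) k) ⟨⟨by positivity, div_le_self hT.le hn'⟩, ?_⟩
      refine abs_le.1 ((abs_stepFreq_le hβ0.le (by positivity) k).trans ?_)
      have hk' : (k : ℝ) + 1 ≤ n := by exact_mod_cast hk
      refine mul_le_mul_of_nonneg_left ?_ (abs_nonneg θ)
      calc T / n * (k + 1) ≤ T / n * n := by gcongr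
        _ = T := by field_simp)
    (fun s hs => by
      have h3 := (hcont.tendsto (0, θ * ((Real.exp (β * s) - 1) / β))).comp
        (hδ0.prodMk_nhds (tendsto_stepFreq hβ0 θ hT hs.1.le))
      simp only [flowAverage_zero] at h3
      exact h3)
  have h3 : Tendsto (fun n : ℕ => stepFreq β θ (T / n) n - θ * (T / n)) atTop
      (𝓝 (θ * ((Real.exp (β * T) - 1) / β))) := by
    have h4 := (tendsto_stepFreq hβ0 θ hT hT.le).sub (hδ0.const_mul θ)
    rw [mul_zero, sub_zero] at h4
    refine h4.congr' ?_
    filter_upwards [eventually_gt_atTop 0] with n hn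
    rw [hfl n hn]
  have h4 := ((Complex.continuous_ofReal.tendsto _).comp h3).mul_const Complex.I
  have h5 := (Complex.continuous_exp.tendsto _).comp (h2.add (h4.const_mul ((x : ℝ) : ℂ)))
  refine tendsto_nhds_unique h1 (h5.congr' ?_)
  filter_upwards [eventually_gt_atTop 0] with n hn
  have h6 := X.charFun_riemann_sum hβ hF θ (T / n).toNNReal n x
  rw [hδ] at h6
  rw [hfl n hn]
  simp only [Function.comp_apply]
  exact h6.symm

end LineIntegral

end AffineProcess

/-! ### Analytic continuation of integrated exponents -/

/-- The projection of the complex plane onto the strip `x₀ ≤ Re u ≤ 0`. -/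
noncomputable def clamp (x₀ : ℝ) (u : ℂ) : ℂ := (max x₀ (min 0 u.re) : ℝ) + u.im * Complex.I

lemma continuous_clamp (x₀ : ℝ) : Continuous (clamp x₀) := by
  have h1 := Complex.continuous_re
  have h2 := Complex.continuous_im
  unfold clamp
  fun_prop

lemma clamp_mem {x₀ : ℝ} (h : x₀ ≤ 0) (u : ℂ) : (clamp x₀ u).re ∈ Icc x₀ 0 := by
  simp [clamp, h]

lemma clamp_of_mem {x₀ : ℝ} {u : ℂ} (h : u.re ∈ Icc x₀ 0) : clamp x₀ u = u := by
  rw [clamp, min_eq_right h.2, max_eq_right h.1, Complex.re_add_im]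

section StripIntegral

variable {E : ℂ → ℂ} {x₀ T : ℝ} {b : ℝ → ℝ}

lemma re_mul_mem {u : ℂ} (hu : u ∈ strip) {t : ℝ} (ht : t ∈ Icc 0 (-x₀)) :
    (u * (t : ℂ)).re ∈ Icc x₀ 0 := by
  have e : (u * (t : ℂ)).re = u.re * t := by simp
  rw [e]
  obtain ⟨h1, h2⟩ := hu
  obtain ⟨h3, h4⟩ := ht
  constructor <;> nlinarith

lemma integral_clamp (hT : 0 ≤ T) (hbm : ∀ s ∈ Icc 0 T, b s ∈ Icc 0 (-x₀)) {u : ℂ}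
    (hu : u ∈ strip) :
    ∫ s in (0 : ℝ)..T, E (u * (b s : ℂ)) = ∫ s in (0 : ℝ)..T, E (clamp x₀ (u * (b s : ℂ))) := by
  refine intervalIntegral.integral_congr fun s hs => ?_
  rw [uIcc_of_le hT] at hs
  simp only [clamp_of_mem (re_mul_mem hu (hbm s hs))]

/-- Clamping extends `E` continuously to the whole plane, where theorems on continuous integrands
apply, without changing it on the strip. -/
lemma continuous_comp_clamp (hx₀ : x₀ ≤ 0) (hE : ContinuousOn E {u | u.re ∈ Icc x₀ 0}) :
    Continuous fun u => E (clamp x₀ u) :=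
  hE.comp_continuous (continuous_clamp x₀) (clamp_mem hx₀)

lemma continuousOn_strip_integral (hx₀ : x₀ ≤ 0) (hT : 0 ≤ T)
    (hE : ContinuousOn E {u | u.re ∈ Icc x₀ 0})
    (hb : Continuous b) (hbm : ∀ s ∈ Icc 0 T, b s ∈ Icc 0 (-x₀)) :
    ContinuousOn (fun u => ∫ s in (0 : ℝ)..T, E (u * (b s : ℂ))) strip := by
  have h := continuous_comp_clamp hx₀ hE
  have : Continuous fun u : ℂ => ∫ s in (0 : ℝ)..T, E (clamp x₀ (u * (b s : ℂ))) :=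
    intervalIntegral.continuous_parametric_intervalIntegral_of_continuous'
      (f := fun (u : ℂ) s => E (clamp x₀ (u * (b s : ℂ))))
      (h.comp (by fun_prop : Continuous fun p : ℂ × ℝ => p.1 * (b p.2 : ℂ))) 0 T
  exact this.continuousOn.congr fun u hu => integral_clamp hT hbm hu

lemma re_strip_integral_le (hx₀ : x₀ ≤ 0) (hT : 0 ≤ T)
    (hE : ContinuousOn E {u | u.re ∈ Icc x₀ 0}) {C : ℝ}
        (hC : ∀ u : ℂ, u.re ∈ Icc x₀ 0 → (E u).re ≤ C)
    (hb : Continuous b) (hbm : ∀ s ∈ Icc 0 T, b s ∈ Icc 0 (-x₀)) {u : ℂ} (hu : u ∈ strip) :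
    (∫ s in (0 : ℝ)..T, E (u * (b s : ℂ))).re ≤ T * C := by
  have hc : Continuous fun s => E (clamp x₀ (u * (b s : ℂ))) :=
    (continuous_comp_clamp hx₀ hE).comp (by fun_prop)
  rw [integral_clamp hT hbm hu]
  have h1 : (∫ s in (0 : ℝ)..T, E (clamp x₀ (u * (b s : ℂ)))).re
      = ∫ s in (0 : ℝ)..T, (E (clamp x₀ (u * (b s : ℂ)))).re :=
    (Complex.reCLM.intervalIntegral_comp_comm (hc.intervalIntegrable 0 T)).symm
  rw [h1]
  refine (intervalIntegral.integral_mono_on hT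
    ((Complex.continuous_re.comp hc).intervalIntegrable 0 T)
    (intervalIntegrable_const (c := C)) fun s _ => hC _ (clamp_mem hx₀ _)).trans ?_
  simp

/-- For `b s > 0` multiplication by `b s` maps the open unit strip into the open strip on which `E`
is holomorphic. This may fail at `s = 0`, a null set omitted by integrating over `Ioc 0 T`. -/
lemma differentiableOn_strip_integral (hx₀ : x₀ ≤ 0) (hT : 0 ≤ T)
    (hE : ContinuousOn E {u | u.re ∈ Icc x₀ 0}) (hd : DifferentiableOn ℂ E {u | u.re ∈ Ioo x₀ 0})
    (hb : Continuous b) (hbm : ∀ s ∈ Icc 0 T, b s ∈ Icc 0 (-x₀)) (hb0 : ∀ s ∈ Ioc 0 T, 0 < b s) :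
    DifferentiableOn ℂ (fun u => ∫ s in (0 : ℝ)..T, E (u * (b s : ℂ)))
      {u | u.re ∈ Ioo (-1 : ℝ) 0} := by
  intro u₀ hu₀
  set N := ‖u₀‖ + 1 with hN
  set U : Set ℂ := {u : ℂ | u.re ∈ Ioo (-1 : ℝ) 0} ∩ Metric.ball 0 N with hU
  have hUo : IsOpen U := (isOpen_Ioo.preimage Complex.continuous_re).inter Metric.isOpen_ball
  have hmem : u₀ ∈ U := ⟨hu₀, by simp [hN]⟩
  have hUs : ∀ u ∈ U, u ∈ strip := fun u hu => ⟨hu.1.1.le, hu.1.2.le⟩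
  have hc := continuous_comp_clamp hx₀ hE
  obtain ⟨C, hC⟩ := (isCompact_closedBall (0 : ℂ) (N * -x₀)).exists_bound_of_continuousOn
    hc.continuousOn
  have h1 : DifferentiableOn ℂ (fun u => ∫ s in Ioc 0 T, E (u * (b s : ℂ))) U := by
    refine differentiableOn_integral_of_dominated (f := fun s u => E (u * (b s : ℂ)))
      (bound := fun _ => C) hUo (fun u hu => ?_) ?_ ?_ (integrable_const C)
    · have h2 : Continuous fun s => E (clamp x₀ (u * (b s : ℂ))) := hc.comp (by fun_prop)
      refine h2.aestronglyMeasurable.congr ?_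
      refine ae_restrict_of_forall_mem measurableSet_Ioc fun s hs => ?_
      simp only [clamp_of_mem (re_mul_mem (hUs u hu) (hbm s ⟨hs.1.le, hs.2⟩))]
    · refine ae_restrict_of_forall_mem measurableSet_Ioc fun s hs => ?_
      have h2 : Differentiable ℂ fun u : ℂ => u * (b s : ℂ) := by fun_prop
      refine hd.comp h2.differentiableOn fun u hu => ?_
      have e : (u * (b s : ℂ)).re = u.re * b s := by simp
      have h3 := hb0 s hs
      have h4 := (hbm s ⟨hs.1.le, hs.2⟩).2
      have h5 := hu.1.1
      have h6 := hu.1.2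
      change (u * (b s : ℂ)).re ∈ Ioo x₀ 0
      rw [e]
      constructor <;> nlinarith
    · refine ae_restrict_of_forall_mem measurableSet_Ioc fun s hs u hu => ?_
      have hbs := hbm s ⟨hs.1.le, hs.2⟩
      rw [← clamp_of_mem (re_mul_mem (hUs u hu) hbs)]
      refine hC _ ?_
      rw [mem_closedBall_zero_iff, norm_mul, Complex.norm_real, Real.norm_of_nonneg hbs.1]
      exact mul_le_mul (mem_ball_zero_iff.1 hu.2).le hbs.2 hbs.1 (by positivity)
  simp_rw [intervalIntegral.integral_of_le hT]
  exact (h1.differentiableAt (hUo.mem_nhds hmem)).differentiableWithinAt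

end StripIntegral

/-! ### Real line: bond prices and yield curves -/

/-- The solution of the Riccati equation for `R u = β u`. -/
noncomputable def linearFlow (β s : ℝ) : ℝ := (Real.exp (β * s) - 1) / β

lemma continuous_linearFlow (β : ℝ) : Continuous (linearFlow β) := by
  unfold linearFlow; fun_prop

lemma hasDerivAt_linearFlow {β : ℝ} (hβ : β ≠ 0) (s : ℝ) :
    HasDerivAt (linearFlow β) (Real.exp (β * s)) s := by
  have h := ((((hasDerivAt_id s).const_mul β).exp).sub_const 1).div_const β
  refine h.congr_deriv ?_
  simp only [id, mul_one]
  field_simp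

lemma linearFlow_pos {β s : ℝ} (hβ : β < 0) (hs : 0 < s) : 0 < linearFlow β s :=
  div_pos_of_neg_of_neg (by
    have : Real.exp (β * s) < 1 := by
      rw [← Real.exp_zero]; exact Real.exp_lt_exp.2 (mul_neg_of_neg_of_pos hβ hs)
    linarith) hβ

lemma linearFlow_mono {β s t : ℝ} (hβ : β < 0) (hst : s ≤ t) : linearFlow β s ≤ linearFlow β t := by
  refine div_le_div_of_nonpos_of_le hβ.le ?_
  have : Real.exp (β * t) ≤ Real.exp (β * s) :=
      Real.exp_le_exp.2 (mul_le_mul_of_nonpos_left hst hβ.le)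
  linarith

lemma linearFlow_zero (β : ℝ) : linearFlow β 0 = 0 := by simp [linearFlow]

lemma linearFlow_lt {β : ℝ} (hβ : β < 0) (s : ℝ) : linearFlow β s < -(1 / β) := by
  have e : -(1 / β) = -1 / β := by ring
  rw [linearFlow, e, div_lt_div_right_of_neg hβ]
  linarith [Real.exp_pos (β * s)]

namespace AffineProcess

variable {Ω : Type*} [MeasurableSpace Ω] (X : AffineProcess StateSpace.line Ω)

/-- The bond price on the real line. -/
lemma bondPrice_line {β : ℝ} (hβ0 : β < 0) (hβ : ∀ u : ℂ, u.re = 0 → X.R u = β * u)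
    {L : LevyTriplet} (hL : ∀ u : ℂ, u.re = 0 → X.F u = L.exponent u)
    (hm : ∀ u ∈ Ioc (1 / β) 0, L.HasMoment u) {T : ℝ} (hT : 0 < T) (x : StateSpace.line.carrier) :
    X.bondPrice T x
      = Real.exp ((∫ s in (0 : ℝ)..T, L.realValue (-linearFlow β s)) - x * linearFlow β T) := by
  set b := linearFlow β with hb
  have hbT := linearFlow_pos hβ0 hT
  have hx₀ : -b T ≤ 0 := by linarith
  -- The flow stays below `-1 / β`, so only moments in `(1 / β, 0]` are used, and the one at `-b T`
  -- implies those at all earlier times.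
  have hmom : L.HasMoment (-b T) := hm _ ⟨by linarith [linearFlow_lt hβ0 T], hx₀⟩
  have hbc : Continuous b := continuous_linearFlow β
  have hbm : ∀ s ∈ Icc 0 T, b s ∈ Icc 0 (-(-b T)) := fun s hs => by
    rw [neg_neg]
    exact ⟨by rw [← linearFlow_zero β]; exact linearFlow_mono hβ0 hs.1, linearFlow_mono hβ0 hs.2⟩
  have hb0 : ∀ s ∈ Ioc 0 T, 0 < b s := fun s hs => linearFlow_pos hβ0 hs.1
  have hE := hmom.continuousOn_exponent
  obtain ⟨C, hC⟩ := isCompact_Icc.exists_bound_of_continuousOn hmom.continuousOn_realValue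
  have hC' : ∀ u : ℂ, u.re ∈ Icc (-b T) 0 → (L.exponent u).re ≤ C := fun u hu =>
    (hmom.re_exponent_le hu.1 hu.2).trans ((le_abs_self _).trans (hC _ hu))
  -- On the imaginary axis `H` is the characteristic function of the time integral; at `-1` it is
  -- the claimed price.
  let H : ℂ → ℂ := fun u => Complex.exp ((∫ s in (0 : ℝ)..T, L.exponent (u * (b s : ℂ)))
    + ((x : ℝ) : ℂ) * (u * (b T : ℂ)))
  have hF : Continuous fun θ : ℝ => X.F (θ * Complex.I) := by
    have h1 : Continuous fun θ : ℝ => L.exponent (θ * Complex.I) :=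
      L.hasMoment_zero.continuousOn_exponent.comp_continuous (by fun_prop) fun θ => by simp
    exact h1.congr fun θ => (hL _ (by simp)).symm
  have key := exp_moment_of_strip (X.aemeasurable_integral x hT.le) (H := H)
    (C := Real.exp (T * C + |(x : ℝ)| * b T)) ?_ ?_ ?_ ?_
  · have h1 : ∫ s in (0 : ℝ)..T, L.exponent (-1 * (b s : ℂ))
        = ((∫ s in (0 : ℝ)..T, L.realValue (-b s) : ℝ) : ℂ) := by
      rw [← intervalIntegral.integral_ofReal]
      refine intervalIntegral.integral_congr fun s _ => ?_
      have e : -1 * (b s : ℂ) = ((-b s : ℝ) : ℂ) := by push_cast; ring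
      simp only [e, L.exponent_ofReal]
    have h2 : H (-1) = ((Real.exp ((∫ s in (0 : ℝ)..T, L.realValue (-b s)) - x * b T) : ℝ) : ℂ) := by
      simp only [H]
      rw [h1]
      push_cast
      congr 1; ring
    rw [h2] at key
    exact_mod_cast key
  · refine Complex.continuous_exp.comp_continuousOn ?_
    refine (continuousOn_strip_integral hx₀ hT.le hE hbc hbm).add ?_
    exact (by fun_prop : Continuous fun u : ℂ => ((x : ℝ) : ℂ) * (u * (b T : ℂ))).continuousOn
  · intro u hu
    simp only [H]
    rw [Complex.norm_exp, Real.exp_le_exp, Complex.add_re]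
    refine add_le_add (re_strip_integral_le hx₀ hT.le hE hC' hbc hbm hu) ?_
    have e : (((x : ℝ) : ℂ) * (u * (b T : ℂ))).re = x * u.re * b T := by simp; ring
    rw [e]
    refine mul_le_mul_of_nonneg_right ?_ hbT.le
    refine (le_abs_self _).trans ?_
    rw [abs_mul]
    refine mul_le_of_le_one_right (abs_nonneg _) (abs_le.2 ⟨hu.1, hu.2.trans zero_le_one⟩)
  · refine DifferentiableOn.cexp ?_
    refine (differentiableOn_strip_integral hx₀ hT.le hE hmom.differentiableOn_exponent hbc hbm
      hb0).add ?_
    exact (by fun_prop : Differentiable ℂ fun u : ℂ => ((x : ℝ) : ℂ) * (u * (b T :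
        ℂ))).differentiableOn
  · intro y
    rw [X.charFun_integral hβ0 hβ hF hT y x]
    simp only [H]
    congr 1
    congr 1
    · refine intervalIntegral.integral_congr fun s _ => ?_
      have e : ((y * ((Real.exp (β * s) - 1) / β) : ℝ) : ℂ) * Complex.I
          = y * Complex.I * (b s : ℂ) := by
        simp only [hb, linearFlow]; push_cast; ring
      simp only [e]
      rw [hL]
      simp
    · simp only [hb, linearFlow]; push_cast; ring

theorem shapes_line (hX : X.FiniteCondition) {c : ℝ} (hc : c < 0) (hR : X.realR c = 1)
    (hlin : ¬ IsLinearFun X.realF ∨ ¬ IsLinearFun X.realR) (x : StateSpace.line.carrier) :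
    (IsNormal (fun T => X.yield T x) ∨ IsInverse (fun T => X.yield T x) ∨
        IsHumped (fun T => X.yield T x)) ∧
      (((x : ℝ) : EReal) ≤ X.bYNorm c → IsNormal (fun T => X.yield T x)) ∧
      (X.bYNorm c < ((x : ℝ) : EReal) → ((x : ℝ) : EReal) < X.bInv →
        IsHumped (fun T => X.yield T x)) ∧
      (X.bInv ≤ ((x : ℝ) : EReal) → IsInverse (fun T => X.yield T x)) := by
  obtain ⟨β, hβ, hβR⟩ := X.exists_R_eq (x := c) (by rw [hR]; exact EReal.coe_ne_top 1)
  have hβc : β * c = 1 := by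
    rw [hβR] at hR; exact_mod_cast hR
  have hβ0 : β < 0 := by
    by_contra h
    have := mul_nonpos_of_nonneg_of_nonpos (not_lt.1 h) hc.le
    linarith
  have hcβ : 1 / β = c := by
    rw [div_eq_iff hβ0.ne]; linarith
  have hρ : ∀ u, β * u = u / c := fun u => by
    rw [eq_div_iff hc.ne, mul_right_comm, hβc, one_mul]
  have hfin : ∀ u ∈ Ioc c 0, X.realF u < ⊤ := by
    have := hX rfl β fun y _ => hβR y
    rwa [if_pos hβ0, hcβ] at this
  obtain ⟨L, hL, hLF⟩ := levyExtension_spec (f := X.F) (hfin 0 ⟨hc, le_rfl⟩).ne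
  have hLF' : ∀ y, X.realF y = L.realExponent y := hLF
  have hm : ∀ u ∈ Ioc c 0, L.HasMoment u := by
    intro u hu
    by_contra h
    have := hfin u hu
    rw [hLF', L.realExponent_eq_top h] at this
    exact lt_irrefl _ this
  have hFeq : ∀ u ∈ Ioc c 0, X.realF u = (L.realValue u : ℝ) := fun u hu => by
    rw [hLF', (hm u hu).realExponent_eq hu.2]
  -- Here `R` is always linear, so `F` is not, and its triplet has a Gaussian part or jumps.
  have hne : L.a ≠ 0 ∨ L.m ≠ 0 := by
    by_contra h
    push Not at h
    rcases hlin with h1 | h1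
    · exact h1 ⟨L.b, fun u _ => by rw [hLF', L.realExponent_eq_linear h.1 h.2]⟩
    · exact h1 ⟨β, fun u _ => hβR u⟩
  have hsc := L.strictConvexOn_realValue hm hne
  have hcont : ContinuousOn L.realValue (Ioc c 0) := by
    intro u hu
    obtain ⟨v, hv, hvu⟩ := exists_between hu.1
    refine ((hm v ⟨hv, hvu.le.trans hu.2⟩).continuousOn_realValue u
      ⟨hvu.le, hu.2⟩).mono_of_mem_nhdsWithin ?_
    filter_upwards [self_mem_nhdsWithin, mem_nhdsWithin_of_mem_nhds (Ioi_mem_nhds hvu)] with w hw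
        hw2
    exact ⟨le_of_lt hw2, hw.2⟩
  set B : ℝ → ℝ := fun s => -linearFlow β s with hB
  have hBd : ∀ s, HasDerivAt B (B s / c - 1) s := by
    intro s
    refine (hasDerivAt_linearFlow hβ0.ne s).neg.congr_deriv ?_
    rw [← hρ]
    simp only [hB, linearFlow]
    have := hβ0.ne
    field_simp
    ring
  have hBc : Continuous B := (continuous_linearFlow β).neg
  have hBi : Continuous fun s => B s / c - 1 := by fun_prop
  have hRic : IsRiccati c (fun u => u / c) B :=
    { neg := hc
      convexOn := by
        have : (fun u : ℝ => u / c) = fun u => β * u := funext fun u => (hρ u).symm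
        rw [this]
        exact ((LinearMap.mul ℝ ℝ β).convexOn (convex_Iic 0))
      continuousOn := by fun_prop
      map_zero := zero_div c
      map_c := div_self hc.ne
      nonpos := fun t ht => by
        have := linearFlow_mono hβ0 ht
        rw [linearFlow_zero] at this
        simp only [hB]; linarith
      intervalIntegrable := fun T _ => hBi.intervalIntegrable 0 T
      eq_integral := fun T _ => by
        rw [intervalIntegral.integral_eq_sub_of_hasDerivAt (fun s _ => hBd s)
          (hBi.intervalIntegrable 0 T)]
        simp [hB, linearFlow_zero] }
  refine shapes_of_isRiccati X x hRic (f := L.realValue) hsc.convexOn hcont L.realValue_zero hFeq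
    (fun u _ => by rw [hβR, hρ]) ?_ ?_ (Or.inr ?_) (Or.inr fun u _ => rfl) ?_ ?_
  · rw [hLF']; exact L.tendsto_realValue hc hm
  · rw [hLF']; exact L.realExponent_ne_bot hc.le
  · refine hsc.add_convexOn ?_
    have : (fun u : ℝ => (x : ℝ) * (u / c)) = fun u => (x * β) * u := funext fun u => by
      rw [← hρ]; ring
    rw [this]
    exact (LinearMap.mul ℝ ℝ (x * β)).convexOn (convex_Ioc c 0)
  -- This case is void: the left derivative of `R` at zero is `β < 0`.
  · intro h
    exfalso
    have h1 : leftDerivZero X.realR = (β : EReal) := by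
      rw [leftDerivZero]
      have h2 : (fun u : ℝ => (X.realR u - X.realR 0) / (u : EReal))
          =ᶠ[𝓝[<] 0] fun _ => (β : EReal) := by
        filter_upwards [self_mem_nhdsWithin] with u hu
        have hu' : u ≠ 0 := ne_of_lt hu
        rw [hβR, hβR, mul_zero, EReal.coe_zero, sub_zero, ← EReal.coe_div,
          mul_div_cancel_right₀ _ hu']
      rw [limsup_congr h2, limsup_const]
    rw [h1] at h
    exact absurd (by exact_mod_cast h) (not_le.2 hβ0)
  · intro T hT
    have hprice := X.bondPrice_line hβ0 hβ hL (by rw [hcβ]; exact hm) hT x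
    rw [yield, hprice, Real.log_exp]
    have hmem : ∀ s ∈ uIcc 0 T, B s ∈ Ioc c 0 := fun s hs => by
      rw [uIcc_of_le hT.le] at hs
      exact hRic.mem hs.1
    have hi1 : IntervalIntegrable (fun s => L.realValue (B s)) volume 0 T :=
      (hcont.comp hBc.continuousOn hmem).intervalIntegrable
    have hi2 : IntervalIntegrable (fun s => (x : ℝ) * (B s / c)) volume 0 T :=
      (by fun_prop : Continuous fun s => (x : ℝ) * (B s / c)).intervalIntegrable 0 T
    have h3 : ∫ s in (0 : ℝ)..T, B s / c = B T + T := by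
      have h4 := hRic.eq_integral T hT.le
      rw [intervalIntegral.integral_sub ((by fun_prop : Continuous fun s => B s /
          c).intervalIntegrable 0 T)
        intervalIntegrable_const] at h4
      simp only [intervalIntegral.integral_const, smul_eq_mul, mul_one, sub_zero] at h4
      linarith
    rw [intervalIntegral.integral_add hi1 hi2, intervalIntegral.integral_const_mul, h3]
    simp only [hB]
    field_simp
    ring

end AffineProcess

end AffineYield

theorem theorem1 {Ω : Type*} [MeasurableSpace Ω] (D : AffineYield.StateSpace)
    (X : AffineYield.AffineProcess D Ω) (hX : X.FiniteCondition)
    (lam c : ℝ) (hlam : X.IsQuasiMeanReversion lam) (hpos : 0 < lam) (hc : lam = -1 / c)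
    (hF : ∃ u : ℝ, u ≤ 0 ∧ X.realF u ≠ 0)
    (hlin : ¬ AffineYield.IsLinearFun X.realF ∨ ¬ AffineYield.IsLinearFun X.realR) :
    ∀ x : D.carrier,
      (AffineYield.IsNormal (fun T => X.yield T x) ∨
        AffineYield.IsInverse (fun T => X.yield T x) ∨
        AffineYield.IsHumped (fun T => X.yield T x)) ∧
      (((x : ℝ) : EReal) ≤ X.bYNorm c → AffineYield.IsNormal (fun T => X.yield T x)) ∧
      (X.bYNorm c < ((x : ℝ) : EReal) → ((x : ℝ) : EReal) < X.bInv →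
        AffineYield.IsHumped (fun T => X.yield T x)) ∧
      (X.bInv ≤ ((x : ℝ) : EReal) → AffineYield.IsInverse (fun T => X.yield T x)) := by
  intro x
  obtain ⟨hc0, hR⟩ : c < 0 ∧ X.realR c = 1 := by
    -- The root behind `lam` is the given `c` because both equal `-1 / lam`; uniqueness of the root
    -- is not needed.
    rcases hlam with ⟨c', hc', hR, h⟩ | ⟨-, h⟩
    · have : c' = c := by
        rw [hc, div_eq_div_iff_comm] at h
        linarith
      exact this ▸ ⟨hc', hR⟩
    · exact absurd hpos (by rw [h]; exact lt_irrefl 0)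
  cases D with
  | halfLine => exact X.shapes_halfLine hc0 hR hF hlin x
  | line => exact X.shapes_line hX hc0 hR hlin x
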